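/- **Setting.** Let $\mathcal T$ be either $C_c^\infty(\mathbb R^3,\mathbb R)$ or the real Schwartz space on $\mathbb R^3$ (the theorem holds for both). Let $\mathcal S=\mathcal T\oplus\mathcal T\ni s=(s_0,s_1)$, $\eta(s,s')=\int_{\mathbb R^3}(s_1s'_0-s_0s'_1)\,dx$, $\mathrm{supp}\,s=\mathrm{supp}\,s_0\cup\mathrm{supp}\,s_1$, and let $\mathcal W(\mathcal S,\eta)$ be the Weyl C*-algebra, generated by unitaries $W(s)$ with $W(s)W(s')=e^{i\eta(s,s')/2}W(s+s')$. Let $\omega$ be a regular state of it, with GNS triple $(h^\omega,\Omega^\omega,\pi^\omega)$; regular means that $t\mapsto\pi^\omega(W(ts))$ is strongly continuous for all $s$. Let $\phi(s)$ be the self-adjoint field given by $\pi^\omega(W(ts))=e^{it\phi(s)}$. Let $h=h_+\oplus h_-$ with $h_+=L^2(\mathbb R^3,\mathbb C^4)$ and $h_-=L^2(\mathbb R^3,\mathbb C^{4,*})$. Let $F_a(h)$ be the fermionic Fock space with creation and annihilation operators $a^*$, $a$ and second quantizations $\Gamma_a$, $d\Gamma_a$, and set $\mathcal H^\omega=F_a(h)\otimes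 h^\omega$. The Dirac field is $\psi(w)=2^{-1/2}\big(a^*(w\oplus0)+a(0\oplus\bar w)\big)\otimes1$, $w\in h_+$. Let $\sigma$ be a real tempered distribution on $\mathbb R^3$ and $(\sigma\star f)(x)=\int\sigma(y)f(x-y)\,dy$. For $s\in\mathcal S$ let $u_{\sigma,s}$ be the unitary and $\mu_{\sigma,s}$ the self-adjoint operator (on its maximal domain) on $h$ given by $$u_{\sigma,s}(w_+\oplus w_-)=e^{-i\sigma\star s_0}w_+\oplus e^{i\sigma\star s_0}w_-,\qquad \mu_{\sigma,s}(w_+\oplus w_-)=(-\sigma\star s_0\,w_+)\oplus(\sigma\star s_0\,w_-).$$ The twisted field $\phi^\lambda(s)$ is the closure of $1\otimes\phi(s)+d\Gamma_a(\mu_{\sigma,s})\otimes1$ on the algebraic tensor product of the domains $\mathrm{Dom}\,d\Gamma_a(\mu_{\sigma,s})$ and $\mathrm{Dom}\,\phi(s)$. **Theorem.** 1. *CAR and CCR.* For $w,w'\in h_+$: $\psi(w)\psi(w')+\psi(w')\psi(w)=0$ and $\psi(w)\psi(w')^*+\psi(w')^*\psi(w)=\langle w',w\rangle 1$. For $s,s'\in\mathcal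 S$: $\phi^\lambda(s)$ is self-adjoint, $e^{i\phi^\lambda(s)}=\Gamma_a(u_{\sigma,s})\otimes\pi^\omega(W(s))$, $e^{i\phi^\lambda(s)}e^{i\phi^\lambda(s')}=e^{i\eta(s,s')/2}e^{i\phi^\lambda(s+s')}$, and $[\phi^\lambda(s),\phi^\lambda(s')]v=-i\eta(s,s')v$ for every $v$ in the natural domain of the commutator. 2. *Twisted relations.* For $s\in\mathcal S$ and $w\in C_c^\infty(\mathbb R^3,\mathbb C^4)$, $\psi(w)$ maps $\mathrm{Dom}\,\phi^\lambda(s)$ into itself, and there $$[\phi^\lambda(s),\psi(w)]=-\psi\big((\sigma\star s_0)\cdot w\big).$$ 3. *Local gauge transformations.* Let $P_\partial$ be a constant-coefficient differential operator with real coefficients, $P_\partial\sigma=\delta$, and put $P_\partial s=(P_\partial s_0,P_\partial s_1)$, $\varrho(s)=\phi^\lambda(P_\partial s)$. For all $s\in\mathcal S$ and $w\in h_+$, $\psi(w)$ maps $\mathrm{Dom}\,\varrho(s)$ into itself, and there $$[\varrho(s),\psi(w)]=-\psi(s_0w);\qquad\text{moreover}\qquad e^{i\varrho(s)}\psi(w)e^{-i\varrho(s)}=\psi(e^{-is_0}w).$$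 In particular, if $\mathrm{supp}\,s\cap\mathrm{supp}\,w=\emptyset$, then $\varrho(s)$ (on its domain) and $e^{i\varrho(s)}$ commute with $\psi(w)$. 4. *Charged states.* Let $q\in\mathbb Z$ and let $\Omega^q_f$ be an antisymmetrized product $f_1\otimes_a\cdots\otimes_a f_n$, scaled to norm $1$, with $f_i\in h_{q_i}$, $q_i=\pm1$, $\sum_iq_i=q$ (here $n\ge0$; for $n=0$ it is the vacuum). Let $\mathrm{supp}\,\Omega^q_f$ be the union of the (essential) supports of the $f_i$. There is a state $\omega_{\sigma,q}$ of $\mathcal W(\mathcal S,\eta)$ with $$\omega_{\sigma,q}(W(s))=\langle\Omega^q_f,\Gamma_a(u_{\sigma,s})\Omega^q_f\rangle\,\omega(W(s)),\qquad s\in\mathcal S.$$ On the closed span of the vectors $e^{i\phi^\lambda(s)}(\Omega^q_f\otimes\Omega^\omega)$, $s\in\mathcal S$, there is a representation of $\mathcal W(\mathcal S,\eta)$ in which $W(s)$ acts as $e^{i\phi^\lambda(s)}$. Together with the vector $\Omega^q_f\otimes\Omega^\omega$ it is a GNS triple of $\omega_{\sigma,q}$. 5. *Localization.* $\omega_{\sigma,q}(W(s))=\omega(W(s))$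 whenever $\mathrm{supp}\,s$ is disjoint from $\mathrm{supp}\,\Omega^q_f-\mathrm{supp}\,\sigma=\{x-y: x\in\mathrm{supp}\,\Omega^q_f,\ y\in\mathrm{supp}\,\sigma\}$. If $\mathrm{supp}\,\sigma=-\mathrm{supp}\,\sigma$, this set is $\mathrm{supp}\,\Omega^q_f+\mathrm{supp}\,\sigma$. If $P_\partial\sigma=\delta$ for some $P_\partial$ as in 3, then $\omega_{\sigma,q}(W(P_\partial s))=\omega(W(P_\partial s))$ whenever $\mathrm{supp}\,s\cap\mathrm{supp}\,\Omega^q_f=\emptyset$. -/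

import Mathlib

open scoped InnerProductSpace ComplexOrder ComplexConjugate SchwartzMap LineDeriv Topology Pointwise
open MeasureTheory

namespace TwistedFieldModel

noncomputable section

section Fock
variable (V : Type*) [NormedAddCommGroup V] [InnerProductSpace ℂ V]

/-- The Gram determinant `det ⟨f_i, g_j⟩` of two finite families of the same length, and `0` for
families of different length. -/
def detKernel (a b : Σ n : ℕ, (Fin n → V)) : ℂ :=
  if h : a.1 = b.1 then
    Matrix.det (Matrix.of fun i j : Fin a.1 => ⟪a.2 i, b.2 (Fin.cast h j)⟫_ℂ)
  else 0

/-- Formal linear combinations of symbols `f_1 ∧ ... ∧ f_n`, `n ≥ 0`, `f_i ∈ V`. -/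
def PreFock : Type _ := (Σ n : ℕ, (Fin n → V)) →₀ ℂ

instance : AddCommGroup (PreFock V) := inferInstanceAs (AddCommGroup ((Σ n : ℕ, (Fin n → V)) →₀ ℂ))
instance : Module ℂ (PreFock V) := inferInstanceAs (Module ℂ ((Σ n : ℕ, (Fin n → V)) →₀ ℂ))

variable {V}

theorem detKernel_conj (a b : Σ n : ℕ, (Fin n → V)) :
    conj (detKernel V b a) = detKernel V a b := by
  obtain ⟨n, v⟩ := a
  obtain ⟨m, w⟩ := b
  by_cases h : n = m
  · subst h
    simp only [detKernel, dite_true, Fin.cast_eq_self]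
    rw [← Complex.star_def, ← Matrix.det_conjTranspose]
    congr 1
    ext i j
    simp [Matrix.conjTranspose_apply]
  · simp [detKernel, h, Ne.symm h]

theorem det_mul_average {n N : ℕ} (A : Fin n → Fin N → ℂ) (B : Fin N → Fin n → ℂ) :
    (n.factorial : ℂ) * Matrix.det (Matrix.of fun i j => ∑ k, A i k * B k j) =
      ∑ κ : Fin n → Fin N, Matrix.det (Matrix.of fun i j => A i (κ j)) *
        Matrix.det (Matrix.of fun i j => B (κ i) j) := by
  have h1 : Matrix.det (Matrix.of fun i j => ∑ k, A i k * B k j) =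
      ∑ κ : Fin n → Fin N, (∏ i, A i (κ i)) * Matrix.det (Matrix.of fun i j => B (κ i) j) := by
    have := (Matrix.detRowAlternating (n := Fin n) (R := ℂ)).toMultilinearMap.map_sum
      (fun i (k : Fin N) => A i k • B k)
    have e : (fun i => ∑ k, A i k • B k) = (Matrix.of fun i j => ∑ k, A i k * B k j) := by
      ext i j; simp
    rw [e] at this
    refine this.trans ?_
    refine Finset.sum_congr rfl fun κ _ => ?_
    exact (Matrix.detRowAlternating (n := Fin n) (R := ℂ)).toMultilinearMap.map_smul_univ
      (fun i => A i (κ i)) (fun i => B (κ i))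
  have h2 : ∀ τ : Equiv.Perm (Fin n), Matrix.det (Matrix.of fun i j => ∑ k, A i k * B k j) =
      ∑ κ : Fin n → Fin N, ((Equiv.Perm.sign τ : ℤ) : ℂ) * (∏ i, A i (κ (τ i))) *
        Matrix.det (Matrix.of fun i j => B (κ i) j) := by
    intro τ
    rw [h1, ← (Equiv.arrowCongr τ (Equiv.refl (Fin N))).symm.sum_comp]
    refine Finset.sum_congr rfl fun κ _ => ?_
    have : Matrix.det (Matrix.of fun i j => B (κ (τ i)) j) =
        ((Equiv.Perm.sign τ : ℤ) : ℂ) * Matrix.det (Matrix.of fun i j => B (κ i) j) :=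
      Matrix.det_permute τ (Matrix.of fun i j => B (κ i) j)
    simp only [Equiv.arrowCongr, Equiv.coe_fn_symm_mk, Equiv.coe_refl, Function.comp_def,
      Equiv.refl_symm, id] at *
    rw [this]
    ring
  have h3 : (n.factorial : ℂ) * Matrix.det (Matrix.of fun i j => ∑ k, A i k * B k j) =
      ∑ τ : Equiv.Perm (Fin n), Matrix.det (Matrix.of fun i j => ∑ k, A i k * B k j) := by
    simp [Fintype.card_perm]
  rw [h3, Finset.sum_congr rfl (fun τ _ => h2 τ), Finset.sum_comm]
  refine Finset.sum_congr rfl fun κ _ => ?_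
  rw [← Finset.sum_mul]
  congr 1
  rw [← Matrix.det_transpose, Matrix.det_apply']
  rfl

theorem detKernel_sum_nonneg (x : (Σ n : ℕ, (Fin n → V)) →₀ ℂ) :
    0 ≤ x.sum fun a c => x.sum fun b d => conj c * d * detKernel V a b := by
  classical
  let W : Submodule ℂ V := Submodule.span ℂ (⋃ a ∈ x.support, Set.range a.2)
  have hfin : (⋃ a ∈ x.support, Set.range a.2).Finite :=
    Set.Finite.biUnion x.support.finite_toSet fun a _ => Set.finite_range _
  have : FiniteDimensional ℂ W := FiniteDimensional.span_of_finite ℂ hfin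
  let e := stdOrthonormalBasis ℂ W
  have hmem : ∀ a ∈ x.support, ∀ i, a.2 i ∈ W := fun a ha i =>
    Submodule.subset_span (Set.mem_biUnion ha ⟨i, rfl⟩)
  have hin : ∀ v ∈ W, ∀ w ∈ W, ⟪v, w⟫_ℂ = ∑ k, ⟪v, (e k : V)⟫_ℂ * ⟪(e k : V), w⟫_ℂ := by
    intro v hv w hw
    exact (e.sum_inner_mul_inner (⟨v, hv⟩ : W) ⟨w, hw⟩).symm
  let m : (n : ℕ) → (Fin n → Fin (Module.finrank ℂ W)) → (Σ n : ℕ, (Fin n → V)) → ℂ :=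
    fun n κ a => if h : n = a.1 then
      Matrix.det (Matrix.of fun i j : Fin n => ⟪(e (κ i) : V), a.2 (Fin.cast h j)⟫_ℂ) else 0
  have hK : ∀ a ∈ x.support, ∀ b ∈ x.support, detKernel V a b =
      ∑ n ∈ x.support.image Sigma.fst, (n.factorial : ℂ)⁻¹ * ∑ κ, conj (m n κ a) * m n κ b := by
    intro a ha b hb
    rw [Finset.sum_eq_single a.1]
    · by_cases h : a.1 = b.1
      · have hf : (a.1.factorial : ℂ) ≠ 0 := by exact_mod_cast Nat.factorial_ne_zero _
        rw [eq_inv_mul_iff_mul_eq₀ hf]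
        have := det_mul_average (fun i k => ⟪a.2 i, (e k : V)⟫_ℂ)
          (fun k j => ⟪(e k : V), b.2 (Fin.cast h j)⟫_ℂ)
        have e1 : (Matrix.of fun i j : Fin a.1 => ⟪a.2 i, b.2 (Fin.cast h j)⟫_ℂ) =
            Matrix.of fun i j => ∑ k, ⟪a.2 i, (e k : V)⟫_ℂ * ⟪(e k : V), b.2 (Fin.cast h j)⟫_ℂ := by
          ext i j
          exact hin _ (hmem a ha i) _ (hmem b hb _)
        rw [detKernel, dif_pos h, e1, this]
        refine Finset.sum_congr rfl fun κ _ => ?_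
        have hm1 : m a.1 κ a = Matrix.det (Matrix.of fun i j => ⟪(e (κ i) : V), a.2 j⟫_ℂ) :=
          dif_pos rfl
        have hm2 : m a.1 κ b =
            Matrix.det (Matrix.of fun i j => ⟪(e (κ i) : V), b.2 (Fin.cast h j)⟫_ℂ) := dif_pos h
        rw [hm1, hm2]
        congr 1
        rw [← Complex.star_def, ← Matrix.det_conjTranspose]
        congr 1
        ext i j
        simp [Matrix.conjTranspose_apply]
      · simp [detKernel, h, m]
    · intro n _ hn
      simp [m, hn]
    · intro h
      exact absurd (Finset.mem_image_of_mem _ ha) h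
  have : (x.sum fun a c => x.sum fun b d => conj c * d * detKernel V a b) =
      ∑ n ∈ x.support.image Sigma.fst, (n.factorial : ℂ)⁻¹ * ∑ κ,
        conj (∑ a ∈ x.support, x a * m n κ a) * (∑ a ∈ x.support, x a * m n κ a) := by
    simp only [Finsupp.sum]
    calc _ = ∑ a ∈ x.support, ∑ b ∈ x.support, ∑ n ∈ x.support.image Sigma.fst,
          ∑ κ, (n.factorial : ℂ)⁻¹ * (conj (x a * m n κ a) * (x b * m n κ b)) := by
          refine Finset.sum_congr rfl fun a ha => Finset.sum_congr rfl fun b hb => ?_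
          rw [hK a ha b hb, Finset.mul_sum]
          refine Finset.sum_congr rfl fun n _ => ?_
          rw [Finset.mul_sum, Finset.mul_sum]
          refine Finset.sum_congr rfl fun κ _ => ?_
          rw [map_mul]; ring
      _ = _ := by
          have : ∀ a ∈ x.support, (∑ b ∈ x.support, ∑ n ∈ x.support.image Sigma.fst,
              ∑ κ, (n.factorial : ℂ)⁻¹ * (conj (x a * m n κ a) * (x b * m n κ b))) =
              ∑ n ∈ x.support.image Sigma.fst, ∑ κ, ∑ b ∈ x.support,
                (n.factorial : ℂ)⁻¹ * (conj (x a * m n κ a) * (x b * m n κ b)) := by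
            intro a _
            rw [Finset.sum_comm]
            exact Finset.sum_congr rfl fun n _ => Finset.sum_comm
          rw [Finset.sum_congr rfl this, Finset.sum_comm]
          refine Finset.sum_congr rfl fun n _ => ?_
          rw [Finset.sum_comm, Finset.mul_sum]
          refine Finset.sum_congr rfl fun κ _ => ?_
          rw [map_sum, Finset.sum_mul_sum, Finset.mul_sum]
          refine Finset.sum_congr rfl fun a _ => ?_
          rw [Finset.mul_sum]
  rw [this]
  refine Finset.sum_nonneg fun n _ => mul_nonneg ?_ (Finset.sum_nonneg fun κ _ => ?_)
  · rw [← Complex.ofReal_natCast, ← Complex.ofReal_inv]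
    exact Complex.zero_le_real.mpr (by positivity)
  · rw [mul_comm, Complex.mul_conj]
    exact Complex.zero_le_real.mpr (Complex.normSq_nonneg _)

/-- The sesquilinear extension of the Gram determinant. -/
def gramForm (x y : (Σ n : ℕ, (Fin n → V)) →₀ ℂ) : ℂ :=
  x.sum fun a c => y.sum fun b d => conj c * d * detKernel V a b

theorem gramForm_conj (x y : (Σ n : ℕ, (Fin n → V)) →₀ ℂ) :
    conj (gramForm y x) = gramForm x y := by
  simp only [gramForm, Finsupp.sum, map_sum, map_mul, Complex.conj_conj, detKernel_conj]
  rw [Finset.sum_comm]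
  refine Finset.sum_congr rfl fun a _ => Finset.sum_congr rfl fun b _ => ?_
  ring

theorem gramForm_add (x y z : (Σ n : ℕ, (Fin n → V)) →₀ ℂ) :
    gramForm (x + y) z = gramForm x z + gramForm y z := by
  classical
  refine Finsupp.sum_add_index' (h := fun a c => z.sum fun b d =>
    conj c * d * detKernel V a b) (fun a => by simp [Finsupp.sum]) (fun a c c' => ?_)
  simp only [Finsupp.sum, map_add, add_mul, Finset.sum_add_distrib]

theorem gramForm_smul (x y : (Σ n : ℕ, (Fin n → V)) →₀ ℂ) (r : ℂ) :
    gramForm (r • x) y = conj r * gramForm x y := by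
  rw [gramForm, Finsupp.sum_smul_index' (fun a => by simp [Finsupp.sum])]
  simp only [gramForm, Finsupp.sum, Finset.mul_sum, smul_eq_mul, map_mul, mul_assoc]

/-- The semi-inner product `⟨f_1 ∧ ... ∧ f_n, g_1 ∧ ... ∧ g_m⟩ = δ_{nm} det ⟨f_i, g_j⟩`. -/
abbrev preFockCore : PreInnerProductSpace.Core ℂ (PreFock V) where
  inner x y := gramForm x y
  conj_inner_symm x y := gramForm_conj x y
  re_inner_nonneg x := (Complex.nonneg_iff.mp (detKernel_sum_nonneg x)).1
  add_left x y z := gramForm_add x y z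
  smul_left x y r := gramForm_smul x y r

instance : SeminormedAddCommGroup (PreFock V) :=
  InnerProductSpace.Core.toSeminormedAddCommGroup (c := preFockCore)
instance : InnerProductSpace ℂ (PreFock V) := InnerProductSpace.ofCore preFockCore

variable (V) in
/-- The fermionic Fock space over `V`: the Hilbert space completion (with null vectors identified
with `0`) of the space of formal wedge products. -/
abbrev Fock : Type _ := UniformSpace.Completion (PreFock V)

variable (V) in
/-- The identity map, regarded as a map into the space of formal wedge products. -/
def PreFock.mk : ((Σ n : ℕ, (Fin n → V)) →₀ ℂ) →ₗ[ℂ] PreFock V := LinearMap.id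

/-- The product vector `f_1 ∧ ... ∧ f_n = √(n!) P_a (f_1 ⊗ ... ⊗ f_n)`, a scalar multiple of
`f_1 ⊗_a ... ⊗_a f_n`; for `n = 0` it is the vacuum. -/
def wedge {n : ℕ} (f : Fin n → V) : Fock V :=
  UniformSpace.Completion.toComplL (𝕜 := ℂ) (PreFock.mk V (Finsupp.single ⟨n, f⟩ 1))

theorem inner_wedge {n : ℕ} (f g : Fin n → V) :
    ⟪wedge f, wedge g⟫_ℂ = Matrix.det (Matrix.of fun i j => ⟪f i, g j⟫_ℂ) := by
  refine (UniformSpace.Completion.inner_coe _ _).trans ?_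
  change gramForm (Finsupp.single _ _) (Finsupp.single _ _) = _
  simp [gramForm, detKernel]

theorem inner_wedge_of_ne {n m : ℕ} (h : n ≠ m) (f : Fin n → V) (g : Fin m → V) :
    ⟪wedge f, wedge g⟫_ℂ = 0 := by
  refine (UniformSpace.Completion.inner_coe _ _).trans ?_
  change gramForm (Finsupp.single _ _) (Finsupp.single _ _) = _
  simp [gramForm, detKernel, h]

theorem dense_span_wedge :
    Dense (Submodule.span ℂ {x : Fock V | ∃ (n : ℕ) (f : Fin n → V), x = wedge f} :
      Set (Fock V)) := by
  refine (UniformSpace.Completion.denseRange_coe (α := PreFock V)).mono ?_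
  rintro _ ⟨x, rfl⟩
  suffices h : ∀ y, UniformSpace.Completion.toComplL (𝕜 := ℂ) (PreFock.mk V y) ∈
      Submodule.span ℂ {x : Fock V | ∃ (n : ℕ) (f : Fin n → V), x = wedge f} from h x
  intro y
  induction y using Finsupp.induction_linear with
  | zero => rw [map_zero, map_zero]; exact Submodule.zero_mem _
  | add x y hx hy => rw [map_add, map_add]; exact Submodule.add_mem _ hx hy
  | single a c =>
    have h : Finsupp.single a c = c • Finsupp.single a (1 : ℂ) := by simp
    rw [h, map_smul, map_smul]
    exact Submodule.smul_mem _ _ (Submodule.subset_span ⟨a.1, a.2, rfl⟩)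

theorem eq_of_eq_on_wedge {S T : Fock V →L[ℂ] Fock V}
    (h : ∀ (n : ℕ) (f : Fin n → V), S (wedge f) = T (wedge f)) : S = T := by
  refine ContinuousLinearMap.ext_on dense_span_wedge ?_
  rintro _ ⟨n, f, rfl⟩
  exact h n f

open Classical in
/-- The creation operator `a^*(f)`: the bounded operator with
`a^*(f) (g_1 ∧ ... ∧ g_n) = f ∧ g_1 ∧ ... ∧ g_n`
(it exists, and it is unique by `eq_of_eq_on_wedge`). -/
def creation (f : V) : Fock V →L[ℂ] Fock V :=
  if h : ∃ T : Fock V →L[ℂ] Fock V, ∀ (n : ℕ) (g : Fin n → V),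
      T (wedge g) = wedge (Fin.cons f g : Fin (n + 1) → V)
  then h.choose else 0

/-- The annihilation operator `a(f)`, the adjoint of `a^*(f)`; it is antilinear in `f`. -/
def annihilation (f : V) : Fock V →L[ℂ] Fock V := ContinuousLinearMap.adjoint (creation f)

open Classical in
/-- Second quantization `Γ_a(T)`: the bounded operator with
`Γ_a(T) (f_1 ∧ ... ∧ f_n) = T f_1 ∧ ... ∧ T f_n`
(it exists for every linear isometry `T`, and it is unique by `eq_of_eq_on_wedge`). -/
def secondQuant (T : V → V) : Fock V →L[ℂ] Fock V :=
  if h : ∃ G : Fock V →L[ℂ] Fock V, ∀ (n : ℕ) (f : Fin n → V),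
      G (wedge f) = wedge (fun i => T (f i))
  then h.choose else 0

/-- Second quantization `dΓ_a(A)` of an unbounded operator `A`: the closure of the operator
`f_1 ∧ ... ∧ f_n ↦ ∑ k, f_1 ∧ ... ∧ A f_k ∧ ... ∧ f_n`, `f_i ∈ Dom A`, extended linearly. -/
def diffSecondQuant (A : V →ₗ.[ℂ] V) : Fock V →ₗ.[ℂ] Fock V :=
  (Submodule.span ℂ {p : Fock V × Fock V | ∃ (n : ℕ) (f : Fin n → A.domain),
      p = (wedge (fun i => (f i : V)),
        ∑ k, wedge (Function.update (fun i => (f i : V)) k (A (f k))))}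
    ).topologicalClosure.toLinearPMap

end Fock

section Weyl
variable {S : Type*}

/-- The phase `e^{i η(s,t) / 2}`. -/
def weylPhase (η : S → S → ℝ) (s t : S) : ℂ := Complex.exp (Complex.I * (η s t : ℂ) / 2)

theorem norm_weylPhase (η : S → S → ℝ) (s t : S) : ‖weylPhase η s t‖ = 1 := by
  rw [weylPhase, show Complex.I * (η s t : ℂ) / 2 = ((η s t / 2 : ℝ) : ℂ) * Complex.I by
    push_cast; ring, Complex.norm_exp_ofReal_mul_I]

variable [AddCommGroup S]

/-- The Weyl operator on `ℓ²(S)`: `W(s) δ_t = e^{i η(s,t) / 2} δ_{s+t}`. -/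
def weylOp (η : S → S → ℝ) (s : S) :
    lp (fun _ : S => ℂ) 2 →L[ℂ] lp (fun _ : S => ℂ) 2 :=
  LinearIsometry.toContinuousLinearMap
    { toFun := fun ξ => ⟨fun t => weylPhase η s (t - s) * ξ (t - s), by
        have h := lp.memℓp ξ
        change Memℓp _ _
        rw [memℓp_gen_iff (by norm_num)] at h ⊢
        simp only [norm_mul, norm_weylPhase, one_mul]
        exact (Equiv.subRight s).summable_iff.mpr h⟩
      map_add' := fun ξ ζ => by ext t; exact mul_add _ _ _
      map_smul' := fun c ξ => by ext t; exact mul_left_comm _ _ _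
      norm_map' := fun ξ => by
        rw [lp.norm_eq_tsum_rpow (by norm_num), lp.norm_eq_tsum_rpow (by norm_num)]
        congr 1
        simp only [LinearMap.coe_mk, AddHom.coe_mk, norm_mul, norm_weylPhase, one_mul]
        exact (Equiv.subRight s).tsum_eq fun t => ‖ξ t‖ ^ (2 : ENNReal).toReal }

/-- The Weyl C*-algebra of `(S, η)`: the C*-algebra generated by the operators `W(s)` on `ℓ²(S)`.
For a symplectic form `η` one has `W(s) W(s') = e^{i η(s,s') / 2} W(s + s')`, and this C*-algebra is
up to isomorphism the only one generated by nonzero elements satisfying the Weyl relations. -/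
def WeylAlgebra (η : S → S → ℝ) :
    StarSubalgebra ℂ (lp (fun _ : S => ℂ) 2 →L[ℂ] lp (fun _ : S => ℂ) 2) :=
  (StarAlgebra.adjoin ℂ (Set.range (weylOp η))).topologicalClosure

/-- The generator `W(s)` of the Weyl algebra. -/
def weyl (η : S → S → ℝ) (s : S) : WeylAlgebra η :=
  ⟨weylOp η s, StarSubalgebra.le_topologicalClosure _
    (StarAlgebra.subset_adjoin ℂ _ ⟨s, rfl⟩)⟩

/-- The C*-algebra of bounded operators on a Hilbert space. -/
abbrev BoundedOp (H : Type*) [NormedAddCommGroup H] [InnerProductSpace ℂ H] : Type _ := H →L[ℂ] H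

/-- A state: a positive normalized linear functional. -/
structure IsState {η : S → S → ℝ} (ω : WeylAlgebra η →ₗ[ℂ] ℂ) : Prop where
  nonneg : ∀ a, 0 ≤ ω (star a * a)
  normalized : ω 1 = 1

/-- `(H, Ω, π)` is a GNS triple of `ω`. -/
structure IsGNSTriple {η : S → S → ℝ} (ω : WeylAlgebra η →ₗ[ℂ] ℂ)
    {H : Type*} [NormedAddCommGroup H] [InnerProductSpace ℂ H] [CompleteSpace H]
    (π : WeylAlgebra η →⋆ₐ[ℂ] (H →L[ℂ] H)) (Ω : H) : Prop where
  cyclic : DenseRange fun a => π a Ω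
  apply : ∀ a, ω a = ⟪Ω, π a Ω⟫_ℂ

/-- Regularity of a representation (a state is regular if its GNS representation is):
`t ↦ π(W(t s))` is strongly continuous for every `s`. -/
def IsRegular [Module ℝ S] {η : S → S → ℝ}
    {H : Type*} [NormedAddCommGroup H] [InnerProductSpace ℂ H] [CompleteSpace H]
    (π : WeylAlgebra η →⋆ₐ[ℂ] (H →L[ℂ] H)) : Prop :=
  ∀ (s : S) (v : H), Continuous fun t : ℝ => π (weyl η (t • s)) v
end Weyl

section Generators
variable {H K : Type*} [NormedAddCommGroup H] [InnerProductSpace ℂ H] [CompleteSpace H]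
  [NormedAddCommGroup K] [InnerProductSpace ℂ K] [CompleteSpace K]

/-- Strongly continuous one-parameter unitary groups. -/
structure IsUnitaryGroup (U : ℝ → H →L[ℂ] H) : Prop where
  unitary : ∀ t, U t ∈ unitary (H →L[ℂ] H)
  zero : U 0 = 1
  add : ∀ s t, U (s + t) = U s * U t
  continuous : ∀ v, Continuous fun t => U t v

/-- The Stone generator `A` of `U(t) = e^{i t A}`: `A v = -i d/dt U(t) v` at `t = 0`, on the domain
of all `v` for which the derivative exists. -/
def stoneGenerator (U : ℝ → H →L[ℂ] H) : H →ₗ.[ℂ] H where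
  domain :=
    { carrier := {v | DifferentiableAt ℝ (fun t => U t v) 0}
      add_mem' := fun {v w} hv hw => by
        simpa only [Set.mem_ofPred_eq, map_add] using DifferentiableAt.fun_add hv hw
      zero_mem' := by simp
      smul_mem' := fun c v hv => by
        simpa only [Set.mem_ofPred_eq, map_smul] using DifferentiableAt.fun_const_smul hv c }
  toFun :=
    { toFun := fun v => (-Complex.I) • deriv (fun t => U t (v : H)) 0
      map_add' := fun v w => by
        simp only [Submodule.coe_add, map_add]
        rw [deriv_fun_add v.2 w.2, smul_add]
      map_smul' := fun c v => by
        simp only [Submodule.coe_smul, map_smul, RingHom.id_apply]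
        rw [deriv_fun_const_smul c v.2, smul_comm] }

open Classical in
/-- `e^{iA}`: the value at `t = 1` of the (unique) strongly continuous unitary group with Stone
generator `A`; it exists if and only if `A` is self-adjoint. -/
def expI (A : H →ₗ.[ℂ] H) : H →L[ℂ] H :=
  if h : ∃ U : ℝ → H →L[ℂ] H, IsUnitaryGroup U ∧ stoneGenerator U = A then h.choose 1 else 0

variable (H K) in
/-- The Hilbert space tensor product. -/
abbrev HilbertTensor : Type _ := UniformSpace.Completion (TensorProduct ℂ H K)

/-- The vector `v ⊗ w`. -/
def tmul (v : H) (w : K) : HilbertTensor H K :=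
  UniformSpace.Completion.toComplL (𝕜 := ℂ) (v ⊗ₜ[ℂ] w)

/-- The bounded operator `S ⊗ T`. -/
def tensorOp (S : H →L[ℂ] H) (T : K →L[ℂ] K) : HilbertTensor H K →L[ℂ] HilbertTensor H K :=
  (TensorProduct.mapL S T).completion

/-- The operator `A ⊗ 1 + 1 ⊗ B`: the closure of the operator defined on the linear span of
`{v ⊗ w | v ∈ Dom A, w ∈ Dom B}`. -/
def tensorSum (A : H →ₗ.[ℂ] H) (B : K →ₗ.[ℂ] K) : HilbertTensor H K →ₗ.[ℂ] HilbertTensor H K :=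
  (Submodule.span ℂ {p : HilbertTensor H K × HilbertTensor H K |
    ∃ (v : A.domain) (w : B.domain),
      p = (tmul (v : H) (w : K), tmul (A v) (w : K) + tmul (v : H) (B w))}
    ).topologicalClosure.toLinearPMap
end Generators

section Concrete

/-- Physical space `ℝ³`. -/
abbrev Space := EuclideanSpace ℝ (Fin 3)

/-- The spin space `ℂ⁴`; its dual `ℂ^{4,*}` is identified with it through the dual basis. -/
abbrev Spinor := EuclideanSpace ℂ (Fin 4)

/-- Real tempered distributions on `ℝ³`. -/
abbrev Distr := 𝓢(Space, ℝ) →L[ℝ] ℝ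

/-- The function `y ↦ f (x - y)`. -/
def reflectedTranslate (x : Space) (f : 𝓢(Space, ℝ)) : 𝓢(Space, ℝ) :=
  SchwartzMap.compSubConstCLM ℝ x
    (SchwartzMap.compCLMOfContinuousLinearEquiv ℝ (ContinuousLinearEquiv.neg ℝ) f)

theorem reflectedTranslate_apply (x y : Space) (f : 𝓢(Space, ℝ)) :
    reflectedTranslate x f y = f (x - y) := by
  simp [reflectedTranslate]

/-- The convolution `(σ ⋆ f)(x) = ∫ σ(y) f(x - y) dy`. -/
def conv (σ : Distr) (f : 𝓢(Space, ℝ)) (x : Space) : ℝ := σ (reflectedTranslate x f)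

/-- The partial derivative `∂^α`. -/
def multiDeriv (α : Fin 3 →₀ ℕ) (f : 𝓢(Space, ℝ)) : 𝓢(Space, ℝ) :=
  (fun g => ∂_{EuclideanSpace.single (0 : Fin 3) (1 : ℝ)} g)^[α 0]
    ((fun g => ∂_{EuclideanSpace.single (1 : Fin 3) (1 : ℝ)} g)^[α 1]
      ((fun g => ∂_{EuclideanSpace.single (2 : Fin 3) (1 : ℝ)} g)^[α 2] f))

/-- The constant-coefficient differential operator `P_∂ = ∑ c_α ∂^α` with symbol
`P = ∑ c_α X^α`. -/
def diffOp (P : MvPolynomial (Fin 3) ℝ) (f : 𝓢(Space, ℝ)) : 𝓢(Space, ℝ) :=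
  ∑ α ∈ P.support, P.coeff α • multiDeriv α f

/-- The formal transpose `∑ (-1)^|α| c_α ∂^α` of `P_∂`. -/
def transposeDiffOp (P : MvPolynomial (Fin 3) ℝ) (f : 𝓢(Space, ℝ)) : 𝓢(Space, ℝ) :=
  ∑ α ∈ P.support, ((-1) ^ (α 0 + α 1 + α 2) * P.coeff α) • multiDeriv α f

/-- `P_∂ σ = δ` in the sense of distributions. -/
def IsFundamentalSolution (P : MvPolynomial (Fin 3) ℝ) (σ : Distr) : Prop :=
  ∀ f : 𝓢(Space, ℝ), σ (transposeDiffOp P f) = f 0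

/-- The two classes of real test functions on `ℝ³`. -/
inductive TestClass
  | compact
  | schwartz

/-- The space of real test functions: `C_c^∞(ℝ³)` or the Schwartz space. -/
def testSpace : TestClass → Submodule ℝ 𝓢(Space, ℝ)
  | .compact =>
    { carrier := {f | HasCompactSupport f}
      add_mem' := fun hf hg => HasCompactSupport.add hf hg
      zero_mem' := HasCompactSupport.zero
      smul_mem' := fun c _ hf => HasCompactSupport.smul_left (f := fun _ => c) hf }
  | .schwartz => ⊤

theorem diffOp_mem_testSpace (c : TestClass) (P : MvPolynomial (Fin 3) ℝ) {f : 𝓢(Space, ℝ)}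
    (hf : f ∈ testSpace c) : diffOp P f ∈ testSpace c := by
  have key : ∀ (m : Space) (g : 𝓢(Space, ℝ)), g ∈ testSpace c → ∂_{m} g ∈ testSpace c := by
    intro m g hg
    cases c with
    | compact =>
      exact IsCompact.of_isClosed_subset (show IsCompact (tsupport g) from hg)
        (isClosed_tsupport _) (SchwartzMap.tsupport_lineDerivOp_subset m g)
    | schwartz => exact Submodule.mem_top
  have iter : ∀ (m : Space) (n : ℕ) (g : 𝓢(Space, ℝ)), g ∈ testSpace c →
      (fun g : 𝓢(Space, ℝ) => (∂_{m} g : 𝓢(Space, ℝ)))^[n] g ∈ testSpace c := by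
    intro m n
    induction n with
    | zero => intro g hg; exact hg
    | succ n ih => intro g hg; exact ih _ (key m g hg)
  exact Submodule.sum_mem _ fun α _ => Submodule.smul_mem _ _
    (iter _ _ _ (iter _ _ _ (iter _ _ _ hf)))

/-- The space `𝒮` of pairs `s = (s_0, s_1)` of test functions. -/
abbrev TestPair (c : TestClass) : Type := testSpace c × testSpace c

/-- The symplectic form `η(s, s') = ∫ (s_1 s'_0 - s_0 s'_1)`. -/
def sympl (c : TestClass) (s s' : TestPair c) : ℝ :=
  ∫ x : Space, ((s.2 : 𝓢(Space, ℝ)) x * (s'.1 : 𝓢(Space, ℝ)) x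
    - (s.1 : 𝓢(Space, ℝ)) x * (s'.2 : 𝓢(Space, ℝ)) x)

/-- `P_∂ s = (P_∂ s_0, P_∂ s_1)`. -/
def diffOpPair {c : TestClass} (P : MvPolynomial (Fin 3) ℝ) (s : TestPair c) : TestPair c :=
  (⟨diffOp P s.1, diffOp_mem_testSpace c P s.1.2⟩, ⟨diffOp P s.2, diffOp_mem_testSpace c P s.2.2⟩)

/-- `supp s = supp s_0 ∪ supp s_1`. -/
def suppPair {c : TestClass} (s : TestPair c) : Set Space :=
  tsupport (s.1 : 𝓢(Space, ℝ)) ∪ tsupport (s.2 : 𝓢(Space, ℝ))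

/-- `h_+ = L²(ℝ³, ℂ⁴)`; it also serves as `h_- = L²(ℝ³, ℂ^{4,*})` in dual coordinates. -/
abbrev HPlus := Lp Spinor 2 (volume : Measure Space)

/-- `h = h_+ ⊕ h_-`. -/
abbrev OneParticle := WithLp 2 (HPlus × HPlus)

/-- All `w ∈ L²(ℝ³, ℂ⁴)` such that the product `m · w` is again in `L²`. -/
def mulDomain (m : Space → ℂ) : Submodule ℂ HPlus where
  carrier := {w | MemLp (fun x => m x • (w x : Spinor)) 2 volume}
  add_mem' := fun {v w} hv hw => by
    refine (MemLp.add (Set.mem_ofPred.mp hv) (Set.mem_ofPred.mp hw)).ae_eq ?_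
    filter_upwards [Lp.coeFn_add v w] with x hx
    rw [hx, Pi.add_apply, Pi.add_apply, smul_add]
  zero_mem' := by
    refine (MemLp.zero (μ := volume) (p := 2) (ε := Spinor)).ae_eq ?_
    filter_upwards [Lp.coeFn_zero Spinor 2 (volume : Measure Space)] with x hx
    rw [hx, Pi.zero_apply, smul_zero]
  smul_mem' := fun c w hw => by
    refine (MemLp.const_smul (Set.mem_ofPred.mp hw) c).ae_eq ?_
    filter_upwards [Lp.coeFn_smul c w] with x hx
    rw [hx, Pi.smul_apply, Pi.smul_apply, smul_comm]

theorem memLp_of_mem_mulDomain {m : Space → ℂ} {w : HPlus} (h : w ∈ mulDomain m) :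
    MemLp (fun x => m x • (w x : Spinor)) 2 volume := h

/-- The maximal operator of multiplication by the function `m` on `L²(ℝ³, ℂ⁴)`. -/
def mulOp (m : Space → ℂ) : HPlus →ₗ.[ℂ] HPlus where
  domain := mulDomain m
  toFun :=
    { toFun := fun w => (memLp_of_mem_mulDomain w.2).toLp
      map_add' := fun v w => by
        refine Lp.ext ?_
        filter_upwards [Lp.coeFn_add (v : HPlus) (w : HPlus),
          (memLp_of_mem_mulDomain v.2).coeFn_toLp, (memLp_of_mem_mulDomain w.2).coeFn_toLp,
          (memLp_of_mem_mulDomain (v + w).2).coeFn_toLp,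
          Lp.coeFn_add (memLp_of_mem_mulDomain v.2).toLp (memLp_of_mem_mulDomain w.2).toLp]
          with x h1 h2 h3 h4 h5
        rw [h4, h5, Pi.add_apply, h2, h3, Submodule.coe_add, h1, Pi.add_apply, smul_add]
      map_smul' := fun c w => by
        refine Lp.ext ?_
        filter_upwards [Lp.coeFn_smul c (w : HPlus), (memLp_of_mem_mulDomain w.2).coeFn_toLp,
          (memLp_of_mem_mulDomain (c • w).2).coeFn_toLp,
          Lp.coeFn_smul c (memLp_of_mem_mulDomain w.2).toLp] with x h1 h2 h3 h4
        rw [RingHom.id_apply, h3, h4, Pi.smul_apply, h2, Submodule.coe_smul, h1, Pi.smul_apply,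
          smul_comm] }

open Classical in
/-- The product `m · w` of a function `m` and `w ∈ L²(ℝ³, ℂ⁴)`, whenever `m · w` is again in `L²`. -/
def mulL2 (m : Space → ℂ) (w : HPlus) : HPlus :=
  if h : w ∈ mulDomain m then mulOp m ⟨w, h⟩ else 0

/-- The twist `u_{σ,f} (w_+ ⊕ w_-) = (e^{-i σ⋆f} w_+) ⊕ (e^{i σ⋆f} w_-)`. -/
def twist (σ : Distr) (f : 𝓢(Space, ℝ)) (z : OneParticle) : OneParticle :=
  WithLp.toLp 2
    (mulL2 (fun x => Complex.exp (-Complex.I * (conv σ f x : ℂ))) z.fst,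
     mulL2 (fun x => Complex.exp (Complex.I * (conv σ f x : ℂ))) z.snd)

/-- All `w_+ ⊕ w_-` with `σ⋆f · w_±` in `L²`. -/
def twistDomain (σ : Distr) (f : 𝓢(Space, ℝ)) : Submodule ℂ OneParticle where
  carrier := {z | z.fst ∈ mulDomain (fun x => (conv σ f x : ℂ)) ∧
    z.snd ∈ mulDomain (fun x => (conv σ f x : ℂ))}
  add_mem' := fun hv hw => ⟨Submodule.add_mem _ hv.1 hw.1, Submodule.add_mem _ hv.2 hw.2⟩
  zero_mem' := ⟨Submodule.zero_mem _, Submodule.zero_mem _⟩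
  smul_mem' := fun c _ hw => ⟨Submodule.smul_mem _ c hw.1, Submodule.smul_mem _ c hw.2⟩

/-- The component `σ⋆f · w_+` of a vector of `twistDomain`. -/
def twistFst (σ : Distr) (f : 𝓢(Space, ℝ)) : twistDomain σ f →ₗ[ℂ] HPlus where
  toFun z := mulOp (fun x => (conv σ f x : ℂ)) ⟨(z : OneParticle).fst, z.2.1⟩
  map_add' v w := (mulOp (fun x => (conv σ f x : ℂ))).map_add
    ⟨(v : OneParticle).fst, v.2.1⟩ ⟨(w : OneParticle).fst, w.2.1⟩
  map_smul' c w := (mulOp (fun x => (conv σ f x : ℂ))).map_smul c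
    ⟨(w : OneParticle).fst, w.2.1⟩

/-- The component `σ⋆f · w_-` of a vector of `twistDomain`. -/
def twistSnd (σ : Distr) (f : 𝓢(Space, ℝ)) : twistDomain σ f →ₗ[ℂ] HPlus where
  toFun z := mulOp (fun x => (conv σ f x : ℂ)) ⟨(z : OneParticle).snd, z.2.2⟩
  map_add' v w := (mulOp (fun x => (conv σ f x : ℂ))).map_add
    ⟨(v : OneParticle).snd, v.2.2⟩ ⟨(w : OneParticle).snd, w.2.2⟩
  map_smul' c w := (mulOp (fun x => (conv σ f x : ℂ))).map_smul c
    ⟨(w : OneParticle).snd, w.2.2⟩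

/-- The generator `μ_{σ,f} (w_+ ⊕ w_-) = (-σ⋆f · w_+) ⊕ (σ⋆f · w_-)` of the twist, on the domain of
all `w_+ ⊕ w_-` with `σ⋆f · w_±` in `L²`. -/
def twistGenerator (σ : Distr) (f : 𝓢(Space, ℝ)) : OneParticle →ₗ.[ℂ] OneParticle where
  domain := twistDomain σ f
  toFun := (WithLp.linearEquiv 2 ℂ (HPlus × HPlus)).symm.toLinearMap ∘ₗ
    (-twistFst σ f).prod (twistSnd σ f)

/-- Entrywise complex conjugation, the conjugation `ℂ⁴ → ℂ^{4,*}` in dual coordinates. -/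
def conjSpinor (v : Spinor) : Spinor := WithLp.toLp 2 fun i => conj (v i)

theorem continuous_conjSpinor : Continuous conjSpinor := by
  unfold conjSpinor
  fun_prop

theorem norm_conjSpinor (v : Spinor) : ‖conjSpinor v‖ = ‖v‖ := by
  simp [conjSpinor, EuclideanSpace.norm_eq]

/-- The pointwise conjugate `w̄` of `w ∈ L²(ℝ³, ℂ⁴)`. -/
def bar (w : HPlus) : HPlus :=
  MemLp.toLp (fun x => conjSpinor (w x))
    ((Lp.memLp w).of_le (continuous_conjSpinor.comp_aestronglyMeasurable
      (Lp.aestronglyMeasurable w)) (Filter.Eventually.of_forall fun _ => (norm_conjSpinor _).le))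

/-- The conjugation `κ (w_+ ⊕ w̄_-) = w_- ⊕ w̄_+`. -/
def conjugation (z : OneParticle) : OneParticle := WithLp.toLp 2 (bar z.snd, bar z.fst)

/-- The self-dual Dirac field `2^{-1/2} (a^*(z) + a(κ z))`. -/
def selfDualField (z : OneParticle) : Fock OneParticle →L[ℂ] Fock OneParticle :=
  ((Real.sqrt 2 : ℂ)⁻¹) • (creation z + annihilation (conjugation z))

/-- The Dirac (electron) field `ψ(w)`, `w ∈ h_+`, on the fermionic Fock space. -/
def fockDirac (w : HPlus) : Fock OneParticle →L[ℂ] Fock OneParticle :=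
  selfDualField (WithLp.toLp 2 (w, 0))

/-- `w ∈ C_c^∞(ℝ³, ℂ⁴)`. -/
def IsTestSpinor (w : HPlus) : Prop :=
  ∃ g : Space → Spinor, ContDiff ℝ (⊤ : ℕ∞) g ∧ HasCompactSupport g ∧ w =ᵐ[volume] g

/-- The (essential) support of `w ∈ L²(ℝ³, ℂ⁴)`. -/
def essSupport (w : HPlus) : Set Space :=
  {x | ∀ U ∈ 𝓝 x, ¬ (w =ᵐ[volume.restrict U] 0)}

/-- `f_1 ∧ ... ∧ f_n` is a product vector of charge `q`: there are signs `q_i = ±1` with sum `q` such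
that `f_i ∈ h_{q_i}` for all `i`. -/
def IsProductOfCharge (q : ℤ) {n : ℕ} (f : Fin n → OneParticle) : Prop :=
  ∃ ε : Fin n → ℤˣ, ∑ i, (ε i : ℤ) = q ∧
    ∀ i, (ε i = 1 → (f i).snd = 0) ∧ (ε i = -1 → (f i).fst = 0)

/-- The support in `ℝ³` of the product vector `f_1 ∧ ... ∧ f_n`: the union of the supports of its
factors. -/
def suppProduct {n : ℕ} (f : Fin n → OneParticle) : Set Space :=
  ⋃ i, (essSupport (f i).fst ∪ essSupport (f i).snd)

variable {c : TestClass} {K : Type*} [NormedAddCommGroup K] [InnerProductSpace ℂ K]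
  [CompleteSpace K]

variable (K) in
/-- The Hilbert space `𝓗^ω = F_a(h) ⊗ h^ω`, where `h^ω = K`. -/
abbrev TotalSpace : Type _ := HilbertTensor (Fock OneParticle) K

variable (K) in
/-- The Dirac field `ψ(w) ⊗ 1` on `𝓗^ω`. -/
def dirac (w : HPlus) : TotalSpace K →L[ℂ] TotalSpace K := tensorOp (fockDirac w) 1

/-- The untwisted bosonic field `φ(s)`, given by `π(W(t s)) = e^{i t φ(s)}`. -/
def bosonField (π : WeylAlgebra (sympl c) →⋆ₐ[ℂ] (K →L[ℂ] K)) (s : TestPair c) : K →ₗ.[ℂ] K :=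
  stoneGenerator fun t : ℝ => π (weyl (sympl c) (t • s))

/-- The twisted bosonic field `φ^λ(s) = 1 ⊗ φ(s) + dΓ_a(μ_{σ,s}) ⊗ 1` on `𝓗^ω`. -/
def twistedField (σ : Distr) (π : WeylAlgebra (sympl c) →⋆ₐ[ℂ] (K →L[ℂ] K)) (s : TestPair c) :
    TotalSpace K →ₗ.[ℂ] TotalSpace K :=
  tensorSum (diffSecondQuant (twistGenerator σ s.1)) (bosonField π s)

/-- The twisted Weyl operator `Γ_a(u_{σ,s}) ⊗ π(W(s))` on `𝓗^ω`. -/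
def twistedWeyl (σ : Distr) (π : WeylAlgebra (sympl c) →⋆ₐ[ℂ] (K →L[ℂ] K)) (s : TestPair c) :
    TotalSpace K →L[ℂ] TotalSpace K :=
  tensorOp (secondQuant (twist σ s.1)) (π (weyl (sympl c) s))

/-- The field `ϱ(s) = φ^λ(P_∂ s)`. -/
def gaugeField (σ : Distr) (π : WeylAlgebra (sympl c) →⋆ₐ[ℂ] (K →L[ℂ] K))
    (P : MvPolynomial (Fin 3) ℝ) (s : TestPair c) : TotalSpace K →ₗ.[ℂ] TotalSpace K :=
  twistedField σ π (diffOpPair P s)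

/-- The closed subspace of `𝓗^ω` generated by the vectors `Γ_a(u_{σ,s}) ⊗ π(W(s)) Ω`, `s ∈ 𝒮`. -/
def cyclicSpace (σ : Distr) (π : WeylAlgebra (sympl c) →⋆ₐ[ℂ] (K →L[ℂ] K)) (Ω : TotalSpace K) :
    Submodule ℂ (TotalSpace K) :=
  (Submodule.span ℂ (Set.range fun s : TestPair c => twistedWeyl σ π s Ω)).topologicalClosure

instance (σ : Distr) (π : WeylAlgebra (sympl c) →⋆ₐ[ℂ] (K →L[ℂ] K)) (Ω : TotalSpace K) :
    CompleteSpace (cyclicSpace σ π Ω) :=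
  inferInstanceAs (CompleteSpace (Submodule.topologicalClosure _))

end Concrete

end

end TwistedFieldModel

/-! For bounded operators the theorem is algebra. The twists `u_{σ,s}` are commuting unitaries that
depend additively on `s`, so `T(s) = Γ_a(u_{σ,s}) ⊗ π(W(s))` satisfies the same Weyl relations as
`W(s)`. Moreover `Γ_a(u) ψ(w) Γ_a(u)* = ψ(e^{-iσ⋆s_0} w)`, because `u` rotates `h_-` oppositely to
`h_+` and the conjugation `w ↦ w̄` undoes this sign.

The analytic point is that the field, defined as a closure, is the Stone generator of `t ↦ T(ts)`
(`twistedField_eq`). It rests on a core criterion: a set of graph elements that is invariant under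
the group and has a total set of first components spans a core (`closure_span_eq_graph`). This is
used once for `dΓ_a` (`diffSecondQuant_eq_stoneGenerator`) and once for `A ⊗ 1 + 1 ⊗ B`
(`tensorSum_stoneGenerator`). Self-adjointness and the exponential are then general facts about
generators. The commutators arise by differentiating bounded relations (`commutator_of_weyl`,
`mem_graph_of_covariant`); for the Dirac field this yields the invariance of the domain as well. If
`P_∂ σ = δ`, then `σ ⋆ P_∂ s_0 = s_0` (`conv_diffOp`), which turns the twist into a local gauge
transformation.

For the charged states one has to show that `W(s) ↦ ⟨x, Γ_a(u_{σ,s}) x⟩ ω(W(s))` is bounded on the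
span of the Weyl operators. The first factor is a function of positive type, and multiplying the
`W(s)` by it is a compression `V* (· ⊗ 1) V` (`exists_norm_schur_le`). Neither simplicity nor
uniqueness of the Weyl algebra enters. Positivity and the GNS representation follow because the
numbers `φ(W(s)* W(t))` form the Gram matrix of the vectors `T(s)(x ⊗ Ω)` (`exists_representation`).

Localization holds because the twist fixes every factor of the product vector as soon as `σ ⋆ s_0`
vanishes on the supports, and because a tempered distribution annihilates each Schwartz function
whose support misses its own (`apply_eq_zero_of_disjoint_dsupport`). -/

namespace TwistedFieldModel

noncomputable section

/-! ### Stone generators of unitary groups: self-adjointness, cores, commutators -/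

section UnitaryGroups

variable {H : Type*} [NormedAddCommGroup H] [InnerProductSpace ℂ H] [CompleteSpace H]
  {U V : ℝ → H →L[ℂ] H}

-- Unbounded operators are handled through their graphs throughout; this criterion replaces domain
-- bookkeeping by a derivative at `0`.
omit [CompleteSpace H] in
theorem mem_graph_stoneGenerator {v w : H} :
    (v, w) ∈ (stoneGenerator U).graph ↔
      HasDerivAt (fun t => U t v) (Complex.I • w) 0 := by
  rw [LinearPMap.mem_graph_iff]
  constructor
  · rintro ⟨⟨y, hy⟩, rfl, h⟩
    have hd : DifferentiableAt ℝ (fun t => U t y) 0 := hy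
    have : (-Complex.I) • deriv (fun t => U t y) 0 = w := h
    rw [← this, smul_smul]
    simpa using hd.hasDerivAt
  · intro h
    refine ⟨⟨v, h.differentiableAt⟩, rfl, ?_⟩
    change (-Complex.I) • deriv (fun t => U t v) 0 = w
    rw [h.deriv, smul_smul]
    simp

namespace IsUnitaryGroup

theorem inner_map_map (hU : IsUnitaryGroup U) (t : ℝ) (v w : H) : ⟪U t v, U t w⟫_ℂ = ⟪v, w⟫_ℂ := by
  have h := (Unitary.mem_iff.mp (hU.unitary t)).1
  rw [← ContinuousLinearMap.adjoint_inner_right, ← ContinuousLinearMap.star_eq_adjoint,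
    ← mul_apply_eq_comp, h, one_apply_eq_self]

theorem norm_map (hU : IsUnitaryGroup U) (t : ℝ) (v : H) : ‖U t v‖ = ‖v‖ := by
  rw [@norm_eq_sqrt_re_inner ℂ, hU.inner_map_map, ← @norm_eq_sqrt_re_inner ℂ]

theorem add_apply (hU : IsUnitaryGroup U) (s t : ℝ) (v : H) : U (s + t) v = U s (U t v) := by
  rw [hU.add]; rfl

theorem zero_apply (hU : IsUnitaryGroup U) (v : H) : U 0 v = v := by
  rw [hU.zero]; rfl

theorem neg_apply_apply (hU : IsUnitaryGroup U) (t : ℝ) (v : H) : U (-t) (U t v) = v := by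
  rw [← hU.add_apply, neg_add_cancel, hU.zero_apply]

theorem apply_neg_apply (hU : IsUnitaryGroup U) (t : ℝ) (v : H) : U t (U (-t) v) = v := by
  rw [← hU.add_apply, add_neg_cancel, hU.zero_apply]

theorem inner_map_left (hU : IsUnitaryGroup U) (t : ℝ) (v w : H) :
    ⟪U t v, w⟫_ℂ = ⟪v, U (-t) w⟫_ℂ := by
  rw [← hU.inner_map_map t v, hU.apply_neg_apply]

theorem comp_neg (hU : IsUnitaryGroup U) : IsUnitaryGroup fun t => U (-t) where
  unitary t := hU.unitary _
  zero := by simp [hU.zero]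
  add s t := by rw [neg_add, hU.add]
  continuous v := (hU.continuous v).comp continuous_neg

theorem hasDerivAt (hU : IsUnitaryGroup U) {v w : H} (h : (v, w) ∈ (stoneGenerator U).graph)
    (t : ℝ) : HasDerivAt (fun s => U s v) (Complex.I • U t w) t := by
  rw [mem_graph_stoneGenerator] at h
  have h1 : HasDerivAt (fun s => U (s - t) v) (Complex.I • w) t := by
    have := HasDerivAt.comp_sub_const t t (f := fun s => U s v) (f' := Complex.I • w)
      (by simpa using h)
    exact this
  have h2 := ((U t).restrictScalars ℝ).hasFDerivAt.comp_hasDerivAt t h1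
  have e : (fun s => U s v) = ⇑((U t).restrictScalars ℝ) ∘ fun s => U (s - t) v := by
    ext s
    simp only [Function.comp_apply, ContinuousLinearMap.coe_restrictScalars']
    rw [← hU.add_apply, add_sub_cancel]
  rw [e]
  simpa using h2

theorem map_mem_graph (hU : IsUnitaryGroup U) {v w : H} (h : (v, w) ∈ (stoneGenerator U).graph)
    (t : ℝ) : (U t v, U t w) ∈ (stoneGenerator U).graph := by
  rw [mem_graph_stoneGenerator] at h ⊢
  have h2 := ((U t).restrictScalars ℝ).hasFDerivAt.comp_hasDerivAt 0 h
  have e : (fun s => U s (U t v)) = ⇑((U t).restrictScalars ℝ) ∘ fun s => U s v := by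
    ext s
    simp only [Function.comp_apply, ContinuousLinearMap.coe_restrictScalars']
    rw [← hU.add_apply, ← hU.add_apply, add_comm]
  rw [e]
  simpa using h2

theorem hasDerivAt_neg (hU : IsUnitaryGroup U) {v w : H}
    (h : (v, w) ∈ (stoneGenerator U).graph) (t : ℝ) :
    HasDerivAt (fun s => U (-s) v) (-Complex.I • U (-t) w) t := by
  have h1 := (hU.hasDerivAt h (-t)).scomp t (_root_.hasDerivAt_neg t)
  refine h1.congr_deriv ?_
  simp

theorem inner_symm_of_mem_graph (hU : IsUnitaryGroup U) {v w v' w' : H}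
    (h : (v, w) ∈ (stoneGenerator U).graph) (h' : (v', w') ∈ (stoneGenerator U).graph) :
    ⟪w, v'⟫_ℂ = ⟪v, w'⟫_ℂ := by
  rw [mem_graph_stoneGenerator] at h h'
  have h1 := h.inner ℂ h'
  simp only [hU.inner_map_map, hU.zero_apply] at h1
  have h2 := h1.unique (hasDerivAt_const (0 : ℝ) ⟪v, v'⟫_ℂ)
  rw [inner_smul_left, inner_smul_right, Complex.conj_I] at h2
  have h3 : Complex.I * (⟪v, w'⟫_ℂ - ⟪w, v'⟫_ℂ) = 0 := by rw [← h2]; ring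
  rcases mul_eq_zero.mp h3 with h | h
  · exact absurd h Complex.I_ne_zero
  · exact (sub_eq_zero.mp h).symm

/-- A restriction of the generator to a dense invariant subspace has no proper symmetric-dual
extension: its adjoint is contained in the generator. -/
theorem mem_graph_of_formal_adjoint (hU : IsUnitaryGroup U) {G : Set (H × H)}
    (hG : G ⊆ (stoneGenerator U).graph) (hinv : ∀ p ∈ G, ∀ t, (U t p.1, U t p.2) ∈ G)
    (hdense : Dense (Submodule.span ℂ (Prod.fst '' G) : Set H)) {y z : H}
    (h : ∀ p ∈ G, ⟪p.2, y⟫_ℂ = ⟪p.1, z⟫_ℂ) : (y, z) ∈ (stoneGenerator U).graph := by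
  have hc : Continuous fun s => Complex.I • U s z := (hU.continuous z).const_smul _
  have hg : ∀ t : ℝ, HasDerivAt (fun t => y + ∫ s in (0 : ℝ)..t, Complex.I • U s z)
      (Complex.I • U t z) t := fun t =>
    (intervalIntegral.integral_hasDerivAt_right (hc.intervalIntegrable _ _)
      hc.stronglyMeasurable.stronglyMeasurableAtFilter hc.continuousAt).const_add y
  -- The differential equation `d/dt U(t) y = i U(t) z` is proved in integrated form. Tested against
  -- first components of `G`, both sides have the same derivative, and these components are total.
  have key : ∀ t : ℝ, U t y = y + ∫ s in (0 : ℝ)..t, Complex.I • U s z := by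
    intro t
    have hx : ∀ p ∈ G, ⟪p.1, U t y⟫_ℂ = ⟪p.1, y + ∫ s in (0 : ℝ)..t, Complex.I • U s z⟫_ℂ := by
      intro p hp
      have hd : ∀ t : ℝ, HasDerivAt (fun t => ⟪p.1, U t y⟫_ℂ -
          ⟪p.1, y + ∫ s in (0 : ℝ)..t, Complex.I • U s z⟫_ℂ) 0 t := by
        intro t
        have h1 := (hU.hasDerivAt_neg (hG hp) t).inner ℂ (hasDerivAt_const t y)
        have h2 := (hasDerivAt_const t p.1).inner ℂ (hg t)
        have h3 := h1.sub h2
        have e : (fun t => ⟪p.1, U t y⟫_ℂ) = fun t => ⟪U (-t) p.1, y⟫_ℂ := by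
          ext t; rw [hU.inner_map_left, neg_neg]
        have e2 : (fun t => ⟪p.1, U t y⟫_ℂ -
          ⟪p.1, y + ∫ s in (0 : ℝ)..t, Complex.I • U s z⟫_ℂ) = (fun t => ⟪U (-t) p.1, y⟫_ℂ) -
            fun t => ⟪p.1, y + ∫ s in (0 : ℝ)..t, Complex.I • U s z⟫_ℂ := by
          rw [← e]; rfl
        rw [e2]
        refine h3.congr_deriv ?_
        -- Invariance enters here: the adjoint relation is needed at the translated pair `(U(-t)
        -- p.1, U(-t) p.2)`.
        have h4 := h _ (hinv p hp (-t))
        simp only at h4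
        rw [inner_smul_left, h4, inner_smul_right, inner_zero_left, inner_zero_right,
          hU.inner_map_left, neg_neg]
        simp
      have := is_const_of_deriv_eq_zero (fun t => (hd t).differentiableAt)
        (fun t => (hd t).deriv) t 0
      simp only [hU.zero_apply, intervalIntegral.integral_same, add_zero, sub_self] at this
      exact sub_eq_zero.mp this
    refine hdense.eq_of_inner_right ℂ fun v hv => ?_
    induction hv using Submodule.span_induction with
    | mem v hv => obtain ⟨p, hp, rfl⟩ := hv; exact hx p hp
    | zero => simp
    | add a b _ _ ha hb => rw [inner_add_left, inner_add_left, ha, hb]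
    | smul c a _ ha => rw [inner_smul_left, inner_smul_left, ha]
  rw [mem_graph_stoneGenerator]
  have h0 := hg 0
  rw [hU.zero_apply] at h0
  exact h0.congr_of_eventuallyEq (Filter.Eventually.of_forall key)

/-- The averages `∫_0^h U(s) v ds` lie in the domain, since `U(t)` merely shifts the interval of
integration, and divided by `h` they converge to `v`. -/
theorem dense_domain (hU : IsUnitaryGroup U) : Dense ((stoneGenerator U).domain : Set H) := by
  intro v
  have hc := hU.continuous v
  have hg : ∀ t : ℝ, HasDerivAt (fun t => ∫ s in (0 : ℝ)..t, U s v) (U t v) t := fun t =>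
    intervalIntegral.integral_hasDerivAt_right (hc.intervalIntegrable _ _)
      hc.stronglyMeasurable.stronglyMeasurableAtFilter hc.continuousAt
  have hmem : ∀ h : ℝ, (∫ s in (0 : ℝ)..h, U s v) ∈ (stoneGenerator U).domain := by
    intro h
    have e : (fun t => U t (∫ s in (0 : ℝ)..h, U s v)) =
        fun t => (∫ s in (0 : ℝ)..(h + t), U s v) - ∫ s in (0 : ℝ)..t, U s v := by
      ext t
      rw [← ContinuousLinearMap.intervalIntegral_comp_comm _ (hc.intervalIntegrable _ _)]
      simp_rw [← hU.add_apply, add_comm t]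
      rw [intervalIntegral.integral_comp_add_right (fun s => U s v), zero_add,
        intervalIntegral.integral_interval_sub_left] <;> exact hc.intervalIntegrable _ _
    change DifferentiableAt ℝ (fun t => U t (∫ s in (0 : ℝ)..h, U s v)) 0
    rw [e]
    have h1 : DifferentiableAt ℝ (fun t => ∫ s in (0 : ℝ)..(h + t), U s v) 0 :=
      (HasDerivAt.comp_const_add h 0 (f := fun t => ∫ s in (0 : ℝ)..t, U s v)
        (hg _)).differentiableAt
    exact h1.sub (hg 0).differentiableAt
  have hlim := (hg 0).tendsto_slope_zero_right
  simp only [intervalIntegral.integral_same, sub_zero, zero_add, hU.zero_apply] at hlim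
  refine mem_closure_of_tendsto hlim (Filter.Eventually.of_forall fun t => ?_)
  exact (stoneGenerator U).domain.smul_of_tower_mem _ (hmem t)

theorem dense_span_fst_graph (hU : IsUnitaryGroup U) :
    Dense (Submodule.span ℂ (Prod.fst '' ((stoneGenerator U).graph : Set (H × H))) : Set H) := by
  refine hU.dense_domain.mono ?_
  rintro v hv
  refine Submodule.subset_span ⟨(v, stoneGenerator U ⟨v, hv⟩), ?_, rfl⟩
  exact LinearPMap.mem_graph _ (⟨v, hv⟩ : (stoneGenerator U).domain)

/-- Symmetry gives one inclusion; the other is `mem_graph_of_formal_adjoint` with `G` the whole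
graph. -/
theorem isSelfAdjoint_stoneGenerator (hU : IsUnitaryGroup U) :
    IsSelfAdjoint (stoneGenerator U) := by
  rw [LinearPMap.isSelfAdjoint_def]
  refine LinearPMap.eq_of_eq_graph ?_
  rw [LinearPMap.adjoint_graph_eq_graph_adjoint hU.dense_domain]
  ext ⟨y, z⟩
  rw [Submodule.mem_adjoint_iff]
  constructor
  · intro h
    exact hU.mem_graph_of_formal_adjoint subset_rfl (fun p hp t => hU.map_mem_graph hp t)
      hU.dense_span_fst_graph fun p hp => sub_eq_zero.mp (h p.1 p.2 hp)
  · intro h a b hab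
    exact sub_eq_zero.mpr (hU.inner_symm_of_mem_graph hab h)

theorem isClosed_graph (hU : IsUnitaryGroup U) :
    IsClosed ((stoneGenerator U).graph : Set (H × H)) :=
  hU.isSelfAdjoint_stoneGenerator.isClosed

/-- A dense invariant subspace of the domain is a core for the generator. -/
theorem closure_span_eq_graph (hU : IsUnitaryGroup U) {G : Set (H × H)}
    (hG : G ⊆ (stoneGenerator U).graph) (hinv : ∀ p ∈ G, ∀ t, (U t p.1, U t p.2) ∈ G)
    (hdense : Dense (Submodule.span ℂ (Prod.fst '' G) : Set H)) :
    (Submodule.span ℂ G).topologicalClosure = (stoneGenerator U).graph := by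
  have hspan : Submodule.span ℂ G ≤ (stoneGenerator U).graph := Submodule.span_le.mpr hG
  refine le_antisymm (Submodule.topologicalClosure_minimal _ hspan hU.isClosed_graph) ?_
  -- On the graph of the generator `A` this is `A + i`. By symmetry its squared norm is `‖Av‖² +
  -- ‖v‖²`, so closeness in the graph norm can be tested after applying `R`.
  let R : H × H →ₗ[ℂ] H := LinearMap.snd ℂ H H + Complex.I • LinearMap.fst ℂ H H
  have hR : ∀ p, R p = p.2 + Complex.I • p.1 := fun p => rfl
  have hnorm : ∀ p ∈ (stoneGenerator U).graph, ‖R p‖ ^ 2 = ‖p.2‖ ^ 2 + ‖p.1‖ ^ 2 := by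
    rintro ⟨v, w⟩ hp
    have hs : ⟪w, v⟫_ℂ = ⟪v, w⟫_ℂ := hU.inner_symm_of_mem_graph hp hp
    have him : (⟪w, v⟫_ℂ).im = 0 := by
      have := inner_conj_symm (𝕜 := ℂ) w v
      rw [← hs] at this
      exact Complex.conj_eq_iff_im.mp this
    rw [hR, norm_add_sq (𝕜 := ℂ), inner_smul_right, norm_smul]
    simp [him]
  -- A vector `y` orthogonal to the image would satisfy `A y = i y`, which is impossible for a
  -- symmetric operator unless `y = 0`.
  have hdr : Dense ((Submodule.span ℂ G).map R : Set H) := by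
    rw [Submodule.dense_iff_topologicalClosure_eq_top,
      Submodule.topologicalClosure_eq_top_iff, Submodule.eq_bot_iff]
    intro y hy
    rw [Submodule.mem_orthogonal] at hy
    have h1 : (y, Complex.I • y) ∈ (stoneGenerator U).graph := by
      refine hU.mem_graph_of_formal_adjoint hG hinv hdense fun p hp => ?_
      have := hy (R p) ⟨p, Submodule.subset_span hp, rfl⟩
      rw [hR, inner_add_left, inner_smul_left, Complex.conj_I] at this
      rw [inner_smul_right]
      linear_combination this
    have h2 := hU.inner_symm_of_mem_graph h1 h1
    rw [inner_smul_left, inner_smul_right, Complex.conj_I] at h2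
    have h3 : Complex.I * ⟪y, y⟫_ℂ = 0 := by linear_combination -h2 / 2
    rcases mul_eq_zero.mp h3 with h | h
    · exact absurd h Complex.I_ne_zero
    · exact inner_self_eq_zero.mp h
  rintro ⟨x, x'⟩ hx
  change (x, x') ∈ closure _
  rw [Metric.mem_closure_iff]
  intro ε hε
  obtain ⟨_, hdist, ⟨d, hd, rfl⟩⟩ := Metric.dense_iff.mp hdr (R (x, x')) ε hε
  refine ⟨d, hd, ?_⟩
  -- An approximation of `R (x, x')` by `R d` approximates both components at once.
  have h1 := hnorm ((x, x') - d) (Submodule.sub_mem _ hx (hspan hd))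
  rw [map_sub, ← dist_eq_norm, dist_comm] at h1
  rw [dist_eq_norm, Prod.norm_def]
  rw [Metric.mem_ball] at hdist
  have h2 : dist (R d) (R (x, x')) ^ 2 < ε ^ 2 := by
    gcongr
  refine max_lt ?_ ?_ <;> refine lt_of_pow_lt_pow_left₀ 2 hε.le ?_
  · nlinarith [sq_nonneg ‖((x, x') - d).2‖]
  · nlinarith [sq_nonneg ‖((x, x') - d).1‖]

theorem toLinearPMap_closure_span_eq (hU : IsUnitaryGroup U) {G : Set (H × H)}
    (hG : G ⊆ (stoneGenerator U).graph) (hinv : ∀ p ∈ G, ∀ t, (U t p.1, U t p.2) ∈ G)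
    (hdense : Dense (Submodule.span ℂ (Prod.fst '' G) : Set H)) :
    (Submodule.span ℂ G).topologicalClosure.toLinearPMap = stoneGenerator U := by
  rw [hU.closure_span_eq_graph hG hinv hdense]
  refine LinearPMap.eq_of_eq_graph (Submodule.toLinearPMap_graph_eq _ ?_)
  rintro ⟨x, x'⟩ hx h
  exact LinearPMap.graph_fst_eq_zero_snd _ hx h

/-- For `v` in the common domain `⟨U(t) v, V(t) v⟩` has zero derivative, hence equals `‖v‖²`, which
forces `‖U(t) v - V(t) v‖ = 0`. This is what makes `expI` independent of the choice in its
definition. -/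
theorem eq_of_stoneGenerator_eq (hU : IsUnitaryGroup U) (hV : IsUnitaryGroup V)
    (h : stoneGenerator U = stoneGenerator V) : U = V := by
  ext1 t
  refine ContinuousLinearMap.ext_on (s := (stoneGenerator U).domain)
    (hU.dense_domain.mono Submodule.subset_span) fun v hv => ?_
  obtain ⟨w, hg⟩ := LinearPMap.mem_domain_iff.mp hv
  have hg' := hg
  rw [h] at hg'
  have hd : ∀ t : ℝ, HasDerivAt (fun t => ⟪U t v, V t v⟫_ℂ) 0 t := by
    intro t
    have h1 := (hU.hasDerivAt hg t).inner ℂ (hV.hasDerivAt hg' t)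
    refine h1.congr_deriv ?_
    have h2 := hV.map_mem_graph hg' t
    rw [← h] at h2
    rw [inner_smul_left, inner_smul_right,
      hU.inner_symm_of_mem_graph (hU.map_mem_graph hg t) h2, Complex.conj_I]
    ring
  have h3 := is_const_of_deriv_eq_zero (fun t => (hd t).differentiableAt)
    (fun t => (hd t).deriv) t 0
  simp only [hU.zero_apply, hV.zero_apply] at h3
  rw [← sub_eq_zero, ← norm_eq_zero, ← sq_eq_zero_iff, norm_sub_sq (𝕜 := ℂ), h3, hU.norm_map,
    hV.norm_map, inner_self_eq_norm_sq_to_K]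
  norm_cast
  ring

theorem expI_stoneGenerator (hU : IsUnitaryGroup U) : expI (stoneGenerator U) = U 1 := by
  have h : ∃ V : ℝ → H →L[ℂ] H, IsUnitaryGroup V ∧ stoneGenerator V = stoneGenerator U :=
    ⟨U, hU, rfl⟩
  rw [expI, dif_pos h, h.choose_spec.1.eq_of_stoneGenerator_eq hU h.choose_spec.2]

theorem neg_stoneGenerator (hU : IsUnitaryGroup U) :
    -stoneGenerator U = stoneGenerator fun t => U (-t) := by
  refine LinearPMap.eq_of_eq_graph ?_
  rw [LinearPMap.neg_graph]
  have h : ∀ {W : ℝ → H →L[ℂ] H}, IsUnitaryGroup W → ∀ v w, (v, w) ∈ (stoneGenerator W).graph →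
      (v, -w) ∈ (stoneGenerator fun t => W (-t)).graph := by
    intro W hW v w hv
    rw [mem_graph_stoneGenerator]
    have := hW.hasDerivAt_neg hv 0
    simpa [hW.zero] using this
  ext ⟨v, w⟩
  constructor
  · rintro ⟨⟨a, b⟩, hab, he⟩
    simp only [Prod.mk.injEq, LinearMap.prodMap_apply, LinearMap.id_coe, id_eq,
      LinearMap.neg_apply] at he
    rw [← he.1, ← he.2]
    exact h hU _ _ hab
  · intro hv
    refine ⟨(v, -w), ?_, by simp⟩
    -- The reverse inclusion is the first one applied to the reversed group.
    have := h hU.comp_neg _ _ hv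
    simpa using this

/-- A conjugation relation `U(t) B = B(t) U(t)` yields the commutator of the generator
with `B`. -/
theorem mem_graph_of_intertwine (hU : IsUnitaryGroup U) {B : ℝ → H →L[ℂ] H} {B' : H →L[ℂ] H}
    (hB : ∀ t, U t * B 0 = B t * U t) (hB' : HasDerivAt B (-Complex.I • B') 0) {v w : H}
    (h : (v, w) ∈ (stoneGenerator U).graph) :
    (B 0 v, B 0 w - B' v) ∈ (stoneGenerator U).graph := by
  rw [mem_graph_stoneGenerator] at h ⊢
  have e : (fun t => U t (B 0 v)) = fun t => B t (U t v) := by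
    ext t
    rw [← mul_apply_eq_comp, hB]; rfl
  rw [e]
  have h1 : HasDerivAt (fun t => ContinuousLinearMap.restrictScalarsL ℂ H H ℝ ℝ (B t))
      (ContinuousLinearMap.restrictScalarsL ℂ H H ℝ ℝ (-Complex.I • B')) 0 :=
    (ContinuousLinearMap.restrictScalarsL ℂ H H ℝ ℝ).hasFDerivAt.comp_hasDerivAt 0 hB'
  -- `B` is differentiable in operator norm, so the product rule applies to `B(t) U(t) v`.
  refine (h1.clm_apply h).congr_deriv ?_
  change (-Complex.I • B') (U 0 v) + B 0 (Complex.I • w) = _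
  rw [hU.zero_apply, map_smul, smul_sub, smul_apply, neg_smul]
  abel

/-- The infinitesimal form of the Weyl relations `U(t) V(r) = e^{i η t r} V(r) U(t)`. -/
theorem commutator_of_weyl (hU : IsUnitaryGroup U) (hV : IsUnitaryGroup V) {η : ℝ}
    (hUV : ∀ t r : ℝ, U t * V r = Complex.exp (Complex.I * (η * t * r : ℝ)) • (V r * U t))
    {v v₁ v₂ v₁₂ v₂₁ : H}
    (h₁ : (v, v₁) ∈ (stoneGenerator U).graph) (h₂ : (v, v₂) ∈ (stoneGenerator V).graph)
    (h₁₂ : (v₂, v₁₂) ∈ (stoneGenerator U).graph) (h₂₁ : (v₁, v₂₁) ∈ (stoneGenerator V).graph) :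
    v₁₂ - v₂₁ = (-Complex.I * (η : ℂ)) • v := by
  -- Differentiating the Weyl relation in `r` alone: `U(t)` preserves membership of `v` in the
  -- domain of the generator of `V` and shifts its value by a multiple of `t`.
  have hmem : ∀ t : ℝ, (U t v, U t v₂ - ((η * t : ℝ) : ℂ) • U t v) ∈ (stoneGenerator V).graph := by
    intro t
    rw [mem_graph_stoneGenerator] at h₂ ⊢
    have e : (fun r => V r (U t v)) =
        fun r : ℝ => Complex.exp (-Complex.I * (η * t * r : ℝ)) • U t (V r v) := by
      ext r
      have := congrArg (fun T : H →L[ℂ] H => T v) (hUV t r)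
      simp only [mul_apply_eq_comp, smul_apply] at this
      rw [this, smul_smul, ← Complex.exp_add]
      simp
    rw [e]
    have h1 := ((U t).restrictScalars ℝ).hasFDerivAt.comp_hasDerivAt 0 h₂
    have h2 : HasDerivAt (fun r : ℝ => Complex.exp (-Complex.I * (η * t * r : ℝ)))
        (-Complex.I * (η * t : ℝ)) 0 := by
      have h3 : HasDerivAt (fun r : ℝ => -Complex.I * ((η * t * r : ℝ) : ℂ))
          (-Complex.I * (η * t : ℝ)) 0 := by
        have h4 : HasDerivAt (fun r : ℝ => η * t * r) (η * t) 0 := by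
          simpa using (hasDerivAt_id (0 : ℝ)).const_mul (η * t)
        exact h4.ofReal_comp.const_mul _
      simpa using h3.cexp
    refine (h2.smul h1).congr_deriv ?_
    simp only [Function.comp_apply, ContinuousLinearMap.coe_restrictScalars', hV.zero_apply,
      map_smul]
    simp [smul_sub, smul_smul]
    try abel
  -- The remaining derivative in `t` is taken weakly: against `y` in its domain the generator of `V`
  -- moves to the left, where only `U(t) v` has to be differentiated.
  have key : ∀ y z, (y, z) ∈ (stoneGenerator V).graph →
      ⟪y, v₁₂ - v₂₁⟫_ℂ = ⟪y, (-Complex.I * (η : ℂ)) • v⟫_ℂ := by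
    intro y z hyz
    rw [mem_graph_stoneGenerator] at h₁ h₁₂
    have e : (fun t => ⟪z, U t v⟫_ℂ) = fun t => ⟪y, U t v₂⟫_ℂ - (η * t : ℝ) * ⟪y, U t v⟫_ℂ := by
      ext t
      rw [hV.inner_symm_of_mem_graph hyz (hmem t), inner_sub_right, inner_smul_right]
    have d1 := (hasDerivAt_const (0 : ℝ) z).inner ℂ h₁
    have d2 := (hasDerivAt_const (0 : ℝ) y).inner ℂ h₁₂
    have d3 := (hasDerivAt_const (0 : ℝ) y).inner ℂ h₁
    have d4 : HasDerivAt (fun t : ℝ => ((η * t : ℝ) : ℂ)) η 0 := by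
      have h4 : HasDerivAt (fun r : ℝ => η * r) η 0 := by
        simpa using (hasDerivAt_id (0 : ℝ)).const_mul η
      exact h4.ofReal_comp
    rw [e] at d1
    have := d1.unique (d2.sub (d4.mul d3))
    simp only [inner_zero_left, add_zero, inner_smul_right, hU.zero_apply, mul_zero,
      Complex.ofReal_zero, zero_mul, hV.inner_symm_of_mem_graph hyz h₂₁] at this
    rw [inner_sub_right, inner_smul_right]
    have h5 : Complex.I * Complex.I = -1 := Complex.I_mul_I
    linear_combination (Complex.I) * this + (⟪y, v₁₂⟫_ℂ - ⟪y, v₂₁⟫_ℂ) * h5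
  refine hV.dense_domain.eq_of_inner_right ℂ fun y hy => ?_
  obtain ⟨z, hz⟩ := LinearPMap.mem_domain_iff.mp hy
  exact key y z hz

end IsUnitaryGroup

end UnitaryGroups

end

end TwistedFieldModel

namespace TwistedFieldModel

noncomputable section

/-! ### Fermionic Fock space: creation, annihilation and second quantization -/

section FockOperators

variable {V : Type*} [NormedAddCommGroup V] [InnerProductSpace ℂ V]

variable (V) in
/-- The canonical map from formal wedge products to the Fock space. -/
def PreFock.toFock : PreFock V →L[ℂ] Fock V := UniformSpace.Completion.toComplL

namespace PreFock

/-- The formal wedge product of a finite family. -/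
def single (a : Σ n : ℕ, (Fin n → V)) : PreFock V := PreFock.mk V (Finsupp.single a 1)

theorem toFock_single {n : ℕ} (f : Fin n → V) : toFock V (single ⟨n, f⟩) = wedge f := rfl

theorem inner_single (a b : Σ n : ℕ, (Fin n → V)) : ⟪single a, single b⟫_ℂ = detKernel V a b := by
  change gramForm (Finsupp.single _ _) (Finsupp.single _ _) = _
  simp [gramForm]

theorem inner_toFock (x y : PreFock V) : ⟪toFock V x, toFock V y⟫_ℂ = ⟪x, y⟫_ℂ :=
  UniformSpace.Completion.inner_coe _ _

theorem norm_toFock (x : PreFock V) : ‖toFock V x‖ = ‖x‖ :=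
  UniformSpace.Completion.norm_coe _

omit [NormedAddCommGroup V] [InnerProductSpace ℂ V] in
theorem span_single : Submodule.span ℂ (Set.range (single (V := V))) = ⊤ := by
  rw [eq_top_iff]
  intro x _
  suffices h : ∀ y, PreFock.mk V y ∈ Submodule.span ℂ (Set.range (single (V := V))) from h x
  intro y
  induction y using Finsupp.induction_linear with
  | zero => rw [map_zero]; exact Submodule.zero_mem _
  | add x y hx hy => rw [map_add]; exact Submodule.add_mem _ hx hy
  | single a c =>
    have h : Finsupp.single a c = c • Finsupp.single a (1 : ℂ) := by simp
    rw [h, map_smul]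
    exact Submodule.smul_mem _ _ (Submodule.subset_span ⟨a, rfl⟩)

omit [NormedAddCommGroup V] [InnerProductSpace ℂ V] in
@[elab_as_elim]
theorem induction {p : PreFock V → Prop} (x : PreFock V) (single : ∀ a, p (single a))
    (zero : p 0) (add : ∀ x y, p x → p y → p (x + y)) (smul : ∀ (c : ℂ) x, p x → p (c • x)) :
    p x := by
  have hx : x ∈ Submodule.span ℂ (Set.range (PreFock.single (V := V))) := by
    rw [span_single]; trivial
  induction hx using Submodule.span_induction with
  | mem x hx => obtain ⟨a, rfl⟩ := hx; exact single a
  | zero => exact zero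
  | add x y _ _ hx hy => exact add x y hx hy
  | smul c x _ hx => exact smul c x hx

/-- The linear extension of a map on formal products. -/
def lift {W : Type*} [AddCommGroup W] [Module ℂ W] (φ : (Σ n : ℕ, (Fin n → V)) → W) :
    PreFock V →ₗ[ℂ] W :=
  (Finsupp.linearCombination ℂ φ : ((Σ n : ℕ, (Fin n → V)) →₀ ℂ) →ₗ[ℂ] W)

omit [NormedAddCommGroup V] [InnerProductSpace ℂ V] in
theorem lift_single {W : Type*} [AddCommGroup W] [Module ℂ W] (φ : (Σ n : ℕ, (Fin n → V)) → W)
    (a : Σ n : ℕ, (Fin n → V)) : lift φ (single a) = φ a := by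
  refine (Finsupp.linearCombination_single ℂ (1 : ℂ) a).trans (one_smul _ _)

/-- Exterior multiplication by `f`. -/
def wedgeLeft (f : V) : PreFock V →ₗ[ℂ] PreFock V :=
  lift fun a => single ⟨a.1 + 1, Fin.cons f a.2⟩

omit [NormedAddCommGroup V] [InnerProductSpace ℂ V] in
theorem wedgeLeft_single (f : V) (a : Σ n : ℕ, (Fin n → V)) :
    wedgeLeft f (single a) = single ⟨a.1 + 1, Fin.cons f a.2⟩ := lift_single _ _

/-- The contraction of a formal product with `⟨f, ·⟩`. -/
def contractSingle (f : V) : (Σ n : ℕ, (Fin n → V)) → PreFock V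
  | ⟨0, _⟩ => 0
  | ⟨n + 1, g⟩ => ∑ k : Fin (n + 1),
      ((-1) ^ (k : ℕ) * ⟪f, g k⟫_ℂ) • single ⟨n, fun i => g (k.succAbove i)⟩

/-- Contraction with `⟨f, ·⟩`. -/
def contract (f : V) : PreFock V →ₗ[ℂ] PreFock V := lift (contractSingle f)

theorem contract_single (f : V) (a : Σ n : ℕ, (Fin n → V)) :
    contract f (single a) = contractSingle f a := lift_single _ _

/-- On products this is the Laplace expansion of the Gram determinant along its first row. -/
theorem inner_wedgeLeft_left (f : V) (x y : PreFock V) :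
    ⟪wedgeLeft f x, y⟫_ℂ = ⟪x, contract f y⟫_ℂ := by
  induction x using PreFock.induction with
  | zero => simp
  | add x x' h h' => rw [map_add, inner_add_left, inner_add_left, h, h']
  | smul c x h => rw [map_smul, inner_smul_left, inner_smul_left, h]
  | single a =>
    induction y using PreFock.induction with
    | zero => simp
    | add x x' h h' => rw [map_add, inner_add_right, inner_add_right, h, h']
    | smul c x h => rw [map_smul, inner_smul_right, inner_smul_right, h]
    | single b =>
      rw [wedgeLeft_single, contract_single, inner_single]
      obtain ⟨n, v⟩ := a
      obtain ⟨m, g⟩ := b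
      cases m with
      | zero => simp [contractSingle, detKernel]
      | succ m =>
        simp only [contractSingle, inner_sum, inner_smul_right, inner_single]
        by_cases h : n = m
        · subst h
          simp only [detKernel, dite_true, Fin.cast_eq_self]
          rw [Matrix.det_succ_row_zero]
          rfl
        · simp [detKernel, h]

/-- Contracting the new first factor gives the right-hand side. Contracting any later factor comes
with one extra sign, because its position has moved by one, and cancels against the second summand.
-/
theorem contract_wedgeLeft (f h : V) (x : PreFock V) :
    contract f (wedgeLeft h x) + wedgeLeft h (contract f x) = ⟪f, h⟫_ℂ • x := by
  induction x using PreFock.induction with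
  | zero => simp
  | add x x' h h' => simp only [map_add, smul_add, ← h, ← h']; abel
  | smul c x h => rw [map_smul, map_smul, map_smul, map_smul, ← smul_add, h, smul_comm]
  | single a =>
    rw [wedgeLeft_single, contract_single, contract_single]
    obtain ⟨n, v⟩ := a
    cases n with
    | zero =>
      simp only [contractSingle, map_zero, add_zero]
      simp
    | succ n =>
      simp only [contractSingle, map_sum, map_smul, wedgeLeft_single]
      rw [Fin.sum_univ_succ, add_assoc, ← Finset.sum_add_distrib]
      simp only [Fin.cons_zero, Fin.cons_succ, Fin.val_zero, pow_zero, one_mul, Fin.val_succ,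
        Fin.succAbove_zero]
      rw [Finset.sum_eq_zero, add_zero]
      intro k _
      have : (fun i => (Fin.cons h v : Fin (n + 2) → V) (k.succ.succAbove i)) =
          (Fin.cons h fun i => v (k.succAbove i) : Fin (n + 1) → V) := by
        ext i
        refine Fin.cases ?_ (fun i => ?_) i <;> simp
      rw [this, ← add_smul, pow_succ]
      simp

/-- The anticommutation relation yields `‖f ∧ x‖² + ‖contract f x‖² = ‖f‖² ‖x‖²`. The bound is what
lets exterior multiplication extend to the completion. -/
theorem norm_wedgeLeft_le (f : V) (x : PreFock V) : ‖wedgeLeft f x‖ ≤ ‖f‖ * ‖x‖ := by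
  have h : ⟪wedgeLeft f x, wedgeLeft f x⟫_ℂ + ⟪contract f x, contract f x⟫_ℂ =
      ⟪f, f⟫_ℂ * ⟪x, x⟫_ℂ := by
    rw [← inner_smul_right, ← contract_wedgeLeft, inner_add_right,
      ← inner_conj_symm x (wedgeLeft f (contract f x)), inner_wedgeLeft_left f (contract f x),
      inner_conj_symm, inner_wedgeLeft_left]
  simp only [inner_self_eq_norm_sq_to_K] at h
  norm_cast at h
  refine abs_le_of_sq_le_sq' ?_ (by positivity) |>.2
  rw [mul_pow]
  have h' : ‖wedgeLeft f x‖ ^ 2 + ‖contract f x‖ ^ 2 = ‖f‖ ^ 2 * ‖x‖ ^ 2 := by exact_mod_cast h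
  nlinarith [sq_nonneg ‖contract f x‖]

end PreFock

theorem exists_creation (f : V) : ∃ T : Fock V →L[ℂ] Fock V,
    ∀ x, T (PreFock.toFock V x) = PreFock.toFock V (PreFock.wedgeLeft f x) :=
  ⟨((PreFock.wedgeLeft f).mkContinuous ‖f‖ (PreFock.norm_wedgeLeft_le f)).completion,
    fun _ => ContinuousLinearMap.completion_apply_coe _ _⟩

theorem creation_wedge (f : V) {n : ℕ} (g : Fin n → V) :
    creation f (wedge g) = wedge (Fin.cons f g : Fin (n + 1) → V) := by
  have h : ∃ T : Fock V →L[ℂ] Fock V, ∀ (n : ℕ) (g : Fin n → V),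
      T (wedge g) = wedge (Fin.cons f g : Fin (n + 1) → V) := by
    obtain ⟨T, hT⟩ := exists_creation f
    refine ⟨T, fun n g => ?_⟩
    rw [← PreFock.toFock_single, hT, PreFock.wedgeLeft_single, PreFock.toFock_single]
  rw [creation, dif_pos h]
  exact h.choose_spec n g

theorem creation_toFock (f : V) (x : PreFock V) :
    creation f (PreFock.toFock V x) = PreFock.toFock V (PreFock.wedgeLeft f x) := by
  obtain ⟨T, hT⟩ := exists_creation f
  have : creation f = T := eq_of_eq_on_wedge fun n g => by
    rw [creation_wedge, ← PreFock.toFock_single, ← PreFock.toFock_single, hT,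
      PreFock.wedgeLeft_single]
  rw [this, hT]

theorem norm_creation_apply_le (f : V) (x : Fock V) : ‖creation f x‖ ≤ ‖f‖ * ‖x‖ := by
  induction x using UniformSpace.Completion.induction_on with
  | hp => exact isClosed_le (by fun_prop) (by fun_prop)
  | ih x =>
    change ‖creation f (PreFock.toFock V x)‖ ≤ ‖f‖ * ‖PreFock.toFock V x‖
    rw [creation_toFock, PreFock.norm_toFock, PreFock.norm_toFock]
    exact PreFock.norm_wedgeLeft_le f x

theorem fock_ext {x y : Fock V} (h : ∀ (n : ℕ) (g : Fin n → V), ⟪wedge g, x⟫_ℂ = ⟪wedge g, y⟫_ℂ) :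
    x = y := by
  refine dense_span_wedge.eq_of_inner_right ℂ fun v hv => ?_
  induction hv using Submodule.span_induction with
  | mem v hv => obtain ⟨n, g, rfl⟩ := hv; exact h n g
  | zero => simp
  | add a b _ _ ha hb => rw [inner_add_left, inner_add_left, ha, hb]
  | smul c a _ ha => rw [inner_smul_left, inner_smul_left, ha]

theorem annihilation_toFock (f : V) (x : PreFock V) :
    annihilation f (PreFock.toFock V x) = PreFock.toFock V (PreFock.contract f x) := by
  refine fock_ext fun n g => ?_
  rw [annihilation, ContinuousLinearMap.adjoint_inner_right, ← PreFock.toFock_single,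
    creation_toFock, PreFock.inner_toFock, PreFock.inner_toFock, PreFock.inner_wedgeLeft_left]

theorem annihilation_mul_creation (f h : V) :
    annihilation f * creation h + creation h * annihilation f = ⟪f, h⟫_ℂ • 1 := by
  refine eq_of_eq_on_wedge fun n g => ?_
  change annihilation f (creation h (wedge g)) + creation h (annihilation f (wedge g)) =
    ⟪f, h⟫_ℂ • wedge g
  rw [← PreFock.toFock_single, creation_toFock, annihilation_toFock, annihilation_toFock,
    creation_toFock, ← map_add, PreFock.contract_wedgeLeft, map_smul]

theorem of_inner_update {n : ℕ} (g f : Fin n → V) (k : Fin n) (z : V) :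
    (Matrix.of fun i j => ⟪g i, Function.update f k z j⟫_ℂ) =
      (Matrix.of fun i j => ⟪g i, f j⟫_ℂ).updateCol k fun i => ⟪g i, z⟫_ℂ := by
  ext i j
  by_cases hj : j = k
  · subst hj; simp
  · simp [Matrix.updateCol_ne hj, Function.update_of_ne hj]

variable (V) in
/-- The product vector as an alternating function of its factors. -/
def wedgeAlternating (n : ℕ) : V [⋀^Fin n]→ₗ[ℂ] Fock V where
  toFun f := wedge f
  map_update_add' {inst} f k x y := by
    obtain rfl := Subsingleton.elim inst (instDecidableEqFin n)
    -- Formal products are not multilinear; the relations hold only in `Fock V`, where null vectors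
    -- vanish. They are read off from the columns of the Gram determinant.
    refine fock_ext fun m g => ?_
    by_cases h : m = n
    · subst h
      simp only [inner_add_right, inner_wedge, of_inner_update]
      exact Matrix.det_updateCol_add _ k _ _
    · simp [inner_add_right, inner_wedge_of_ne h]
  map_update_smul' {inst} f k c x := by
    obtain rfl := Subsingleton.elim inst (instDecidableEqFin n)
    refine fock_ext fun m g => ?_
    by_cases h : m = n
    · subst h
      simp only [inner_smul_right, inner_wedge, of_inner_update]
      exact Matrix.det_updateCol_smul _ k c _
    · simp [inner_smul_right, inner_wedge_of_ne h]
  map_eq_zero_of_eq' f i j hf hij := by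
    refine fock_ext fun m g => ?_
    by_cases h : m = n
    · subst h
      rw [inner_wedge, inner_zero_right]
      exact Matrix.det_zero_of_column_eq hij fun k => by simp [hf]
    · simp [inner_wedge_of_ne h]

/-- Hadamard's inequality for Gram determinants, obtained by creating one factor at a time. -/
theorem norm_wedge_le {n : ℕ} (f : Fin n → V) : ‖wedge f‖ ≤ ∏ i, ‖f i‖ := by
  induction n with
  | zero =>
    rw [Finset.univ_eq_empty, Finset.prod_empty, @norm_eq_sqrt_re_inner ℂ, inner_wedge]
    simp
  | succ n ih =>
    rw [Fin.prod_univ_succ, ← Fin.cons_self_tail f, ← creation_wedge]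
    refine (norm_creation_apply_le _ _).trans ?_
    simp only [Fin.cons_zero, Fin.cons_succ]
    gcongr
    exact ih _

variable (V) in
/-- The product vector as a bounded multilinear function of its factors. -/
def wedgeL (n : ℕ) : ContinuousMultilinearMap ℂ (fun _ : Fin n => V) (Fock V) :=
  (wedgeAlternating V n).toMultilinearMap.mkContinuous 1 fun f => by
    rw [one_mul]; exact norm_wedge_le f

theorem continuous_wedge {n : ℕ} : Continuous fun f : Fin n → V => wedge f :=
  (wedgeL V n).cont

/-- This Leibniz rule is the reason why `dΓ_a` generates the second quantized group. -/
theorem hasDerivAt_wedge {n : ℕ} {f : ℝ → Fin n → V} {f' : Fin n → V} {t : ℝ}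
    (h : ∀ i, HasDerivAt (fun s => f s i) (f' i) t) :
    HasDerivAt (fun s => wedge (f s)) (∑ k, wedge (Function.update (f t) k (f' k))) t := by
  have h1 := (((wedgeL V n).restrictScalars ℝ).hasFDerivAt (f t)).comp_hasDerivAt t
    (hasDerivAt_pi.mpr h)
  refine h1.congr_deriv ?_
  rw [ContinuousMultilinearMap.linearDeriv_apply]
  rfl

variable (V) in
/-- The creation operators as a bounded linear map. -/
def creationL : V →L[ℂ] Fock V →L[ℂ] Fock V :=
  LinearMap.mkContinuous
    { toFun := creation
      map_add' := fun f g => eq_of_eq_on_wedge fun n v => by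
        rw [add_apply, creation_wedge, creation_wedge, creation_wedge]
        simpa [wedgeAlternating] using (wedgeAlternating V (n + 1)).map_update_add
          (Fin.cons 0 v) 0 f g
      map_smul' := fun c f => eq_of_eq_on_wedge fun n v => by
        rw [RingHom.id_apply, smul_apply, creation_wedge, creation_wedge]
        simpa [wedgeAlternating] using (wedgeAlternating V (n + 1)).map_update_smul (Fin.cons 0 v) 0 c f }
    1 fun f => by
      rw [one_mul]
      exact ContinuousLinearMap.opNorm_le_bound _ (norm_nonneg _) (norm_creation_apply_le f)

theorem creationL_apply (f : V) : creationL V f = creation f := rfl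

theorem creation_mul_creation (f h : V) :
    creation f * creation h + creation h * creation f = 0 := by
  refine eq_of_eq_on_wedge fun n g => ?_
  change creation f (creation h (wedge g)) + creation h (creation f (wedge g)) = 0
  simp only [creation_wedge]
  have := (wedgeAlternating V (n + 2)).map_swap_add
    (Fin.cons f (Fin.cons h g : Fin (n + 1) → V)) (i := 0) (j := 1) (by simp)
  rw [add_comm] at this
  have e : (Fin.cons f (Fin.cons h g : Fin (n + 1) → V) : Fin (n + 2) → V) ∘ Equiv.swap 0 1 =
      Fin.cons h (Fin.cons f g : Fin (n + 1) → V) := by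
    ext i
    refine Fin.cases ?_ (fun i => ?_) i
    · simp
    · refine Fin.cases ?_ (fun i => ?_) i
      · simp
      · rw [Function.comp_apply, Equiv.swap_apply_of_ne_of_ne]
        · simp
        · exact Fin.succ_ne_zero _
        · intro h
          have := congrArg Fin.val h
          simp at this
  rw [e] at this
  exact this

theorem annihilation_eq_star (f : V) : annihilation f = star (creation f) :=
  (ContinuousLinearMap.star_eq_adjoint _).symm

theorem annihilation_mul_annihilation (f h : V) :
    annihilation f * annihilation h + annihilation h * annihilation f = 0 := by
  have := congrArg star (creation_mul_creation h f)
  simpa [annihilation_eq_star] using this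

/-- A map that preserves inner products leaves every Gram determinant unchanged, so the induced map
on formal products is isometric. -/
theorem exists_secondQuant {T : V → V} (hT : ∀ x y, ⟪T x, T y⟫_ℂ = ⟪x, y⟫_ℂ) :
    ∃ G : Fock V →L[ℂ] Fock V, ∀ (n : ℕ) (f : Fin n → V),
      G (wedge f) = wedge (fun i => T (f i)) := by
  let F : PreFock V →ₗ[ℂ] PreFock V := PreFock.lift fun a => PreFock.single ⟨a.1, fun i => T (a.2 i)⟩
  have hF : ∀ x y, ⟪F x, F y⟫_ℂ = ⟪x, y⟫_ℂ := by
    intro x y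
    induction x using PreFock.induction with
    | zero => simp
    | add x x' h h' => rw [map_add, inner_add_left, inner_add_left, h, h']
    | smul c x h => rw [map_smul, inner_smul_left, inner_smul_left, h]
    | single a =>
      induction y using PreFock.induction with
      | zero => simp
      | add x x' h h' => rw [map_add, inner_add_right, inner_add_right, h, h']
      | smul c x h => rw [map_smul, inner_smul_right, inner_smul_right, h]
      | single b =>
        simp only [F, PreFock.lift_single, PreFock.inner_single, detKernel, hT]
  have hn : ∀ x, ‖F x‖ ≤ 1 * ‖x‖ := fun x => by
    rw [@norm_eq_sqrt_re_inner ℂ, hF, ← @norm_eq_sqrt_re_inner ℂ, one_mul]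
  refine ⟨(F.mkContinuous 1 hn).completion, fun n f => ?_⟩
  refine (ContinuousLinearMap.completion_apply_coe _ _).trans ?_
  change PreFock.toFock V (F (PreFock.single ⟨n, f⟩)) = _
  simp only [F, PreFock.lift_single, PreFock.toFock_single]

theorem secondQuant_wedge {T : V → V} (hT : ∀ x y, ⟪T x, T y⟫_ℂ = ⟪x, y⟫_ℂ) {n : ℕ}
    (f : Fin n → V) : secondQuant T (wedge f) = wedge (fun i => T (f i)) := by
  rw [secondQuant, dif_pos (exists_secondQuant hT)]
  exact (exists_secondQuant hT).choose_spec n f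

theorem secondQuant_mul {S T : V → V} (hS : ∀ x y, ⟪S x, S y⟫_ℂ = ⟪x, y⟫_ℂ)
    (hT : ∀ x y, ⟪T x, T y⟫_ℂ = ⟪x, y⟫_ℂ) :
    secondQuant S * secondQuant T = secondQuant (S ∘ T) := by
  refine eq_of_eq_on_wedge fun n f => ?_
  rw [mul_apply_eq_comp, secondQuant_wedge hT, secondQuant_wedge hS,
    secondQuant_wedge (T := S ∘ T) fun x y => (hS _ _).trans (hT x y)]
  rfl

theorem secondQuant_id : secondQuant (id : V → V) = 1 :=
  eq_of_eq_on_wedge fun n f => by rw [secondQuant_wedge (T := id) fun _ _ => rfl]; rfl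

theorem inner_secondQuant {T : V → V} (hT : ∀ x y, ⟪T x, T y⟫_ℂ = ⟪x, y⟫_ℂ) (x y : Fock V) :
    ⟪secondQuant T x, secondQuant T y⟫_ℂ = ⟪x, y⟫_ℂ := by
  have h : star (secondQuant T) * secondQuant T = 1 := by
    refine eq_of_eq_on_wedge fun n f => fock_ext fun m g => ?_
    rw [mul_apply_eq_comp, ContinuousLinearMap.star_eq_adjoint,
      ContinuousLinearMap.adjoint_inner_right, secondQuant_wedge hT, secondQuant_wedge hT,
      one_apply_eq_self]
    by_cases h : m = n
    · subst h
      simp [inner_wedge, hT]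
    · simp [inner_wedge_of_ne h]
  rw [← ContinuousLinearMap.adjoint_inner_right, ← ContinuousLinearMap.star_eq_adjoint,
    ← mul_apply_eq_comp, h, one_apply_eq_self]

theorem star_secondQuant {S T : V → V} (hS : ∀ x y, ⟪S x, S y⟫_ℂ = ⟪x, y⟫_ℂ)
    (hT : ∀ x y, ⟪T x, T y⟫_ℂ = ⟪x, y⟫_ℂ) (hST : S ∘ T = id) :
    star (secondQuant S) = secondQuant T := by
  ext1 x
  refine ext_inner_right ℂ fun y => ?_
  have h : y = secondQuant S (secondQuant T y) := by
    rw [← mul_apply_eq_comp, secondQuant_mul hS hT, hST, secondQuant_id, one_apply_eq_self]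
  rw [ContinuousLinearMap.star_eq_adjoint, ContinuousLinearMap.adjoint_inner_left]
  have h2 : x = secondQuant S (secondQuant T x) := by
    rw [← mul_apply_eq_comp, secondQuant_mul hS hT, hST, secondQuant_id, one_apply_eq_self]
  conv_lhs => rw [h2, inner_secondQuant hS]

theorem secondQuant_mul_creation {T : V → V} (hT : ∀ x y, ⟪T x, T y⟫_ℂ = ⟪x, y⟫_ℂ) (f : V) :
    secondQuant T * creation f = creation (T f) * secondQuant T := by
  refine eq_of_eq_on_wedge fun n g => ?_
  rw [mul_apply_eq_comp, mul_apply_eq_comp, creation_wedge, secondQuant_wedge hT,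
    secondQuant_wedge hT, creation_wedge]
  congr 1
  ext i
  refine Fin.cases ?_ (fun i => ?_) i <;> simp

/-- The adjoint of the creation rule for the inverse map. -/
theorem secondQuant_mul_annihilation {S T : V → V} (hS : ∀ x y, ⟪S x, S y⟫_ℂ = ⟪x, y⟫_ℂ)
    (hT : ∀ x y, ⟪T x, T y⟫_ℂ = ⟪x, y⟫_ℂ) (hTS : T ∘ S = id) (f : V) :
    secondQuant S * annihilation f = annihilation (S f) * secondQuant S := by
  have h := congrArg star (secondQuant_mul_creation hT (S f))
  rw [star_mul, star_mul, star_secondQuant hT hS hTS, ← annihilation_eq_star,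
    ← annihilation_eq_star, show T (S f) = f from congrFun hTS f] at h
  exact h.symm

section Generator
variable [CompleteSpace V] {u : ℝ → V →L[ℂ] V}

theorem IsUnitaryGroup.secondQuant (hu : IsUnitaryGroup u) :
    IsUnitaryGroup fun t => secondQuant (u t) := by
  have hadd : ∀ s t, (TwistedFieldModel.secondQuant (u (s + t))) =
      TwistedFieldModel.secondQuant (u s) * TwistedFieldModel.secondQuant (u t) := fun s t => by
    rw [secondQuant_mul (hu.inner_map_map s) (hu.inner_map_map t), hu.add]; rfl
  have hzero : TwistedFieldModel.secondQuant (u 0) = 1 := by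
    rw [hu.zero]; exact secondQuant_id
  have hstar : ∀ t, star (TwistedFieldModel.secondQuant (u t)) =
      TwistedFieldModel.secondQuant (u (-t)) := fun t =>
    star_secondQuant (hu.inner_map_map t) (hu.inner_map_map (-t))
      (funext fun v => hu.apply_neg_apply t v)
  have hnorm : ∀ t x, ‖TwistedFieldModel.secondQuant (u t) x‖ = ‖x‖ := fun t x => by
    rw [@norm_eq_sqrt_re_inner ℂ, inner_secondQuant (hu.inner_map_map t),
      ← @norm_eq_sqrt_re_inner ℂ]
  refine ⟨fun t => ?_, hzero, hadd, fun v => ?_⟩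
  · rw [Unitary.mem_iff, hstar, ← hadd, ← hadd, neg_add_cancel, add_neg_cancel, hzero]
    exact ⟨rfl, rfl⟩
  · have hw : ∀ x ∈ Submodule.span ℂ {x : Fock V | ∃ (n : ℕ) (f : Fin n → V), x = wedge f},
        Continuous fun t => TwistedFieldModel.secondQuant (u t) x := by
      intro x hx
      induction hx using Submodule.span_induction with
      | mem x hx =>
        obtain ⟨n, f, rfl⟩ := hx
        simp only [secondQuant_wedge (hu.inner_map_map _)]
        exact continuous_wedge.comp (continuous_pi fun i => hu.continuous _)
      | zero => simp only [map_zero]; exact continuous_const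
      | add a b _ _ ha hb => simp only [map_add]; exact ha.add hb
      | smul c a _ ha => simp only [map_smul]; exact ha.const_smul c
    -- All the operators are isometric, so an approximation of `v` by combinations of product
    -- vectors is uniform in `t`.
    refine continuous_of_uniform_approx_of_continuous fun U hU => ?_
    obtain ⟨ε, hε, hεU⟩ := Metric.mem_uniformity_dist.mp hU
    obtain ⟨x, hx, hxm⟩ := Metric.dense_iff.mp dense_span_wedge v ε hε
    refine ⟨fun t => TwistedFieldModel.secondQuant (u t) x, hw x hxm, fun t => hεU ?_⟩
    rw [dist_eq_norm, ← map_sub, hnorm, ← dist_eq_norm, dist_comm]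
    exact hx

/-- The core criterion, applied to products of vectors of `Dom A`. It is enough that `A` is a
densely defined invariant restriction of the one-particle generator; equality with that generator
need not be known. -/
theorem diffSecondQuant_eq_stoneGenerator (hu : IsUnitaryGroup u) {A : V →ₗ.[ℂ] V}
    (hA : A ≤ stoneGenerator u) (hdense : Dense (A.domain : Set V))
    (hinv : ∀ t, ∀ p ∈ A.graph, (u t p.1, u t p.2) ∈ A.graph) :
    diffSecondQuant A = stoneGenerator fun t => secondQuant (u t) := by
  refine hu.secondQuant.toLinearPMap_closure_span_eq ?_ ?_ ?_
  · rintro _ ⟨n, f, rfl⟩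
    rw [SetLike.mem_coe, mem_graph_stoneGenerator]
    simp only [secondQuant_wedge (hu.inner_map_map _)]
    have h := hasDerivAt_wedge (f := fun t i => u t (f i : V)) (f' := fun i => Complex.I • A (f i))
      (t := 0) fun i => by
        have := LinearPMap.le_graph_of_le hA (A.mem_graph (f i))
        rwa [mem_graph_stoneGenerator] at this
    refine h.congr_deriv ?_
    rw [Finset.smul_sum]
    refine Finset.sum_congr rfl fun k _ => ?_
    simp only [hu.zero_apply]
    exact (wedgeAlternating V n).map_update_smul _ k _ _
  · rintro _ ⟨n, f, rfl⟩ t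
    have h : ∀ i, ∃ y : A.domain, (y : V) = u t (f i : V) ∧ A y = u t (A (f i)) := by
      intro i
      obtain ⟨y, h1, h2⟩ := A.mem_graph_iff.mp (hinv t _ (A.mem_graph (f i)))
      exact ⟨y, h1, h2⟩
    choose g hg hg' using h
    refine ⟨n, g, ?_⟩
    simp only [map_sum, secondQuant_wedge (hu.inner_map_map _), hg, hg']
    congr 1
    refine Finset.sum_congr rfl fun k _ => congrArg wedge ?_
    ext i
    by_cases h : i = k
    · subst h; simp
    · simp [Function.update_of_ne h]
  · rw [← dense_closure]
    refine dense_span_wedge.mono (Submodule.span_le (p := Submodule.topologicalClosure _).mpr ?_)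
    rintro _ ⟨n, f, rfl⟩
    -- Each factor is approximated within `Dom A`, and `wedge` is jointly continuous.
    have hf : f ∈ closure (Set.univ.pi fun _ : Fin n => (A.domain : Set V)) := by
      rw [closure_pi_set]
      exact fun i _ => hdense (f i)
    refine closure_mono ?_ (image_closure_subset_closure_image continuous_wedge ⟨f, hf, rfl⟩)
    rintro _ ⟨g, hg, rfl⟩
    exact Submodule.subset_span ⟨_, ⟨n, fun i => ⟨g i, hg i trivial⟩, rfl⟩, rfl⟩

end Generator

end FockOperators

end

end TwistedFieldModel

namespace TwistedFieldModel

noncomputable section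

/-! ### Hilbert space tensor products of operators and of unitary groups -/

section HilbertTensors

variable {H K : Type*} [NormedAddCommGroup H] [InnerProductSpace ℂ H]
  [NormedAddCommGroup K] [InnerProductSpace ℂ K]

theorem inner_tmul_tmul (v v' : H) (w w' : K) :
    ⟪tmul v w, tmul v' w'⟫_ℂ = ⟪v, v'⟫_ℂ * ⟪w, w'⟫_ℂ :=
  (UniformSpace.Completion.inner_coe _ _).trans (TensorProduct.inner_tmul _ _ _ _ _)

variable (H K) in
/-- The bounded bilinear map `(v, w) ↦ v ⊗ w`. -/
def tmulL : H →L[ℂ] K →L[ℂ] HilbertTensor H K :=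
  (ContinuousLinearMap.compL ℂ K (TensorProduct ℂ H K) (HilbertTensor H K)
    UniformSpace.Completion.toComplL) ∘L TensorProduct.mkL ℂ H K

theorem tmulL_apply (v : H) (w : K) : tmulL H K v w = tmul v w := rfl

theorem continuous_tmul : Continuous fun p : H × K => tmul p.1 p.2 :=
  (tmulL H K).continuous₂

theorem dense_span_tmul : Dense (Submodule.span ℂ
    {x : HilbertTensor H K | ∃ (v : H) (w : K), x = tmul v w} : Set (HilbertTensor H K)) := by
  refine (UniformSpace.Completion.denseRange_coe (α := TensorProduct ℂ H K)).mono ?_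
  rintro _ ⟨x, rfl⟩
  change UniformSpace.Completion.toComplL (𝕜 := ℂ) x ∈ Submodule.span ℂ _
  induction x using TensorProduct.induction_on with
  | zero => rw [map_zero]; exact Submodule.zero_mem _
  | add x y hx hy => rw [map_add]; exact Submodule.add_mem _ hx hy
  | tmul v w => exact Submodule.subset_span ⟨v, w, rfl⟩

theorem eq_of_eq_on_tmul {E : Type*} [NormedAddCommGroup E] [NormedSpace ℂ E]
    {S T : HilbertTensor H K →L[ℂ] E} (h : ∀ v w, S (tmul v w) = T (tmul v w)) : S = T := by
  refine ContinuousLinearMap.ext_on dense_span_tmul ?_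
  rintro _ ⟨v, w, rfl⟩
  exact h v w

theorem tensorOp_tmul (S : H →L[ℂ] H) (T : K →L[ℂ] K) (v : H) (w : K) :
    tensorOp S T (tmul v w) = tmul (S v) (T w) :=
  ContinuousLinearMap.completion_apply_coe _ _

theorem tensorOp_mul (S S' : H →L[ℂ] H) (T T' : K →L[ℂ] K) :
    tensorOp S T * tensorOp S' T' = tensorOp (S * S') (T * T') :=
  eq_of_eq_on_tmul fun v w => by simp only [mul_apply_eq_comp, tensorOp_tmul]

theorem tensorOp_one : tensorOp (1 : H →L[ℂ] H) (1 : K →L[ℂ] K) = 1 :=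
  eq_of_eq_on_tmul fun v w => by simp only [one_apply_eq_self, tensorOp_tmul]

theorem tensorOp_smul_right (c : ℂ) (S : H →L[ℂ] H) (T : K →L[ℂ] K) :
    tensorOp S (c • T) = c • tensorOp S T :=
  eq_of_eq_on_tmul fun v w => by
    simp only [tensorOp_tmul, smul_apply]
    simp [← tmulL_apply]

theorem norm_tensorOp_apply_le (S : H →L[ℂ] H) (T : K →L[ℂ] K) (x : HilbertTensor H K) :
    ‖tensorOp S T x‖ ≤ ‖S‖ * ‖T‖ * ‖x‖ := by
  induction x using UniformSpace.Completion.induction_on with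
  | hp => exact isClosed_le (by fun_prop) (by fun_prop)
  | ih x =>
    have h : tensorOp S T (x : HilbertTensor H K) = (TensorProduct.mapL S T x : _) :=
      ContinuousLinearMap.completion_apply_coe _ _
    rw [h, UniformSpace.Completion.norm_coe, UniformSpace.Completion.norm_coe]
    exact (ContinuousLinearMap.le_opNorm _ _).trans
      (by gcongr; exact TensorProduct.norm_mapL_le S T)

variable (H K) in
/-- The bounded linear map `S ↦ S ⊗ 1`. -/
def tensorOneL : (H →L[ℂ] H) →L[ℂ] HilbertTensor H K →L[ℂ] HilbertTensor H K :=
  LinearMap.mkContinuous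
    { toFun := fun S => tensorOp S 1
      map_add' := fun S T => eq_of_eq_on_tmul fun v w => by
        simp only [tensorOp_tmul, add_apply]
        simp [← tmulL_apply]
      map_smul' := fun c S => eq_of_eq_on_tmul fun v w => by
        simp only [tensorOp_tmul, smul_apply, RingHom.id_apply]
        simp [← tmulL_apply] }
    1 fun S => by
      refine ContinuousLinearMap.opNorm_le_bound _ (by positivity) fun x => ?_
      refine (norm_tensorOp_apply_le S 1 x).trans ?_
      rw [mul_comm 1]
      gcongr
      exact ContinuousLinearMap.norm_id_le

theorem tensorOneL_apply (S : H →L[ℂ] H) : tensorOneL H K S = tensorOp S 1 := rfl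

variable [CompleteSpace H] [CompleteSpace K]

theorem star_tensorOp (S : H →L[ℂ] H) (T : K →L[ℂ] K) :
    star (tensorOp S T) = tensorOp (star S) (star T) := by
  refine eq_of_eq_on_tmul fun v w => ?_
  refine dense_span_tmul.eq_of_inner_left ℂ fun x hx => ?_
  rw [ContinuousLinearMap.star_eq_adjoint, ContinuousLinearMap.adjoint_inner_left]
  induction hx using Submodule.span_induction with
  | mem x hx =>
    obtain ⟨v', w', rfl⟩ := hx
    rw [tensorOp_tmul, tensorOp_tmul, inner_tmul_tmul, inner_tmul_tmul,
      ContinuousLinearMap.star_eq_adjoint, ContinuousLinearMap.star_eq_adjoint,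
      ContinuousLinearMap.adjoint_inner_left, ContinuousLinearMap.adjoint_inner_left]
  | zero => simp
  | add a b _ _ ha hb => rw [map_add, inner_add_right, inner_add_right, ha, hb]
  | smul c a _ ha => rw [map_smul, inner_smul_right, inner_smul_right, ha]

variable {U : ℝ → H →L[ℂ] H} {V : ℝ → K →L[ℂ] K}

theorem IsUnitaryGroup.tensor (hU : IsUnitaryGroup U) (hV : IsUnitaryGroup V) :
    IsUnitaryGroup fun t => tensorOp (U t) (V t) := by
  have hun : ∀ t, tensorOp (U t) (V t) ∈ _root_.unitary (HilbertTensor H K →L[ℂ] HilbertTensor H K) := by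
    intro t
    have h1 := Unitary.mem_iff.mp (hU.unitary t)
    have h2 := Unitary.mem_iff.mp (hV.unitary t)
    rw [Unitary.mem_iff, star_tensorOp, tensorOp_mul, tensorOp_mul, h1.1, h1.2, h2.1, h2.2,
      tensorOp_one]
    exact ⟨rfl, rfl⟩
  have hnorm : ∀ t x, ‖tensorOp (U t) (V t) x‖ = ‖x‖ := fun t x =>
    Unitary.norm_map ⟨_, hun t⟩ x
  refine ⟨hun, ?_, fun s t => ?_, fun v => ?_⟩
  · rw [hU.zero, hV.zero, tensorOp_one]
  · rw [hU.add, hV.add, tensorOp_mul]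
  · have hw : ∀ x ∈ Submodule.span ℂ {x : HilbertTensor H K | ∃ (v : H) (w : K), x = tmul v w},
        Continuous fun t => tensorOp (U t) (V t) x := by
      intro x hx
      induction hx using Submodule.span_induction with
      | mem x hx =>
        obtain ⟨v, w, rfl⟩ := hx
        simp only [tensorOp_tmul]
        exact continuous_tmul.comp ((hU.continuous v).prodMk (hV.continuous w))
      | zero => simp only [map_zero]; exact continuous_const
      | add a b _ _ ha hb => simp only [map_add]; exact ha.add hb
      | smul c a _ ha => simp only [map_smul]; exact ha.const_smul c
    refine continuous_of_uniform_approx_of_continuous fun W hW => ?_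
    obtain ⟨ε, hε, hεW⟩ := Metric.mem_uniformity_dist.mp hW
    obtain ⟨x, hx, hxm⟩ := Metric.dense_iff.mp dense_span_tmul v ε hε
    refine ⟨fun t => tensorOp (U t) (V t) x, hw x hxm, fun t => hεW ?_⟩
    rw [dist_eq_norm, ← map_sub, hnorm, ← dist_eq_norm, dist_comm]
    exact hx

/-- Again the core criterion: the elementary tensors of domain vectors are total and invariant,
since each group preserves the domain of its own generator, and the product rule computes the
derivative on them. -/
theorem tensorSum_stoneGenerator (hU : IsUnitaryGroup U) (hV : IsUnitaryGroup V) :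
    tensorSum (stoneGenerator U) (stoneGenerator V) =
      stoneGenerator fun t => tensorOp (U t) (V t) := by
  refine (hU.tensor hV).toLinearPMap_closure_span_eq ?_ ?_ ?_
  · rintro _ ⟨v, w, rfl⟩
    rw [SetLike.mem_coe, mem_graph_stoneGenerator]
    simp only [tensorOp_tmul]
    have h1 := (stoneGenerator U).mem_graph v
    have h2 := (stoneGenerator V).mem_graph w
    rw [mem_graph_stoneGenerator] at h1 h2
    have h3 := (((tmulL H K).bilinearRestrictScalars ℝ).hasFDerivAt_of_bilinear
      h1.hasFDerivAt h2.hasFDerivAt).hasDerivAt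
    refine h3.congr_deriv ?_
    simp only [add_apply, ContinuousLinearMap.precompR_apply, ContinuousLinearMap.precompL_apply,
      ContinuousLinearMap.compL_apply, ContinuousLinearMap.comp_apply,
      ContinuousLinearMap.toSpanSingleton_apply, one_smul,
      ContinuousLinearMap.bilinearRestrictScalars_apply_apply, hU.zero_apply,
      hV.zero_apply, map_smul, smul_apply, tmulL_apply, smul_add]
    abel
  · rintro _ ⟨v, w, rfl⟩ t
    obtain ⟨v', h1, h2⟩ := (LinearPMap.mem_graph_iff _).mp
      (hU.map_mem_graph ((stoneGenerator U).mem_graph v) t)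
    obtain ⟨w', h3, h4⟩ := (LinearPMap.mem_graph_iff _).mp
      (hV.map_mem_graph ((stoneGenerator V).mem_graph w) t)
    refine ⟨v', w', ?_⟩
    simp only at h1 h2 h3 h4
    simp only [map_add, tensorOp_tmul, h1, h2, h3, h4]
  · rw [← dense_closure]
    refine dense_span_tmul.mono (Submodule.span_le (p := Submodule.topologicalClosure _).mpr ?_)
    rintro _ ⟨v, w, rfl⟩
    have hf : (v, w) ∈ closure (((stoneGenerator U).domain : Set H) ×ˢ
        ((stoneGenerator V).domain : Set K)) := by
      rw [closure_prod_eq]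
      exact ⟨hU.dense_domain v, hV.dense_domain w⟩
    refine closure_mono ?_ (image_closure_subset_closure_image continuous_tmul ⟨_, hf, rfl⟩)
    rintro _ ⟨⟨v, w⟩, ⟨hv, hw⟩, rfl⟩
    exact Submodule.subset_span ⟨_, ⟨⟨v, hv⟩, ⟨w, hw⟩, rfl⟩, rfl⟩

end HilbertTensors

end

end TwistedFieldModel

namespace TwistedFieldModel

noncomputable section

/-! ### Schwartz functions: translations, cutoffs, supports of distributions -/

section Schwartz

variable {E : Type*} [NormedAddCommGroup E] [NormedSpace ℝ E]

/-- Mean value inequality on the unit ball around `y`, where `‖y‖ ≤ 1 + ‖z‖`, so that the weight at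
`y` is controlled by the weight at `z`. The factor `2 ^ k` is the constant of
`SchwartzMap.one_add_le_sup_seminorm_apply`. -/
theorem norm_iteratedFDeriv_translate_sub_le (f : 𝓢(E, ℝ)) (k n : ℕ) {h : E} (hh : ‖h‖ ≤ 1)
    (y : E) : ‖y‖ ^ k * ‖iteratedFDeriv ℝ n f (y - h) - iteratedFDeriv ℝ n f y‖ ≤
      2 ^ k * (Finset.Iic (k, n + 1)).sup (fun m => SchwartzMap.seminorm ℝ m.1 m.2) f * ‖h‖ := by
  have hd : ∀ z, HasFDerivAt (iteratedFDeriv ℝ n f) (fderiv ℝ (iteratedFDeriv ℝ n f) z) z :=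
    fun z => ((f.smooth (n + 1)).differentiable_iteratedFDeriv
      (by exact_mod_cast Nat.lt_succ_self n) z).hasFDerivAt
  have hb : ∀ z ∈ Metric.closedBall y 1, ‖‖y‖ ^ k • fderiv ℝ (iteratedFDeriv ℝ n f) z‖ ≤
      2 ^ k * (Finset.Iic (k, n + 1)).sup (fun m => SchwartzMap.seminorm ℝ m.1 m.2) f := by
    intro z hz
    refine le_trans ?_ (SchwartzMap.one_add_le_sup_seminorm_apply (𝕜 := ℝ) (m := (k, n + 1))
      le_rfl le_rfl f z)
    refine (ContinuousLinearMap.opNorm_smul_le _ _).trans ?_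
    rw [norm_fderiv_iteratedFDeriv, norm_pow, norm_norm]
    gcongr
    have : ‖y - z‖ ≤ 1 := by rw [← dist_eq_norm, dist_comm]; exact hz
    have := norm_sub_norm_le y z
    linarith
  have := (convex_closedBall y 1).norm_image_sub_le_of_norm_hasFDerivWithin_le
    (f := fun z => ‖y‖ ^ k • iteratedFDeriv ℝ n f z)
    (fun z _ => ((hd z).const_smul (‖y‖ ^ k)).hasFDerivWithinAt) hb
    (Metric.mem_closedBall_self zero_le_one)
    (show y - h ∈ Metric.closedBall y 1 by simpa [dist_eq_norm] using hh)
  rw [← smul_sub, norm_smul, norm_pow, norm_norm] at this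
  simpa using this

theorem tendsto_compSubConstCLM_zero (f : 𝓢(E, ℝ)) :
    Filter.Tendsto (fun h => SchwartzMap.compSubConstCLM ℝ h f) (𝓝 0) (𝓝 f) := by
  rw [(schwartz_withSeminorms ℝ E ℝ).tendsto_nhds]
  rintro ⟨k, n⟩ ε hε
  set C := 2 ^ k * (Finset.Iic (k, n + 1)).sup (fun m => SchwartzMap.seminorm ℝ m.1 m.2) f
  have hC : 0 ≤ C := by positivity
  have h1 : ∀ᶠ h : E in 𝓝 0, ‖h‖ < 1 := by
    filter_upwards [Metric.ball_mem_nhds (0 : E) zero_lt_one] with h hh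
    simpa using hh
  have h2 : ∀ᶠ h : E in 𝓝 0, C * ‖h‖ < ε := by
    have : Filter.Tendsto (fun h : E => C * ‖h‖) (𝓝 0) (𝓝 0) := by
      have : Continuous fun h : E => C * ‖h‖ := by fun_prop
      simpa using this.tendsto 0
    exact this.eventually_lt_const hε
  filter_upwards [h1, h2] with h hh1 hh2
  refine lt_of_le_of_lt ?_ hh2
  refine SchwartzMap.seminorm_le_bound ℝ k n _ (by positivity) fun y => ?_
  refine le_trans (le_of_eq ?_) (norm_iteratedFDeriv_translate_sub_le f k n hh1.le y)
  congr 2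
  have e : ((SchwartzMap.compSubConstCLM ℝ h f - f : 𝓢(E, ℝ)) : E → ℝ) =
      (fun y => f (y - h)) - f := by
    ext y; simp
  rw [e, iteratedFDeriv_sub_apply, iteratedFDeriv_comp_sub]
  · exact ((f.smooth n).comp (contDiff_id.sub contDiff_const)).contDiffAt
  · exact (f.smooth n).contDiffAt

theorem continuous_compSubConstCLM (f : 𝓢(E, ℝ)) :
    Continuous fun x => SchwartzMap.compSubConstCLM ℝ x f := by
  rw [continuous_iff_continuousAt]
  intro x
  have h1 := ((SchwartzMap.compSubConstCLM ℝ x).continuous.tendsto f).comp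
    (tendsto_compSubConstCLM_zero f)
  have h2 : Filter.Tendsto (fun y => y - x) (𝓝 x) (𝓝 0) := by
    have : Continuous fun y => y - x := by fun_prop
    simpa using this.tendsto x
  refine (h1.comp h2).congr fun y => ?_
  ext z
  simp [SchwartzMap.compSubConstCLM_apply]

variable [FiniteDimensional ℝ E]

-- The bound is linear in `‖y‖` because `φ - 1` vanishes near the origin. After rescaling, this
-- linear factor supplies the smallness in `exists_cutoff`.
variable (E) in
theorem exists_smooth_cutoff : ∃ φ : E → ℝ, ContDiff ℝ (⊤ : ℕ∞) φ ∧ HasCompactSupport φ ∧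
    ∀ i, ∃ C, 0 ≤ C ∧ ∀ y, ‖iteratedFDeriv ℝ i (fun y => φ y - 1) y‖ ≤ C * ‖y‖ := by
  let φ : ContDiffBump (0 : E) := ⟨1, 2, one_pos, one_lt_two⟩
  refine ⟨φ, φ.contDiff, φ.hasCompactSupport, fun i => ?_⟩
  have hc : Continuous (iteratedFDeriv ℝ i fun y => φ y - 1) :=
    (φ.contDiff.sub contDiff_const (n := i)).continuous_iteratedFDeriv le_rfl
  obtain ⟨M, hM⟩ := (isCompact_closedBall (0 : E) 2).exists_bound_of_continuousOn hc.continuousOn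
  -- Used with `c = 0` inside the unit ball and `c = -1` outside the ball of radius `2`; compactness
  -- covers the annulus between them.
  have hloc : ∀ (y : E) (c : ℝ), (fun y => φ y - 1) =ᶠ[𝓝 y] (fun _ => c) → |c| ≤ 1 →
      ‖iteratedFDeriv ℝ i (fun y => φ y - 1) y‖ ≤ |c| := by
    intro y c h hc
    rw [h.iteratedFDeriv ℝ i |>.eq_of_nhds]
    cases i with
    | zero => simp
    | succ i => rw [iteratedFDeriv_succ_const]; simp
  refine ⟨max M 1, by positivity, fun y => ?_⟩
  by_cases h1 : ‖y‖ < 1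
  · refine (hloc y 0 ?_ (by simp)).trans (by simp)
    filter_upwards [Metric.isOpen_ball.mem_nhds (show y ∈ Metric.ball (0 : E) 1 by simpa using h1)]
      with z hz
    rw [φ.one_of_mem_closedBall (Metric.ball_subset_closedBall hz), sub_self]
  · have h1 : 1 ≤ ‖y‖ := not_lt.mp h1
    refine le_trans ?_ (le_mul_of_one_le_right (by positivity) h1)
    by_cases h2 : ‖y‖ ≤ 2
    · exact (hM y (by simpa using h2)).trans (le_max_left _ _)
    · refine le_trans ?_ (le_max_right _ _)
      refine (hloc y (-1) ?_ (by simp)).trans (by simp)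
      have ho : IsOpen {z : E | 2 < ‖z‖} := isOpen_lt continuous_const continuous_norm
      filter_upwards [ho.mem_nhds (not_le.mp h2)] with z hz
      rw [φ.zero_of_le_dist (by simpa using (le_of_lt hz : (2 : ℝ) ≤ ‖z‖))]
      simp

/-- Schwartz functions are approximated by their cutoffs. -/
theorem exists_cutoff (f : 𝓢(E, ℝ)) : ∃ g : ℕ → 𝓢(E, ℝ),
    (∀ i, HasCompactSupport (g i)) ∧ (∀ i, tsupport (g i) ⊆ tsupport f) ∧
      Filter.Tendsto g Filter.atTop (𝓝 f) := by
  obtain ⟨φ, hφ, hφc, hφd⟩ := exists_smooth_cutoff E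
  choose C hC hCb using hφd
  have hinv : ∀ j : ℕ, ((j : ℝ) + 1)⁻¹ ≠ 0 := fun j => by positivity
  have hs : ∀ j : ℕ, ContDiff ℝ (⊤ : ℕ∞) fun x => φ (((j : ℝ) + 1)⁻¹ • x) * f x := fun j =>
    (hφ.comp (contDiff_const.smul contDiff_id)).mul (f.smooth _)
  have hc : ∀ j : ℕ, HasCompactSupport fun x => φ (((j : ℝ) + 1)⁻¹ • x) * f x := fun j =>
    (hφc.comp_smul (hinv j)).mul_right
  refine ⟨fun j => (hc j).toSchwartzMap (hs j), hc, fun j => tsupport_mul_subset_right, ?_⟩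
  rw [(schwartz_withSeminorms ℝ E ℝ).tendsto_nhds]
  rintro ⟨k, n⟩ ε hε
  -- The error is `(φ(δ x) - 1) f(x)` with `δ = 1/(j+1)`. Each Leibniz term gains a factor `δ ‖x‖`
  -- from the cutoff; `‖x‖` is absorbed by raising the weight from `k` to `k + 1`, which leaves `δ *
  -- B`.
  set B := ∑ i ∈ Finset.range (n + 1), (n.choose i : ℝ) * C i *
    SchwartzMap.seminorm ℝ (k + 1) (n - i) f with hB
  have hB0 : 0 ≤ B := Finset.sum_nonneg fun i _ =>
    mul_nonneg (mul_nonneg (by positivity) (hC i)) (apply_nonneg _ _)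
  have hlim : Filter.Tendsto (fun j : ℕ => ((j : ℝ) + 1)⁻¹ * B) Filter.atTop (𝓝 0) := by
    simpa using (tendsto_one_div_add_atTop_nhds_zero_nat (𝕜 := ℝ)).mul_const B
  filter_upwards [hlim.eventually_lt_const hε] with j hj
  refine lt_of_le_of_lt ?_ hj
  set δ : ℝ := ((j : ℝ) + 1)⁻¹
  have hδ0 : 0 ≤ δ := by positivity
  have hδ1 : δ ≤ 1 := inv_le_one_of_one_le₀ (by simp)
  refine SchwartzMap.seminorm_le_bound ℝ k n _ (by positivity) fun x => ?_
  have e : (((hc j).toSchwartzMap (hs j) - f : 𝓢(E, ℝ)) : E → ℝ) =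
      fun x => (fun y => φ y - 1) (δ • x) * f x := by
    ext x
    change φ (δ • x) * f x - f x = _
    ring
  have hψ : ContDiff ℝ n fun y => φ y - 1 :=
    (hφ.of_le (by exact_mod_cast le_top)).sub contDiff_const
  have hψδ : ContDiff ℝ n fun x => (fun y => φ y - 1) (δ • x) :=
    hψ.comp (contDiff_const.smul contDiff_id)
  rw [e]
  refine (mul_le_mul_of_nonneg_left (norm_iteratedFDeriv_mul_le hψδ (f.smooth n) x le_rfl)
    (by positivity)).trans ?_
  rw [Finset.mul_sum, hB, Finset.mul_sum]
  refine Finset.sum_le_sum fun i hi => ?_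
  have hi' : (i : WithTop ℕ∞) ≤ n := by exact_mod_cast Finset.mem_range_succ_iff.mp hi
  rw [iteratedFDeriv_comp_const_smul δ (hψ.of_le hi')]
  have h1 : ‖δ ^ i • iteratedFDeriv ℝ i (fun y => φ y - 1) (δ • x)‖ ≤ C i * (δ * ‖x‖) := by
    rw [norm_smul, norm_pow, Real.norm_of_nonneg hδ0]
    refine (mul_le_of_le_one_left (norm_nonneg _) (pow_le_one₀ hδ0 hδ1)).trans ?_
    refine (hCb i _).trans (le_of_eq ?_)
    rw [norm_smul, Real.norm_of_nonneg hδ0]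
  have h2 := SchwartzMap.le_seminorm ℝ (k + 1) (n - i) f x
  calc ‖x‖ ^ k * ((n.choose i : ℝ) * ‖δ ^ i • iteratedFDeriv ℝ i (fun y => φ y - 1) (δ • x)‖ *
        ‖iteratedFDeriv ℝ (n - i) f x‖)
      ≤ ‖x‖ ^ k * ((n.choose i : ℝ) * (C i * (δ * ‖x‖)) * ‖iteratedFDeriv ℝ (n - i) f x‖) := by
        gcongr
    _ = δ * ((n.choose i : ℝ) * C i) * (‖x‖ ^ (k + 1) * ‖iteratedFDeriv ℝ (n - i) f x‖) := by
        ring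
    _ ≤ δ * ((n.choose i : ℝ) * C i) * SchwartzMap.seminorm ℝ (k + 1) (n - i) f :=
        mul_le_mul_of_nonneg_left h2 (mul_nonneg hδ0 (mul_nonneg (by positivity) (hC i)))
    _ = _ := by ring

variable {σ : 𝓢(E, ℝ) →L[ℝ] ℝ}

/-- The support of `f` is covered by finitely many open sets on which `σ` vanishes, and a smooth
partition of unity splits `f` into pieces supported in them. -/
theorem apply_eq_zero_of_hasCompactSupport {f : 𝓢(E, ℝ)} (hf : HasCompactSupport f)
    (h : Disjoint (tsupport f) (Distribution.dsupport σ)) : σ f = 0 := by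
  have hx : ∀ x : E, ∃ U : Set E, IsOpen U ∧ (x ∈ tsupport f →
      x ∈ U ∧ Distribution.IsVanishingOn σ U) := by
    intro x
    -- Off the support the empty set serves as a default, so that `U` can be chosen for all points.
    by_cases hx : x ∈ tsupport f
    · obtain ⟨U, h1, h2, h3⟩ := (Distribution.notMem_dsupport_iff x).mp (h.notMem_of_mem_left hx)
      exact ⟨U, h2, fun _ => ⟨h3, h1⟩⟩
    · exact ⟨∅, isOpen_empty, fun h => absurd h hx⟩
  choose U hU hU' using hx
  obtain ⟨t, ht, hcov⟩ := (show IsCompact (tsupport f) from hf).elim_nhds_subcover U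
    fun x hx => (hU x).mem_nhds (hU' x hx).1
  obtain ⟨ρ, hρ⟩ := SmoothPartitionOfUnity.exists_isSubordinate (ι := t) (modelWithCornersSelf ℝ E)
    (isClosed_tsupport f) (fun x => U x) (fun x => hU x) (by
      intro x hx
      simpa using hcov hx)
  have hs : ∀ i : t, ContDiff ℝ (⊤ : ℕ∞) fun x => ρ i x * f x := fun i =>
    (ρ i).contMDiff.contDiff.mul (f.smooth _)
  have hc : ∀ i : t, HasCompactSupport fun x => ρ i x * f x := fun i => hf.mul_left
  have hsum : f = ∑ i : t, (hc i).toSchwartzMap (hs i) := by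
    ext x
    rw [sum_apply]
    change f x = ∑ i : t, ρ i x * f x
    rw [← Finset.sum_mul]
    by_cases hx : f x = 0
    · rw [hx, mul_zero]
    · have := ρ.sum_eq_one (subset_tsupport f hx)
      rw [finsum_eq_sum_of_fintype] at this
      rw [this, one_mul]
  rw [hsum, map_sum]
  refine Finset.sum_eq_zero fun i _ => (hU' i (ht i i.2)).2 _ ?_
  refine subset_trans ?_ (hρ i)
  exact tsupport_mul_subset_left

/-- The cutoffs do not enlarge the support, so continuity of `σ` extends the compactly supported
case to all Schwartz functions. -/
theorem apply_eq_zero_of_disjoint_dsupport {f : 𝓢(E, ℝ)}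
    (h : Disjoint (tsupport f) (Distribution.dsupport σ)) : σ f = 0 := by
  obtain ⟨g, hg, hg', hlim⟩ := exists_cutoff f
  refine tendsto_nhds_unique ((σ.continuous.tendsto f).comp hlim) ?_
  refine tendsto_const_nhds.congr fun i => ?_
  exact (apply_eq_zero_of_hasCompactSupport (hg i) (h.mono_left (hg' i))).symm

end Schwartz

/-! ### Convolution with a tempered distribution -/

section Convolution

theorem continuous_conv (σ : Distr) (f : 𝓢(Space, ℝ)) : Continuous (conv σ f) :=
  σ.continuous.comp (continuous_compSubConstCLM _)

theorem conv_add (σ : Distr) (f g : 𝓢(Space, ℝ)) (x : Space) :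
    conv σ (f + g) x = conv σ f x + conv σ g x := by
  simp [conv, reflectedTranslate]

theorem conv_smul (σ : Distr) (c : ℝ) (f : 𝓢(Space, ℝ)) (x : Space) :
    conv σ (c • f) x = c * conv σ f x := by
  simp [conv, reflectedTranslate]

theorem lineDerivOp_reflectedTranslate (x m : Space) (f : 𝓢(Space, ℝ)) :
    ∂_{m} (reflectedTranslate x f) = -reflectedTranslate x (∂_{m} f) := by
  ext y
  have e : ((reflectedTranslate x f : 𝓢(Space, ℝ)) : Space → ℝ) = fun y => f (x - y) := by
    ext y; rw [reflectedTranslate_apply]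
  have h : HasFDerivAt (fun y => f (x - y)) ((fderiv ℝ f (x - y)).comp
      (-ContinuousLinearMap.id ℝ Space)) y :=
    (f.differentiableAt.hasFDerivAt).comp y ((hasFDerivAt_id y).const_sub x)
  rw [SchwartzMap.lineDerivOp_apply_eq_fderiv, e, h.fderiv, neg_apply,
    reflectedTranslate_apply, SchwartzMap.lineDerivOp_apply_eq_fderiv]
  simp

theorem iterate_lineDerivOp_reflectedTranslate (x m : Space) (n : ℕ) (f : 𝓢(Space, ℝ)) :
    (fun g : 𝓢(Space, ℝ) => (∂_{m} g : 𝓢(Space, ℝ)))^[n] (reflectedTranslate x f) =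
      (-1 : ℝ) ^ n • reflectedTranslate x
        ((fun g : 𝓢(Space, ℝ) => (∂_{m} g : 𝓢(Space, ℝ)))^[n] f) := by
  induction n with
  | zero => simp
  | succ n ih =>
    rw [Function.iterate_succ_apply', ih, Function.iterate_succ_apply',
      LineDeriv.lineDerivOp_smul, lineDerivOp_reflectedTranslate, pow_succ]
    simp

theorem iterate_lineDerivOp_smul (m : Space) (n : ℕ) (c : ℝ) (f : 𝓢(Space, ℝ)) :
    (fun g : 𝓢(Space, ℝ) => (∂_{m} g : 𝓢(Space, ℝ)))^[n] (c • f) =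
      c • (fun g : 𝓢(Space, ℝ) => (∂_{m} g : 𝓢(Space, ℝ)))^[n] f := by
  induction n with
  | zero => rfl
  | succ n ih =>
    rw [Function.iterate_succ_apply', ih, Function.iterate_succ_apply', LineDeriv.lineDerivOp_smul]

theorem multiDeriv_reflectedTranslate (x : Space) (α : Fin 3 →₀ ℕ) (f : 𝓢(Space, ℝ)) :
    multiDeriv α (reflectedTranslate x f) =
      (-1 : ℝ) ^ (α 0 + α 1 + α 2) • reflectedTranslate x (multiDeriv α f) := by
  simp only [multiDeriv, iterate_lineDerivOp_reflectedTranslate, iterate_lineDerivOp_smul,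
    smul_smul, pow_add]
  congr 1
  ring

/-- Every derivative of `y ↦ f (x - y)` produces a factor `-1`; these signs cancel those of the
formal transpose. -/
theorem transposeDiffOp_reflectedTranslate (P : MvPolynomial (Fin 3) ℝ) (x : Space)
    (f : 𝓢(Space, ℝ)) :
    transposeDiffOp P (reflectedTranslate x f) = reflectedTranslate x (diffOp P f) := by
  have hadd : ∀ g h, reflectedTranslate x (g + h) = reflectedTranslate x g + reflectedTranslate x h :=
    fun g h => by simp [reflectedTranslate]
  have hsmul : ∀ (c : ℝ) g, reflectedTranslate x (c • g) = c • reflectedTranslate x g :=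
    fun c g => by simp [reflectedTranslate]
  let R : 𝓢(Space, ℝ) →ₗ[ℝ] 𝓢(Space, ℝ) := ⟨⟨reflectedTranslate x, hadd⟩, hsmul⟩
  change _ = R (diffOp P f)
  rw [diffOp, transposeDiffOp, map_sum]
  refine Finset.sum_congr rfl fun α _ => ?_
  rw [map_smul, multiDeriv_reflectedTranslate, smul_smul, mul_right_comm, ← pow_add,
    Even.neg_one_pow ⟨_, rfl⟩, one_mul]
  rfl

theorem conv_diffOp {P : MvPolynomial (Fin 3) ℝ} {σ : Distr} (h : IsFundamentalSolution P σ)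
    (f : 𝓢(Space, ℝ)) (x : Space) : conv σ (diffOp P f) x = f x := by
  rw [conv, ← transposeDiffOp_reflectedTranslate, h, reflectedTranslate_apply, sub_zero]

theorem conv_eq_zero {σ : Distr} {f : 𝓢(Space, ℝ)} {x : Space}
    (h : ∀ y ∈ Distribution.dsupport σ, x - y ∉ tsupport f) : conv σ f x = 0 := by
  refine apply_eq_zero_of_disjoint_dsupport ?_
  rw [Set.disjoint_left]
  intro y hy hy'
  refine h y hy' ?_
  have e : ((reflectedTranslate x f : 𝓢(Space, ℝ)) : Space → ℝ) = f ∘ Homeomorph.subLeft x := by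
    ext y; rw [reflectedTranslate_apply]; rfl
  rw [e, tsupport_comp_eq_preimage] at hy
  exact hy

end Convolution

end

end TwistedFieldModel

namespace TwistedFieldModel

noncomputable section

/-! ### Criteria for unitary groups; direct sums -/

section UnitaryGroupConstructions

variable {H K : Type*} [NormedAddCommGroup H] [InnerProductSpace ℂ H] [CompleteSpace H]
  [NormedAddCommGroup K] [InnerProductSpace ℂ K] [CompleteSpace K]

/-- Isometry suffices, since the group law provides the right inverse `U(-t)`. -/
theorem IsUnitaryGroup.of_inner {U : ℝ → H →L[ℂ] H} (hin : ∀ t x y, ⟪U t x, U t y⟫_ℂ = ⟪x, y⟫_ℂ)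
    (h0 : U 0 = 1) (hadd : ∀ s t, U (s + t) = U s * U t) (hc : ∀ v, Continuous fun t => U t v) :
    IsUnitaryGroup U := by
  refine ⟨fun t => ?_, h0, hadd, hc⟩
  have h1 : star (U t) * U t = 1 := by
    ext1 x
    refine ext_inner_right ℂ fun y => ?_
    rw [mul_apply_eq_comp, ContinuousLinearMap.star_eq_adjoint,
      ContinuousLinearMap.adjoint_inner_left, hin]
    rfl
  have h2 : U t * U (-t) = 1 := by rw [← hadd, add_neg_cancel, h0]
  refine Unitary.mem_iff.mpr ⟨h1, ?_⟩
  have h3 : star (U t) = U (-t) := by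
    calc star (U t) = star (U t) * (U t * U (-t)) := by rw [h2, mul_one]
      _ = U (-t) := by rw [← mul_assoc, h1, one_mul]
  rw [h3, h2]

/-- The direct sum of two bounded operators. -/
def directSumOp (S : H →L[ℂ] H) (T : K →L[ℂ] K) : WithLp 2 (H × K) →L[ℂ] WithLp 2 (H × K) :=
  (WithLp.prodContinuousLinearEquiv 2 ℂ H K).symm.toContinuousLinearMap ∘L
    (S.prodMap T) ∘L (WithLp.prodContinuousLinearEquiv 2 ℂ H K).toContinuousLinearMap

omit [CompleteSpace H] [CompleteSpace K] in
theorem directSumOp_apply (S : H →L[ℂ] H) (T : K →L[ℂ] K) (z : WithLp 2 (H × K)) :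
    directSumOp S T z = WithLp.toLp 2 (S z.fst, T z.snd) := rfl

theorem IsUnitaryGroup.directSum {U : ℝ → H →L[ℂ] H} {V : ℝ → K →L[ℂ] K} (hU : IsUnitaryGroup U)
    (hV : IsUnitaryGroup V) : IsUnitaryGroup fun t => directSumOp (U t) (V t) := by
  refine .of_inner (fun t x y => ?_) ?_ (fun s t => ?_) fun v => ?_
  · rw [directSumOp_apply, directSumOp_apply, WithLp.prod_inner_apply, WithLp.prod_inner_apply]
    simp only [hU.inner_map_map, hV.inner_map_map]
    rfl
  · ext1 z
    rw [directSumOp_apply, hU.zero, hV.zero]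
    rfl
  · ext1 z
    rw [mul_apply_eq_comp, directSumOp_apply, directSumOp_apply, hU.add, hV.add]
    rfl
  · simp only [directSumOp_apply]
    exact (WithLp.prod_continuous_toLp 2 H K).comp
      ((hU.continuous v.fst).prodMk (hV.continuous v.snd))

omit [CompleteSpace H] [CompleteSpace K] in
theorem mem_graph_directSum {U : ℝ → H →L[ℂ] H} {V : ℝ → K →L[ℂ] K} {v v' : H} {w w' : K}
    (hv : (v, v') ∈ (stoneGenerator U).graph) (hw : (w, w') ∈ (stoneGenerator V).graph) :
    (WithLp.toLp 2 (v, w), WithLp.toLp 2 (v', w')) ∈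
      (stoneGenerator fun t => directSumOp (U t) (V t)).graph := by
  rw [mem_graph_stoneGenerator] at hv hw ⊢
  exact (((WithLp.prodContinuousLinearEquiv 2 ℂ H K).symm.toContinuousLinearMap.restrictScalars
    ℝ).hasFDerivAt).comp_hasDerivAt 0 (hv.prodMk hw)

end UnitaryGroupConstructions

/-! ### Multiplication operators on `L²` and the phase groups they generate -/

section Multiplication

variable {m m' : Space → ℂ} {w : HPlus}

theorem mulL2_of_mem (h : w ∈ mulDomain m) : mulL2 m w = mulOp m ⟨w, h⟩ := dif_pos h

theorem coeFn_mulL2 (h : w ∈ mulDomain m) : mulL2 m w =ᵐ[volume] fun x => m x • w x := by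
  rw [mulL2_of_mem h]
  exact (memLp_of_mem_mulDomain h).coeFn_toLp

theorem mem_mulDomain_of_bounded (hm : Continuous m) {C : ℝ} (hC : ∀ x, ‖m x‖ ≤ C) (w : HPlus) :
    w ∈ mulDomain m := by
  refine ((Lp.memLp w).const_smul (C : ℂ)).of_le
    (hm.aestronglyMeasurable.smul (Lp.aestronglyMeasurable w))
    (Filter.Eventually.of_forall fun x => ?_)
  rw [Pi.smul_apply, norm_smul, norm_smul, Complex.norm_real]
  gcongr
  exact (hC x).trans (le_abs_self C)

theorem mulL2_eq_of_ae (h : w ∈ mulDomain m) {v : HPlus} (hv : v =ᵐ[volume] fun x => m x • w x) :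
    mulL2 m w = v :=
  Lp.ext ((coeFn_mulL2 h).trans hv.symm)

theorem continuous_phase {θ : Space → ℝ} (hθ : Continuous θ) (t : ℝ) :
    Continuous fun x => Complex.exp (Complex.I * ((t * θ x : ℝ) : ℂ)) := by fun_prop

theorem norm_phase (r : ℝ) : ‖Complex.exp (Complex.I * (r : ℂ))‖ = 1 := by
  rw [mul_comm, Complex.norm_exp_ofReal_mul_I]

theorem mem_mulDomain_phase {θ : Space → ℝ} (hθ : Continuous θ) (t : ℝ) (w : HPlus) :
    w ∈ mulDomain fun x => Complex.exp (Complex.I * ((t * θ x : ℝ) : ℂ)) :=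
  mem_mulDomain_of_bounded (continuous_phase hθ t) (fun _ => (norm_phase _).le) w

/-- The unitary operator of multiplication by `e^{i t θ}`. -/
def phaseOp (θ : Space → ℝ) (hθ : Continuous θ) (t : ℝ) : HPlus →L[ℂ] HPlus :=
  LinearMap.mkContinuous
    { toFun := fun w => mulL2 (fun x => Complex.exp (Complex.I * ((t * θ x : ℝ) : ℂ))) w
      map_add' := fun v w => by
        simp only [mulL2_of_mem (mem_mulDomain_phase hθ t _)]
        exact (mulOp _).map_add ⟨v, mem_mulDomain_phase hθ t v⟩ ⟨w, mem_mulDomain_phase hθ t w⟩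
      map_smul' := fun c w => by
        simp only [mulL2_of_mem (mem_mulDomain_phase hθ t _)]
        exact (mulOp _).map_smul c ⟨w, mem_mulDomain_phase hθ t w⟩ }
    1 fun w => by
      rw [one_mul]
      refine Lp.norm_le_norm_of_ae_le ?_
      filter_upwards [coeFn_mulL2 (mem_mulDomain_phase hθ t w)] with x hx
      refine le_of_eq ?_
      change ‖(mulL2 _ w : HPlus) x‖ = _
      rw [hx, norm_smul, norm_phase, one_mul]

variable {θ : Space → ℝ} (hθ : Continuous θ)

theorem phaseOp_apply (t : ℝ) (w : HPlus) :
    phaseOp θ hθ t w = mulL2 (fun x => Complex.exp (Complex.I * ((t * θ x : ℝ) : ℂ))) w := rfl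

theorem coeFn_phaseOp (t : ℝ) (w : HPlus) :
    phaseOp θ hθ t w =ᵐ[volume] fun x => Complex.exp (Complex.I * ((t * θ x : ℝ) : ℂ)) • w x :=
  coeFn_mulL2 (mem_mulDomain_phase hθ t w)

/-- Dominated convergence for products with a fixed vector of `L²`. -/
theorem tendsto_zero_of_dominated {l : Filter ℝ} [l.IsCountablyGenerated] {F : ℝ → HPlus}
    {a : ℝ → Space → ℂ} {w : HPlus} (g : HPlus) (hF : ∀ t, F t =ᵐ[volume] fun x => a t x • w x)
    (hb : ∀ t, ∀ᵐ x, ‖a t x • (w x : Spinor)‖ ≤ ‖g x‖)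
    (ha : ∀ x, Filter.Tendsto (fun t => a t x) l (𝓝 0)) : Filter.Tendsto F l (𝓝 0) := by
  have hn : ∀ t, ‖F t‖ ^ 2 = ∫ x, ‖a t x • (w x : Spinor)‖ ^ 2 := by
    intro t
    have h1 := inner_self_eq_norm_sq_to_K (𝕜 := ℂ) (F t)
    rw [L2.inner_def] at h1
    have h2 : ∀ᵐ x, ⟪F t x, F t x⟫_ℂ = ((‖a t x • (w x : Spinor)‖ ^ 2 : ℝ) : ℂ) := by
      filter_upwards [hF t] with x hx
      rw [inner_self_eq_norm_sq_to_K, hx]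
      norm_cast
    rw [integral_congr_ae h2, integral_complex_ofReal] at h1
    exact (Complex.ofReal_injective (h1.trans (by push_cast; rfl))).symm
  have h : Filter.Tendsto (fun t => ‖F t‖ ^ 2) l (𝓝 (∫ _ : Space, (0 : ℝ))) := by
    simp only [hn]
    refine tendsto_integral_filter_of_dominated_convergence (fun x => ‖g x‖ ^ 2) ?_ ?_ ?_ ?_
    · refine Filter.Eventually.of_forall fun t => ?_
      exact ((Lp.aestronglyMeasurable (F t)).congr (hF t)).norm.pow 2
    · refine Filter.Eventually.of_forall fun t => ?_
      filter_upwards [hb t] with x hx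
      rw [norm_pow, norm_norm]
      gcongr
    · exact (Lp.memLp g).integrable_norm_pow (by norm_num)
    · refine Filter.Eventually.of_forall fun x => ?_
      have := (((ha x).smul_const (w x : Spinor)).norm).pow 2
      simpa using this
  rw [integral_zero] at h
  rw [tendsto_zero_iff_norm_tendsto_zero]
  have := h.sqrt
  simpa [Real.sqrt_sq (norm_nonneg _)] using this

theorem isUnitaryGroup_phaseOp : IsUnitaryGroup (phaseOp θ hθ) := by
  refine .of_inner (fun t v w => ?_) ?_ (fun s t => ?_) fun v => ?_
  · rw [L2.inner_def, L2.inner_def]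
    refine integral_congr_ae ?_
    filter_upwards [coeFn_phaseOp hθ t v, coeFn_phaseOp hθ t w] with x h1 h2
    rw [h1, h2, inner_smul_left, inner_smul_right, ← mul_assoc, mul_comm (conj _), Complex.mul_conj,
      Complex.normSq_eq_norm_sq, norm_phase]
    simp
  · ext1 w
    refine Lp.ext ?_
    filter_upwards [coeFn_phaseOp hθ 0 w] with x hx
    rw [hx]
    simp
  · ext1 w
    refine Lp.ext ?_
    rw [mul_apply_eq_comp]
    filter_upwards [coeFn_phaseOp hθ (s + t) w, coeFn_phaseOp hθ t w,
      coeFn_phaseOp hθ s (phaseOp θ hθ t w)] with x h1 h2 h3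
    rw [h1, h3, h2, smul_smul, ← Complex.exp_add]
    congr 2
    push_cast
    ring
  · rw [continuous_iff_continuousAt]
    intro t₀
    rw [ContinuousAt, ← tendsto_sub_nhds_zero_iff]
    refine tendsto_zero_of_dominated (a := fun t x =>
      Complex.exp (Complex.I * ((t * θ x : ℝ) : ℂ)) - Complex.exp (Complex.I * ((t₀ * θ x : ℝ) : ℂ)))
      (w := v) ((2 : ℂ) • v) (fun t => ?_) (fun t => ?_) fun x => ?_
    · filter_upwards [Lp.coeFn_sub (phaseOp θ hθ t v) (phaseOp θ hθ t₀ v), coeFn_phaseOp hθ t v,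
        coeFn_phaseOp hθ t₀ v] with x h1 h2 h3
      rw [h1, Pi.sub_apply, h2, h3, sub_smul]
    · filter_upwards [Lp.coeFn_smul (2 : ℂ) v] with x hx
      rw [hx, Pi.smul_apply, norm_smul, norm_smul]
      gcongr
      refine (norm_sub_le _ _).trans ?_
      rw [norm_phase, norm_phase]
      norm_num
    · rw [tendsto_sub_nhds_zero_iff]
      exact Continuous.tendsto (by fun_prop) t₀

theorem mem_graph_mulOp {v w : HPlus} :
    (w, v) ∈ (mulOp m).graph ↔ v =ᵐ[volume] fun x => m x • w x := by
  rw [LinearPMap.mem_graph_iff]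
  constructor
  · rintro ⟨⟨y, hy⟩, rfl, rfl⟩
    exact (memLp_of_mem_mulDomain hy).coeFn_toLp
  · intro h
    have hw : w ∈ mulDomain m := (Lp.memLp v).ae_eq h
    exact ⟨⟨w, hw⟩, rfl, Lp.ext ((memLp_of_mem_mulDomain hw).coeFn_toLp.trans h.symm)⟩

/-- Since `|e^{itθ} - 1| ≤ |tθ|`, the difference quotient minus its limit is dominated by `2 |θ w|`,
which is in `L²`. Only this inclusion is needed: the core criterion does not ask for the full
generator. -/
theorem mem_graph_phaseOp {v w : HPlus} (hvw : v =ᵐ[volume] fun x => (θ x : ℂ) • w x) :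
    (w, v) ∈ (stoneGenerator (phaseOp θ hθ)).graph := by
  rw [mem_graph_stoneGenerator]
  refine hasDerivAt_iff_tendsto_slope.mpr (tendsto_sub_nhds_zero_iff.mp ?_)
  refine tendsto_zero_of_dominated (a := fun t x =>
    (t : ℂ)⁻¹ * (Complex.exp (Complex.I * ((t * θ x : ℝ) : ℂ)) - 1) - Complex.I * θ x)
      (w := w) ((2 : ℂ) • v) (fun t => ?_) (fun t => ?_) fun x => ?_
  · have h0 : phaseOp θ hθ 0 w = w := (isUnitaryGroup_phaseOp hθ).zero_apply w
    rw [slope_def_module, h0]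
    change ((((t - 0)⁻¹ : ℝ) : ℂ) • (phaseOp θ hθ t w - w) - Complex.I • v : HPlus) =ᵐ[volume] _
    rw [sub_zero, Complex.ofReal_inv]
    filter_upwards [Lp.coeFn_sub ((t : ℂ)⁻¹ • (phaseOp θ hθ t w - w)) (Complex.I • v),
      Lp.coeFn_smul (t : ℂ)⁻¹ (phaseOp θ hθ t w - w), Lp.coeFn_sub (phaseOp θ hθ t w) w,
      coeFn_phaseOp hθ t w, Lp.coeFn_smul Complex.I v, hvw] with x h1 h2 h3 h4 h5 h6
    rw [h1, Pi.sub_apply, h2, Pi.smul_apply, h3, Pi.sub_apply, h4, h5, Pi.smul_apply, h6,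
      sub_smul, mul_smul, mul_smul, sub_smul, one_smul]
  · filter_upwards [Lp.coeFn_smul (2 : ℂ) v, hvw] with x hx h2
    rw [hx, Pi.smul_apply, norm_smul, norm_smul, h2, norm_smul, ← mul_assoc]
    gcongr
    refine (norm_sub_le _ _).trans ?_
    rw [norm_mul, norm_mul, Complex.norm_I, one_mul, norm_inv, Complex.norm_real,
      Complex.norm_real]
    have h3 := Real.norm_exp_I_mul_ofReal_sub_one_le (x := t * θ x)
    rw [norm_mul] at h3
    have h4 : ‖t‖⁻¹ * ‖Complex.exp (Complex.I * ((t * θ x : ℝ) : ℂ)) - 1‖ ≤ ‖θ x‖ := by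
      -- At `t = 0` the inverse is `0` by convention and the bound is trivial.
      rcases eq_or_ne t 0 with rfl | ht
      · simp
      · rw [inv_mul_le_iff₀ (norm_pos_iff.mpr ht)]
        exact h3
    have h5 : ‖(2 : ℂ)‖ = 2 := by norm_num
    rw [h5]
    linarith
  · rw [tendsto_sub_nhds_zero_iff]
    have h1 : HasDerivAt (fun t : ℝ => Complex.exp (Complex.I * ((t * θ x : ℝ) : ℂ)))
        (Complex.I * θ x) 0 := by
      have h2 : HasDerivAt (fun t : ℝ => Complex.I * ((t * θ x : ℝ) : ℂ)) (Complex.I * θ x) 0 := by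
        have h4 : HasDerivAt (fun t : ℝ => t * θ x) (θ x) 0 := by
          simpa using (hasDerivAt_id (0 : ℝ)).mul_const (θ x)
        exact h4.ofReal_comp.const_mul _
      simpa using h2.cexp
    have h2 := hasDerivAt_iff_tendsto_slope.mp h1
    refine h2.congr fun t => ?_
    rw [slope_def_module]
    simp

/-- The domain contains the continuous functions of compact support, as a continuous `θ` keeps such
a function in `L²` even when `θ` is unbounded. -/
theorem dense_mulDomain (hθ : Continuous θ) : Dense ((mulDomain fun x => (θ x : ℂ)) : Set HPlus) := by
  intro w
  rw [Metric.mem_closure_iff]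
  intro ε hε
  obtain ⟨g, hgc, hg, hgcont, hgm⟩ := (Lp.memLp w).exists_hasCompactSupport_eLpNorm_sub_le
    (by norm_num) (ε := ENNReal.ofReal (ε / 2)) (by simpa using hε)
  have hmem : hgm.toLp ∈ mulDomain fun x => (θ x : ℂ) := by
    have hcont : Continuous fun x => (θ x : ℂ) • g x :=
      (Complex.continuous_ofReal.comp hθ).smul hgcont
    have hcs : HasCompactSupport fun x => (θ x : ℂ) • g x := hgc.smul_left (f := fun x => (θ x : ℂ))
    have h1 : MemLp (fun x => (θ x : ℂ) • g x) 2 volume := hcont.memLp_of_hasCompactSupport hcs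
    refine h1.ae_eq ?_
    filter_upwards [hgm.coeFn_toLp] with x hx
    rw [hx]
  refine ⟨hgm.toLp, hmem, ?_⟩
  rw [dist_eq_norm, Lp.norm_def]
  have h2 : eLpNorm ((w - hgm.toLp : HPlus) : Space → Spinor) 2 volume =
      eLpNorm ((w : Space → Spinor) - g) 2 volume := by
    refine eLpNorm_congr_ae ?_
    filter_upwards [Lp.coeFn_sub w hgm.toLp, hgm.coeFn_toLp] with x h1 h2
    rw [h1, Pi.sub_apply, h2, Pi.sub_apply]
  rw [h2]
  refine lt_of_le_of_lt (ENNReal.toReal_mono ENNReal.ofReal_ne_top hg) ?_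
  rw [ENNReal.toReal_ofReal (by positivity)]
  linarith

theorem phaseOp_mul (t : ℝ) {v w : HPlus} (hvw : v =ᵐ[volume] fun x => (θ x : ℂ) • w x) :
    phaseOp θ hθ t v =ᵐ[volume] fun x => (θ x : ℂ) • (phaseOp θ hθ t w : HPlus) x := by
  filter_upwards [coeFn_phaseOp hθ t w, hvw, coeFn_phaseOp hθ t v] with x h1 h2 h3
  rw [h1, h3, h2, smul_comm]

end Multiplication

end

end TwistedFieldModel

namespace TwistedFieldModel

noncomputable section

/-! ### The conjugation of spinors -/

section Conjugation

theorem conjSpinor_add (v w : Spinor) : conjSpinor (v + w) = conjSpinor v + conjSpinor w := by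
  ext i; simp [conjSpinor]

theorem conjSpinor_smul (c : ℂ) (v : Spinor) : conjSpinor (c • v) = conj c • conjSpinor v := by
  ext i; simp [conjSpinor]

theorem inner_conjSpinor (v w : Spinor) : ⟪conjSpinor v, conjSpinor w⟫_ℂ = ⟪w, v⟫_ℂ := by
  simp [conjSpinor, PiLp.inner_apply, mul_comm]

theorem coeFn_bar (w : HPlus) : bar w =ᵐ[volume] fun x => conjSpinor (w x) := MemLp.coeFn_toLp _

theorem bar_add (v w : HPlus) : bar (v + w) = bar v + bar w := by
  refine Lp.ext ?_
  filter_upwards [coeFn_bar (v + w), coeFn_bar v, coeFn_bar w, Lp.coeFn_add v w,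
    Lp.coeFn_add (bar v) (bar w)] with x h1 h2 h3 h4 h5
  rw [h1, h4, h5, Pi.add_apply, Pi.add_apply, h2, h3, conjSpinor_add]

theorem bar_smul (c : ℂ) (w : HPlus) : bar (c • w) = conj c • bar w := by
  refine Lp.ext ?_
  filter_upwards [coeFn_bar (c • w), coeFn_bar w, Lp.coeFn_smul c w,
    Lp.coeFn_smul (conj c) (bar w)] with x h1 h2 h3 h4
  rw [h1, h3, h4, Pi.smul_apply, Pi.smul_apply, h2, conjSpinor_smul]

theorem bar_zero : bar 0 = 0 := by
  have := bar_smul 0 0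
  simpa using this

theorem inner_bar (v w : HPlus) : ⟪bar v, bar w⟫_ℂ = ⟪w, v⟫_ℂ := by
  rw [L2.inner_def, L2.inner_def]
  refine integral_congr_ae ?_
  filter_upwards [coeFn_bar v, coeFn_bar w] with x h1 h2
  rw [h1, h2, inner_conjSpinor]

theorem norm_bar (w : HPlus) : ‖bar w‖ = ‖w‖ := by
  rw [@norm_eq_sqrt_re_inner ℂ, inner_bar, ← @norm_eq_sqrt_re_inner ℂ]

/-- This sign matches the opposite phases of the twist on `h_+` and `h_-`: the vectors `w ⊕ 0` and
`0 ⊕ w̄` both follow the same rotation of `w`. -/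
theorem bar_phaseOp {θ : Space → ℝ} (hθ : Continuous θ) (t : ℝ) (w : HPlus) :
    bar (phaseOp θ hθ t w) = phaseOp θ hθ (-t) (bar w) := by
  refine Lp.ext ?_
  filter_upwards [coeFn_bar (phaseOp θ hθ t w), coeFn_phaseOp hθ t w,
    coeFn_phaseOp hθ (-t) (bar w), coeFn_bar w] with x h1 h2 h3 h4
  rw [h1, h2, h3, h4, conjSpinor_smul, ← Complex.exp_conj]
  congr 2
  simp

end Conjugation

/-! ### Sums of a creation and an annihilation operator -/

section SegalField

variable {V : Type*} [NormedAddCommGroup V] [InnerProductSpace ℂ V]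

/-- The sum of a creation operator and an annihilation operator. -/
def segal (x y : V) : Fock V →L[ℂ] Fock V := creation x + annihilation y

theorem segal_anticommute (x y x' y' : V) :
    segal x y * segal x' y' + segal x' y' * segal x y = (⟪y, x'⟫_ℂ + ⟪y', x⟫_ℂ) • 1 := by
  have e : segal x y * segal x' y' + segal x' y' * segal x y =
      (creation x * creation x' + creation x' * creation x) +
      (annihilation y * annihilation y' + annihilation y' * annihilation y) +
      ((annihilation y * creation x' + creation x' * annihilation y) +
        (annihilation y' * creation x + creation x * annihilation y')) := by
    simp only [segal, mul_add, add_mul]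
    abel
  rw [e, creation_mul_creation, annihilation_mul_annihilation, annihilation_mul_creation,
    annihilation_mul_creation, ← add_smul, add_zero, zero_add]

theorem star_segal (x y : V) : star (segal x y) = segal y x := by
  rw [segal, segal, star_add, annihilation_eq_star, annihilation_eq_star, star_star, add_comm]

theorem secondQuant_mul_segal {S T : V → V} (hS : ∀ x y, ⟪S x, S y⟫_ℂ = ⟪x, y⟫_ℂ)
    (hT : ∀ x y, ⟪T x, T y⟫_ℂ = ⟪x, y⟫_ℂ) (hTS : T ∘ S = id) (x y : V) :
    secondQuant S * segal x y = segal (S x) (S y) * secondQuant S := by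
  rw [segal, segal, mul_add, add_mul, secondQuant_mul_creation hS,
    secondQuant_mul_annihilation hS hT hTS]

theorem norm_segal_le (x y : V) : ‖segal x y‖ ≤ ‖x‖ + ‖y‖ := by
  have hc : ∀ z : V, ‖creation z‖ ≤ ‖z‖ := fun z =>
    ContinuousLinearMap.opNorm_le_bound _ (norm_nonneg _) (norm_creation_apply_le z)
  refine (norm_add_le _ _).trans (add_le_add (hc x) ?_)
  exact (ContinuousLinearMap.adjoint.norm_map (creation y)).trans_le (hc y)

theorem segal_add (x y x' y' : V) : segal (x + x') (y + y') = segal x y + segal x' y' := by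
  simp only [segal, annihilation_eq_star, ← creationL_apply, map_add, star_add]
  abel

theorem segal_smul (c : ℂ) (x y : V) : segal (c • x) (conj c • y) = c • segal x y := by
  simp only [segal, annihilation_eq_star, ← creationL_apply, map_smul, star_smul, smul_add]
  simp

variable {W : Type*} [NormedAddCommGroup W] [NormedSpace ℂ W]

/-- The bounded linear map `w ↦ a • segal (X w) (Y w)`, for `X` linear and `Y` antilinear. -/
def segalL (a : ℂ) (X : W →ₗᵢ[ℂ] V) (Y : W →ₛₗᵢ[starRingEnd ℂ] V) :
    W →L[ℂ] Fock V →L[ℂ] Fock V :=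
  LinearMap.mkContinuous
    { toFun := fun w => a • segal (X w) (Y w)
      map_add' := fun v w => by rw [map_add, map_add, segal_add, smul_add]
      map_smul' := fun c w => by
        rw [map_smul, LinearIsometry.map_smulₛₗ, segal_smul, smul_comm, RingHom.id_apply] }
    (‖a‖ * 2) fun w => by
      change ‖a • segal (X w) (Y w)‖ ≤ _
      rw [norm_smul, mul_assoc, two_mul]
      gcongr
      exact (norm_segal_le _ _).trans_eq (by rw [X.norm_map, Y.norm_map])

theorem segalL_apply (a : ℂ) (X : W →ₗᵢ[ℂ] V) (Y : W →ₛₗᵢ[starRingEnd ℂ] V) (w : W) :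
    segalL a X Y w = a • segal (X w) (Y w) := rfl

theorem segalL_anticommute (a : ℂ) {X : W →ₗᵢ[ℂ] V} {Y : W →ₛₗᵢ[starRingEnd ℂ] V}
    (h : ∀ v w, ⟪Y v, X w⟫_ℂ = 0) (v w : W) :
    segalL a X Y v * segalL a X Y w + segalL a X Y w * segalL a X Y v = 0 := by
  rw [segalL_apply, segalL_apply, smul_mul_smul_comm, smul_mul_smul_comm, ← smul_add,
    segal_anticommute, h, h, add_zero, zero_smul, smul_zero]

/-- The creation and annihilation parts contribute equal inner products, each with weight `|a|² =
1/2`. -/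
theorem segalL_anticommute_star {a : ℂ} (ha : a * conj a = 2⁻¹) {X : W →ₗᵢ[ℂ] V}
    {Y : W →ₛₗᵢ[starRingEnd ℂ] V} (h : ∀ v w, ⟪Y v, Y w⟫_ℂ = ⟪X w, X v⟫_ℂ) (v w : W) :
    segalL a X Y v * star (segalL a X Y w) + star (segalL a X Y w) * segalL a X Y v =
      ⟪X w, X v⟫_ℂ • 1 := by
  rw [segalL_apply, segalL_apply, star_smul, star_segal, smul_mul_smul_comm, smul_mul_smul_comm,
    Complex.star_def, mul_comm (conj a), ha, ← smul_add, segal_anticommute, h, smul_smul]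
  congr 1
  ring

theorem secondQuant_mul_segalL (a : ℂ) {X : W →ₗᵢ[ℂ] V} {Y : W →ₛₗᵢ[starRingEnd ℂ] V}
    {S T : V → V} (hS : ∀ x y, ⟪S x, S y⟫_ℂ = ⟪x, y⟫_ℂ) (hT : ∀ x y, ⟪T x, T y⟫_ℂ = ⟪x, y⟫_ℂ)
    (hTS : T ∘ S = id) {v w : W} (hX : S (X v) = X w) (hY : S (Y v) = Y w) :
    secondQuant S * segalL a X Y v = segalL a X Y w * secondQuant S := by
  rw [segalL_apply, segalL_apply, mul_smul_comm, smul_mul_assoc, secondQuant_mul_segal hS hT hTS,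
    hX, hY]

end SegalField

section TensorOne

variable {H K : Type*} [NormedAddCommGroup H] [InnerProductSpace ℂ H]
  [NormedAddCommGroup K] [InnerProductSpace ℂ K]

theorem tensorOp_anticommute {S T R : H →L[ℂ] H} (h : S * T + T * S = R) :
    tensorOp S (1 : K →L[ℂ] K) * tensorOp T 1 + tensorOp T 1 * tensorOp S 1 = tensorOp R 1 := by
  rw [tensorOp_mul, tensorOp_mul, mul_one, ← tensorOneL_apply, ← tensorOneL_apply, ← map_add, h,
    tensorOneL_apply]

theorem tensorOp_anticommute_star [CompleteSpace H] [CompleteSpace K] {S T R : H →L[ℂ] H} (h : S * star T + star T * S = R) :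
    tensorOp S (1 : K →L[ℂ] K) * star (tensorOp T 1) + star (tensorOp T 1) * tensorOp S 1 =
      tensorOp R 1 := by
  rw [star_tensorOp, star_one]
  exact tensorOp_anticommute h

theorem tensorOp_commutation {S T T' : H →L[ℂ] H} (h : S * T = T' * S) (R : K →L[ℂ] K) :
    tensorOp S R * tensorOp T 1 = tensorOp T' 1 * tensorOp S R := by
  rw [tensorOp_mul, tensorOp_mul, h, mul_one, one_mul]

theorem tensorOp_zero_left : tensorOp (0 : H →L[ℂ] H) (1 : K →L[ℂ] K) = 0 := by
  rw [← tensorOneL_apply, map_zero]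

theorem tensorOp_smul_one (c : ℂ) : tensorOp (c • 1 : H →L[ℂ] H) (1 : K →L[ℂ] K) = c • 1 := by
  rw [← tensorOneL_apply, map_smul, tensorOneL_apply, tensorOp_one]

end TensorOne

/-! ### The Dirac field and its anticommutation relations -/

section DiracField

/-- The embedding of `h_+` into `h`. -/
def inPlus : HPlus →ₗᵢ[ℂ] OneParticle where
  toFun w := WithLp.toLp 2 (w, 0)
  map_add' v w := by rw [← WithLp.toLp_add]; simp
  map_smul' c w := by rw [RingHom.id_apply, ← WithLp.toLp_smul]; simp
  norm_map' w := by
    change ‖(WithLp.toLp 2 (w, 0) : OneParticle)‖ = _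
    simp

/-- The antilinear embedding `w ↦ 0 ⊕ w̄`. -/
def inMinus : HPlus →ₛₗᵢ[starRingEnd ℂ] OneParticle where
  toFun w := WithLp.toLp 2 (0, bar w)
  map_add' v w := by rw [← WithLp.toLp_add, bar_add]; simp
  map_smul' c w := by rw [← WithLp.toLp_smul, bar_smul]; simp
  norm_map' w := by
    change ‖(WithLp.toLp 2 (0, bar w) : OneParticle)‖ = _
    simp [norm_bar]

theorem inner_inPlus_inMinus (v w : HPlus) : ⟪inPlus v, inMinus w⟫_ℂ = 0 := by
  refine (WithLp.prod_inner_apply _ _).trans ?_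
  change ⟪v, 0⟫_ℂ + ⟪(0 : HPlus), bar w⟫_ℂ = 0
  rw [inner_zero_left, inner_zero_right, add_zero]

theorem inner_inMinus_inPlus (v w : HPlus) : ⟪inMinus v, inPlus w⟫_ℂ = 0 := by
  rw [← inner_conj_symm, inner_inPlus_inMinus, map_zero]

theorem inner_inMinus (v w : HPlus) : ⟪inMinus v, inMinus w⟫_ℂ = ⟪w, v⟫_ℂ := by
  refine (WithLp.prod_inner_apply _ _).trans ?_
  change ⟪(0 : HPlus), 0⟫_ℂ + ⟪bar v, bar w⟫_ℂ = _
  rw [inner_zero_left, zero_add, inner_bar]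

/-- The Dirac field as a bounded linear map. -/
def fockDiracL : HPlus →L[ℂ] Fock OneParticle →L[ℂ] Fock OneParticle :=
  segalL (Real.sqrt 2 : ℂ)⁻¹ inPlus inMinus

theorem fockDiracL_apply (w : HPlus) : fockDiracL w = fockDirac w := by
  have h : (WithLp.toLp 2 (bar 0, bar w) : OneParticle) = inMinus w := by
    rw [bar_zero]
    rfl
  change (Real.sqrt 2 : ℂ)⁻¹ • (creation (inPlus w) + annihilation (inMinus w)) = _
  rw [← h]
  rfl

theorem sqrt_two_inv_mul_conj : ((Real.sqrt 2 : ℂ)⁻¹) * conj ((Real.sqrt 2 : ℂ)⁻¹) = 2⁻¹ := by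
  rw [map_inv₀, Complex.conj_ofReal, ← mul_inv, ← Complex.ofReal_mul,
    Real.mul_self_sqrt (by norm_num)]
  norm_num

theorem fockDirac_anticommute (w w' : HPlus) :
    fockDirac w * fockDirac w' + fockDirac w' * fockDirac w = 0 := by
  simp only [← fockDiracL_apply]
  exact segalL_anticommute _ inner_inMinus_inPlus w w'

theorem fockDirac_anticommute_star (w w' : HPlus) :
    fockDirac w * star (fockDirac w') + star (fockDirac w') * fockDirac w = ⟪w', w⟫_ℂ • 1 := by
  rw [← inPlus.inner_map_map]
  simp only [← fockDiracL_apply]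
  exact segalL_anticommute_star sqrt_two_inv_mul_conj
    (fun v w => (inner_inMinus v w).trans (inPlus.inner_map_map w v).symm) w w'

variable (K : Type*) [NormedAddCommGroup K] [InnerProductSpace ℂ K] [CompleteSpace K]

/-- The Dirac field on the tensor product as a bounded linear map. -/
def diracL : HPlus →L[ℂ] TotalSpace K →L[ℂ] TotalSpace K :=
  tensorOneL (Fock OneParticle) K ∘L fockDiracL

omit [CompleteSpace K] in
theorem diracL_apply (w : HPlus) : diracL K w = dirac K w :=
  congrArg (fun T => tensorOp T (1 : K →L[ℂ] K)) (fockDiracL_apply w)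

omit [CompleteSpace K] in
theorem dirac_anticommute (w w' : HPlus) :
    dirac K w * dirac K w' + dirac K w' * dirac K w = 0 :=
  (tensorOp_anticommute (fockDirac_anticommute w w')).trans tensorOp_zero_left

theorem dirac_anticommute_star (w w' : HPlus) :
    dirac K w * star (dirac K w') + star (dirac K w') * dirac K w = ⟪w', w⟫_ℂ • 1 :=
  (tensorOp_anticommute_star (fockDirac_anticommute_star w w')).trans (tensorOp_smul_one _)

end DiracField

/-! ### The twist group and its action on the Dirac field -/

section Twist

variable (σ : Distr) (f : 𝓢(Space, ℝ))

/-- The one-parameter group of twists `u_{σ,tf}`. -/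
def twistGroup (t : ℝ) : OneParticle →L[ℂ] OneParticle :=
  directSumOp (phaseOp (conv σ f) (continuous_conv σ f) (-t))
    (phaseOp (conv σ f) (continuous_conv σ f) t)

theorem isUnitaryGroup_twistGroup : IsUnitaryGroup (twistGroup σ f) :=
  (isUnitaryGroup_phaseOp _).comp_neg.directSum (isUnitaryGroup_phaseOp _)

theorem twist_smul (t : ℝ) : twist σ (t • f) = twistGroup σ f t := by
  ext1 z
  rw [twist, twistGroup, directSumOp_apply, phaseOp_apply, phaseOp_apply]
  simp only [conv_smul]
  congr 5
  ext x
  congr 1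
  push_cast
  ring

theorem twist_eq_twistGroup_one : twist σ f = twistGroup σ f 1 := by
  rw [← twist_smul, one_smul]

theorem inner_twist (x y : OneParticle) : ⟪twist σ f x, twist σ f y⟫_ℂ = ⟪x, y⟫_ℂ := by
  rw [twist_eq_twistGroup_one, (isUnitaryGroup_twistGroup σ f).inner_map_map]

theorem phaseOp_comp_phaseOp {θ θ' : Space → ℝ} (hθ : Continuous θ) (hθ' : Continuous θ') (t : ℝ) :
    phaseOp θ hθ t * phaseOp θ' hθ' t = phaseOp (θ + θ') (hθ.add hθ') t := by
  ext1 w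
  refine Lp.ext ?_
  rw [mul_apply_eq_comp]
  filter_upwards [coeFn_phaseOp (hθ.add hθ') t w, coeFn_phaseOp hθ' t w,
    coeFn_phaseOp hθ t (phaseOp θ' hθ' t w)] with x h1 h2 h3
  rw [h1, h3, h2, smul_smul, ← Complex.exp_add]
  congr 2
  simp only [Pi.add_apply]
  push_cast
  ring

theorem twist_comp_twist (g : 𝓢(Space, ℝ)) : twist σ f ∘ twist σ g = twist σ (f + g) := by
  have hc : conv σ (f + g) = conv σ f + conv σ g := funext (conv_add σ f g)
  have h : ∀ t, phaseOp (conv σ (f + g)) (continuous_conv σ (f + g)) t =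
      phaseOp (conv σ f) (continuous_conv σ f) t * phaseOp (conv σ g) (continuous_conv σ g) t := by
    intro t
    rw [phaseOp_comp_phaseOp]
    congr 1
  ext1 z
  simp only [Function.comp_apply, twist_eq_twistGroup_one, twistGroup, directSumOp_apply, h]
  rfl

variable {σ f}

theorem mem_graph_twistGenerator {z z' : OneParticle} :
    (z, z') ∈ (twistGenerator σ f).graph ↔
      (-z'.fst =ᵐ[volume] fun x => (conv σ f x : ℂ) • z.fst x) ∧
        z'.snd =ᵐ[volume] fun x => (conv σ f x : ℂ) • z.snd x := by
  rw [← mem_graph_mulOp, ← mem_graph_mulOp, LinearPMap.mem_graph_iff]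
  constructor
  · rintro ⟨⟨y, hy⟩, rfl, rfl⟩
    refine ⟨?_, ?_⟩
    · convert LinearPMap.mem_graph (mulOp fun x => (conv σ f x : ℂ)) ⟨y.fst, hy.1⟩ using 2
      exact neg_neg _
    · exact LinearPMap.mem_graph (mulOp fun x => (conv σ f x : ℂ)) ⟨y.snd, hy.2⟩
  · rintro ⟨h1, h2⟩
    obtain ⟨⟨y1, hy1⟩, h3, h4⟩ := (LinearPMap.mem_graph_iff _).mp h1
    obtain ⟨⟨y2, hy2⟩, h5, h6⟩ := (LinearPMap.mem_graph_iff _).mp h2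
    simp only at h3 h4 h5 h6
    subst h3 h5
    refine ⟨⟨z, hy1, hy2⟩, rfl, ?_⟩
    have e : z' = WithLp.toLp 2 (-(-z'.fst), z'.snd) := by rw [neg_neg]; rfl
    rw [e, ← h4, ← h6]
    rfl

variable (σ f)

/-- The three hypotheses of `diffSecondQuant_eq_stoneGenerator` hold because multiplication by `σ⋆f`
is contained in the generator of its phases, has dense domain, and commutes with them. -/
theorem diffSecondQuant_twistGenerator : diffSecondQuant (twistGenerator σ f) =
    stoneGenerator fun t => secondQuant (twistGroup σ f t) := by
  refine diffSecondQuant_eq_stoneGenerator (isUnitaryGroup_twistGroup σ f) ?_ ?_ ?_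
  · rw [← LinearPMap.le_graph_iff]
    rintro ⟨z, z'⟩ h
    obtain ⟨h1, h2⟩ := mem_graph_twistGenerator.mp h
    refine mem_graph_directSum (v := z.fst) (v' := z'.fst) (w := z.snd) (w' := z'.snd) ?_ ?_
    -- The component in `h_+` moves with the reversed phase group, whose generator is the negative
    -- one.
    · rw [← (isUnitaryGroup_phaseOp (continuous_conv σ f)).neg_stoneGenerator, LinearPMap.neg_graph]
      exact ⟨(z.fst, -z'.fst), mem_graph_phaseOp (continuous_conv σ f) h1, by simp⟩
    · exact mem_graph_phaseOp _ h2
  · have hd := dense_mulDomain (continuous_conv σ f)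
    have h := (WithLp.prodContinuousLinearEquiv 2 ℂ HPlus HPlus).symm.surjective.denseRange.dense_image
      (WithLp.prodContinuousLinearEquiv 2 ℂ HPlus HPlus).symm.continuous (hd.prod hd)
    refine h.mono ?_
    rintro _ ⟨⟨a, b⟩, ⟨ha, hb⟩, rfl⟩
    exact ⟨ha, hb⟩
  · rintro t ⟨z, z'⟩ h
    obtain ⟨h1, h2⟩ := mem_graph_twistGenerator.mp h
    refine mem_graph_twistGenerator.mpr ⟨?_, phaseOp_mul (continuous_conv σ f) t h2⟩
    have h3 := phaseOp_mul (continuous_conv σ f) (-t) h1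
    rw [map_neg] at h3
    exact h3

theorem secondQuant_mul_fockDirac (t : ℝ) (w : HPlus) :
    secondQuant (twistGroup σ f t) * fockDirac w =
      fockDirac (phaseOp (conv σ f) (continuous_conv σ f) (-t) w) *
        secondQuant (twistGroup σ f t) := by
  have hU := isUnitaryGroup_twistGroup σ f
  have h1 : twistGroup σ f t (inPlus w) =
      inPlus (phaseOp (conv σ f) (continuous_conv σ f) (-t) w) := by
    rw [twistGroup, directSumOp_apply]
    change WithLp.toLp 2 (phaseOp (conv σ f) _ (-t) w, phaseOp (conv σ f) _ t 0) = WithLp.toLp 2 _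
    rw [map_zero]
  have h2 : twistGroup σ f t (inMinus w) =
      inMinus (phaseOp (conv σ f) (continuous_conv σ f) (-t) w) := by
    rw [twistGroup, directSumOp_apply]
    change WithLp.toLp 2 (phaseOp (conv σ f) _ (-t) 0, phaseOp (conv σ f) _ t (bar w)) =
      WithLp.toLp 2 _
    rw [map_zero, bar_phaseOp, neg_neg]
  simp only [← fockDiracL_apply]
  exact secondQuant_mul_segalL _ (hU.inner_map_map t) (hU.inner_map_map (-t))
    (funext fun v => hU.neg_apply_apply t v) h1 h2

end Twist

end

end TwistedFieldModel

namespace TwistedFieldModel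

noncomputable section

/-! ### Representing a functional on a given Hilbert space through Gram matrices -/

section Representation

variable {ι A H : Type*} [CStarAlgebra A] [NormedAddCommGroup H] [InnerProductSpace ℂ H]

theorem linearCombination_gram {w : ι → A} {φ : A →L[ℂ] ℂ} {v : ι → H}
    (h : ∀ i j, φ (star (w i) * w j) = ⟪v i, v j⟫_ℂ) (x y : ι →₀ ℂ) :
    φ (star (Finsupp.linearCombination ℂ w x) * Finsupp.linearCombination ℂ w y) =
      ⟪Finsupp.linearCombination ℂ v x, Finsupp.linearCombination ℂ v y⟫_ℂ := by
  simp only [Finsupp.linearCombination_apply, Finsupp.sum, star_sum, star_smul, Finset.sum_mul_sum,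
    smul_mul_smul_comm, map_sum, map_smul, h, sum_inner, inner_sum, inner_smul_left,
    inner_smul_right, smul_eq_mul, Complex.star_def]
  rw [Finset.sum_comm]
  refine Finset.sum_congr rfl fun i _ => ?_
  rw [Finset.mul_sum]
  exact Finset.sum_congr rfl fun j _ => by ring

theorem denseRange_linearCombination {E : Type*} [AddCommGroup E] [Module ℂ E]
    [TopologicalSpace E] {w : ι → E}
    (hw : Dense (Submodule.span ℂ (Set.range w) : Set E)) :
    DenseRange (Finsupp.linearCombination ℂ w) := by
  rwa [DenseRange, ← LinearMap.coe_range, Finsupp.range_linearCombination]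

theorem nonneg_of_gram {w : ι → A} (hw : Dense (Submodule.span ℂ (Set.range w) : Set A))
    {φ : A →L[ℂ] ℂ} {v : ι → H} (h : ∀ i j, φ (star (w i) * w j) = ⟪v i, v j⟫_ℂ) (a : A) :
    0 ≤ φ (star a * a) := by
  refine (denseRange_linearCombination hw).induction_on a ?_ fun x => ?_
  · exact isClosed_Ici.preimage (φ.continuous.comp (continuous_star.mul continuous_id))
  · rw [linearCombination_gram h, inner_self_eq_norm_sq_to_K]
    rw [← RCLike.ofReal_pow]
    exact Complex.zero_le_real.mpr (sq_nonneg _)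

/-- A positive functional is represented on every Hilbert space that contains a total family of
vectors with the right Gram matrix. -/
theorem exists_representation [CompleteSpace H] {w : ι → A}
    (hw : Dense (Submodule.span ℂ (Set.range w) : Set A)) {φ : A →L[ℂ] ℂ} {v : ι → H}
    (hv : Dense (Submodule.span ℂ (Set.range v) : Set H))
    (h : ∀ i j, φ (star (w i) * w j) = ⟪v i, v j⟫_ℂ) :
    ∃ ρ : A →⋆ₐ[ℂ] (H →L[ℂ] H), ∀ a i j, ⟪v i, ρ a (v j)⟫_ℂ = φ (star (w i) * a * w j) := by
  -- The spectral order makes positivity on elements `b* b` the positivity required for the GNS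
  -- construction.
  let := CStarAlgebra.spectralOrder A
  let := CStarAlgebra.spectralOrderedRing A
  let f : A →ₚ[ℂ] ℂ := PositiveLinearMap.mk₀ φ.toLinearMap fun a ha => by
    obtain ⟨b, rfl⟩ := CStarAlgebra.nonneg_iff_eq_star_mul_self.mp ha
    exact nonneg_of_gram hw h b
  have hf : ∀ a, f a = φ a := fun a => rfl
  let e : A →ₗ[ℂ] f.GNS := (UniformSpace.Completion.toComplL (𝕜 := ℂ)).toLinearMap ∘ₗ
    f.toPreGNS.toLinearMap
  have he : ∀ a b, ⟪e a, e b⟫_ℂ = φ (star a * b) := fun a b =>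
    UniformSpace.Completion.inner_coe _ _
  have hρ : ∀ a b, f.gnsStarAlgHom a (e b) = e (a * b) := fun a b =>
    f.gnsNonUnitalStarAlgHom_apply_coe
  -- From `‖e a‖² = φ(a* a) ≤ ‖φ‖ ‖a‖²`. Continuity transfers the totality of `w` in `A` to totality
  -- of its image in the GNS space.
  have hcont : Continuous e := by
    refine continuous_of_linear_of_bound (𝕜 := ℂ) (f := e) (C := √‖φ‖) e.map_add e.map_smul
      fun a => ?_
    rw [@norm_eq_sqrt_re_inner ℂ, he]
    refine Real.sqrt_le_iff.mpr ⟨by positivity, ?_⟩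
    rw [mul_pow, Real.sq_sqrt (norm_nonneg _), sq, ← CStarRing.norm_star_mul_self]
    exact (Complex.re_le_norm _).trans (φ.le_opNorm _)
  have hdense : DenseRange e := by
    refine (UniformSpace.Completion.denseRange_coe (α := f.PreGNS)).mono ?_
    rintro _ ⟨a, rfl⟩
    exact ⟨f.ofPreGNS a, rfl⟩
  have hd : DenseRange (e ∘ₗ Finsupp.linearCombination ℂ w) := by
    rw [LinearMap.coe_comp]
    exact hdense.comp (denseRange_linearCombination hw) hcont
  have hnorm : ∀ x, ‖(e ∘ₗ Finsupp.linearCombination ℂ w) (LinearEquiv.refl ℂ (ι →₀ ℂ) x)‖ =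
      ‖Finsupp.linearCombination ℂ v x‖ := by
    intro x
    rw [@norm_eq_sqrt_re_inner ℂ, @norm_eq_sqrt_re_inner ℂ]
    congr 2
    exact (he _ _).trans (linearCombination_gram h x x)
  -- Two total families with the same Gram matrix are related by a unitary, here `v i ↦ e (w i)`; it
  -- carries the GNS representation over to `H`.
  let u := (LinearEquiv.refl ℂ (ι →₀ ℂ)).extendOfIsometry (Finsupp.linearCombination ℂ v)
    (e ∘ₗ Finsupp.linearCombination ℂ w) (denseRange_linearCombination hv) hd hnorm
  have hu : ∀ i, u (v i) = e (w i) := by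
    intro i
    have := (LinearEquiv.refl ℂ (ι →₀ ℂ)).extendOfIsometry_eq _ _
      (denseRange_linearCombination hv) hd hnorm (Finsupp.single i 1)
    simpa using this
  refine ⟨u.symm.conjStarAlgEquiv.toStarAlgHom.comp f.gnsStarAlgHom, fun a i j => ?_⟩
  rw [← u.inner_map_map]
  change ⟪u (v i), u (u.symm (f.gnsStarAlgHom a (u (v j))))⟫_ℂ = _
  rw [u.apply_symm_apply, hu, hu, hρ, he, mul_assoc]

/-- The matrix elements against the total family `v` determine the vector, so a product formula in
`A` passes to `H`. -/
theorem representation_apply {w : ι → A} {φ : A →L[ℂ] ℂ} {v : ι → H}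
    (hv : Dense (Submodule.span ℂ (Set.range v) : Set H))
    (h : ∀ i j, φ (star (w i) * w j) = ⟪v i, v j⟫_ℂ) {ρ : A → H →L[ℂ] H}
    (hρ : ∀ a i j, ⟪v i, ρ a (v j)⟫_ℂ = φ (star (w i) * a * w j)) {a : A} {j k : ι} {c : ℂ}
    (ha : a * w j = c • w k) : ρ a (v j) = c • v k := by
  refine hv.eq_of_inner_right (𝕜 := ℂ) fun y hy => ?_
  induction hy using Submodule.span_induction with
  | mem y hy =>
    obtain ⟨r, rfl⟩ := hy
    rw [hρ, mul_assoc, ha, mul_smul_comm, map_smul, h, inner_smul_right, smul_eq_mul]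
  | zero => simp
  | add y z _ _ hy hz => rw [inner_add_left, inner_add_left, hy, hz]
  | smul c y _ hy => rw [inner_smul_left, inner_smul_left, hy]

theorem denseRange_representation {w : ι → A} {v : ι → H}
    (hv : Dense (Submodule.span ℂ (Set.range v) : Set H)) (ρ : A →ₗ[ℂ] H →L[ℂ] H) {i : ι}
    (h : ∀ j, ∃ c : ℂ, c ≠ 0 ∧ ρ (w j) (v i) = c • v j) : DenseRange fun a => ρ a (v i) := by
  have hle : Submodule.span ℂ (Set.range v) ≤
      LinearMap.range ((ContinuousLinearMap.apply ℂ H (v i)).toLinearMap ∘ₗ ρ) := by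
    rw [Submodule.span_le]
    rintro _ ⟨j, rfl⟩
    obtain ⟨c, hc, hj⟩ := h j
    refine ⟨c⁻¹ • w j, ?_⟩
    change ρ (c⁻¹ • w j) (v i) = v j
    rw [map_smul, smul_apply, hj, smul_smul, inv_mul_cancel₀ hc, one_smul]
  exact hv.mono hle

end Representation

/-! ### The Weyl relations in the concrete Weyl algebra -/

section WeylRelations

variable {S : Type*} [AddCommGroup S]

/-- Biadditive alternating real forms. -/
structure IsAlternatingForm (η : S → S → ℝ) : Prop where
  add_left : ∀ s s' t, η (s + s') t = η s t + η s' t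
  add_right : ∀ s t t', η s (t + t') = η s t + η s t'
  self : ∀ s, η s s = 0

variable {η : S → S → ℝ}

namespace IsAlternatingForm

variable (hη : IsAlternatingForm η)
include hη

theorem zero_left (t : S) : η 0 t = 0 := by
  have := hη.add_left 0 0 t
  rw [add_zero] at this
  linarith

theorem neg_left (s t : S) : η (-s) t = -η s t := by
  have := hη.add_left (-s) s t
  rw [neg_add_cancel, hη.zero_left] at this
  linarith

theorem swap (s t : S) : η t s = -η s t := by
  have := hη.self (s + t)
  rw [hη.add_left, hη.add_right, hη.add_right, hη.self, hη.self] at this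
  linarith

end IsAlternatingForm

theorem weylOp_apply (s : S) (ξ : lp (fun _ : S => ℂ) 2) (t : S) :
    weylOp η s ξ t = weylPhase η s (t - s) * ξ (t - s) := rfl

theorem weylPhase_mul_weylPhase (hη : IsAlternatingForm η) (s s' t : S) :
    weylPhase η s (s' + t) * weylPhase η s' t = weylPhase η s s' * weylPhase η (s + s') t := by
  simp only [weylPhase, ← Complex.exp_add, hη.add_left, hη.add_right]
  congr 1
  push_cast
  ring

theorem weylOp_mul_weylOp (hη : IsAlternatingForm η) (s s' : S) :
    weylOp η s * weylOp η s' = weylPhase η s s' • weylOp η (s + s') := by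
  ext ξ t
  have h := weylPhase_mul_weylPhase hη s s' (t - s - s')
  rw [add_sub_cancel] at h
  rw [mul_apply_eq_comp, smul_apply, lp.coeFn_smul, Pi.smul_apply, weylOp_apply, weylOp_apply,
    weylOp_apply, ← mul_assoc, h, smul_eq_mul, mul_assoc, sub_add_eq_sub_sub]

theorem weylOp_zero (hη : IsAlternatingForm η) : weylOp η 0 = 1 := by
  ext ξ t
  rw [weylOp_apply, weylPhase, hη.zero_left, sub_zero]
  simp

theorem norm_weylOp_apply (s : S) (ξ : lp (fun _ : S => ℂ) 2) : ‖weylOp η s ξ‖ = ‖ξ‖ := by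
  rw [lp.norm_eq_tsum_rpow (by norm_num), lp.norm_eq_tsum_rpow (by norm_num)]
  simp only [weylOp_apply, norm_mul, norm_weylPhase, one_mul]
  congr 1
  exact (Equiv.subRight s).tsum_eq fun t => ‖ξ t‖ ^ (2 : ENNReal).toReal

theorem weylPhase_neg_self (hη : IsAlternatingForm η) (s : S) : weylPhase η (-s) s = 1 := by
  rw [weylPhase, hη.neg_left, hη.self]
  simp

/-- An isometry with a right inverse is unitary, and the right inverse is its adjoint. -/
theorem star_weylOp (hη : IsAlternatingForm η) (s : S) : star (weylOp η s) = weylOp η (-s) := by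
  have h1 : star (weylOp η s) * weylOp η s = 1 :=
    (ContinuousLinearMap.norm_map_iff_adjoint_comp_self _).mp (norm_weylOp_apply s)
  have h2 : weylOp η s * weylOp η (-s) = 1 := by
    have h := weylPhase_neg_self hη (-s)
    rw [neg_neg] at h
    rw [weylOp_mul_weylOp hη, h, one_smul, add_neg_cancel, weylOp_zero hη]
  rw [← mul_one (star _), ← h2, ← mul_assoc, h1, one_mul]

theorem weyl_mul_weyl (hη : IsAlternatingForm η) (s s' : S) :
    weyl η s * weyl η s' = weylPhase η s s' • weyl η (s + s') :=
  Subtype.ext (weylOp_mul_weylOp hη s s')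

theorem weyl_zero (hη : IsAlternatingForm η) : weyl η 0 = 1 := Subtype.ext (weylOp_zero hη)

theorem star_weyl (hη : IsAlternatingForm η) (s : S) : star (weyl η s) = weyl η (-s) :=
  Subtype.ext (star_weylOp hη s)

/-- By the Weyl relations the linear span of the generators is already closed under products and
adjoints, so it contains the generated star algebra. -/
theorem dense_span_weyl (hη : IsAlternatingForm η) :
    Dense (Submodule.span ℂ (Set.range (weyl η)) : Set (WeylAlgebra η)) := by
  have hmul : ∀ s, ∀ y ∈ Submodule.span ℂ (Set.range (weylOp η)),
      weylOp η s * y ∈ Submodule.span ℂ (Set.range (weylOp η)) := by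
    intro s y hy
    induction hy using Submodule.span_induction with
    | mem y hy =>
      obtain ⟨t, rfl⟩ := hy
      rw [weylOp_mul_weylOp hη]
      exact Submodule.smul_mem _ _ (Submodule.subset_span ⟨_, rfl⟩)
    | zero => rw [mul_zero]; exact Submodule.zero_mem _
    | add y z _ _ hy hz => rw [mul_add]; exact Submodule.add_mem _ hy hz
    | smul c y _ hy => rw [mul_smul_comm]; exact Submodule.smul_mem _ _ hy
  have hadj : ∀ x ∈ StarAlgebra.adjoin ℂ (Set.range (weylOp η)),
      x ∈ Submodule.span ℂ (Set.range (weylOp η)) := by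
    intro x hx
    induction hx using StarAlgebra.adjoin_induction with
    | mem x hx => exact Submodule.subset_span hx
    | algebraMap r =>
      rw [Algebra.algebraMap_eq_smul_one, ← weylOp_zero hη]
      exact Submodule.smul_mem _ _ (Submodule.subset_span ⟨_, rfl⟩)
    | add x y _ _ hx hy => exact Submodule.add_mem _ hx hy
    | mul x y hxa _ hx hy =>
      clear hxa
      induction hx using Submodule.span_induction with
      | mem x hx =>
        obtain ⟨s, rfl⟩ := hx
        exact hmul s y hy
      | zero => rw [zero_mul]; exact Submodule.zero_mem _
      | add x z _ _ hx hz => rw [add_mul]; exact Submodule.add_mem _ hx hz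
      | smul c x _ hx => rw [smul_mul_assoc]; exact Submodule.smul_mem _ _ hx
    | star x hxa hx =>
      clear hxa
      induction hx using Submodule.span_induction with
      | mem x hx =>
        obtain ⟨s, rfl⟩ := hx
        rw [star_weylOp hη]
        exact Submodule.subset_span ⟨_, rfl⟩
      | zero => rw [star_zero]; exact Submodule.zero_mem _
      | add x z _ _ hx hz => rw [star_add]; exact Submodule.add_mem _ hx hz
      | smul c x _ hx => rw [star_smul]; exact Submodule.smul_mem _ _ hx
  have himage : (Subtype.val '' (Submodule.span ℂ (Set.range (weyl η)) : Set (WeylAlgebra η))) =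
      Submodule.span ℂ (Set.range (weylOp η)) := by
    have h := Submodule.map_span (WeylAlgebra η).subtype.toLinearMap (Set.range (weyl η))
    rw [← Set.range_comp] at h
    exact congrArg SetLike.coe h
  exact Subtype.dense_iff.mpr
    ((closure_mono hadj).trans (Eq.subset (congrArg closure himage.symm)))

theorem isClosed_weylAlgebra (η : S → S → ℝ) :
    IsClosed (WeylAlgebra η : Set (lp (fun _ : S => ℂ) 2 →L[ℂ] lp (fun _ : S => ℂ) 2)) :=
  StarSubalgebra.isClosed_topologicalClosure _

end WeylRelations

/-! ### Boundedness of multipliers of positive type on the Weyl operators -/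

section SchurMultiplier

theorem exists_norm_compression_le {H K : Type*} [NormedAddCommGroup H] [InnerProductSpace ℂ H]
    [CompleteSpace H] [NormedAddCommGroup K] [InnerProductSpace ℂ K] [CompleteSpace K]
    (V : H →L[ℂ] HilbertTensor H K) : ∃ C : ℝ, ∀ S : H →L[ℂ] H,
    ‖ContinuousLinearMap.adjoint V ∘L tensorOneL H K S ∘L V‖ ≤ C * ‖S‖ := by
  refine ⟨‖ContinuousLinearMap.adjoint V‖ * (‖(1 : K →L[ℂ] K)‖ * ‖V‖), fun S =>
    ContinuousLinearMap.opNorm_le_bound _ (by positivity) fun x => ?_⟩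
  have h := (norm_tensorOp_apply_le S (1 : K →L[ℂ] K) (V x)).trans
    (mul_le_mul_of_nonneg_left (V.le_opNorm x) (by positivity))
  refine ((ContinuousLinearMap.adjoint V).le_opNorm (tensorOneL H K S (V x))).trans
    ((mul_le_mul_of_nonneg_left h (norm_nonneg _)).trans_eq ?_)
  ring

variable {S F : Type*} [AddCommGroup S] [NormedAddCommGroup F] [InnerProductSpace ℂ F]
  [CompleteSpace F] {η : S → S → ℝ}

open Classical in
theorem weylOp_single (s t : S) : weylOp η s (lp.single 2 t (1 : ℂ)) =
    weylPhase η s t • lp.single 2 (s + t) (1 : ℂ) := by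
  ext r
  rw [weylOp_apply, lp.coeFn_smul, Pi.smul_apply, lp.single_apply, lp.single_apply, smul_eq_mul]
  by_cases h : r = s + t
  · subst h
    simp
  · have h' : r - s ≠ t := fun h' => h (by rw [← h', add_sub_cancel])
    simp [Pi.single_eq_of_ne h, Pi.single_eq_of_ne h']

open Classical in
/-- Multiplication of the generators of the Weyl algebra by a function of positive type of the form
`s ↦ ⟨x, u(s) x⟩` is bounded. -/
theorem exists_norm_schur_le {u : S → F →L[ℂ] F} (hu : ∀ s t, u (s + t) = u s * u t)
    (hu' : ∀ s x y, ⟪u s x, u s y⟫_ℂ = ⟪x, y⟫_ℂ) {x : F} (hx : ‖x‖ = 1) :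
    ∃ C : ℝ, ∀ a : S →₀ ℂ, ‖Finsupp.linearCombination ℂ (fun s => ⟪x, u s x⟫_ℂ • weylOp η s) a‖ ≤
      C * ‖Finsupp.linearCombination ℂ (weylOp η) a‖ := by
  -- The vectors `δ_t ⊗ u(-t) x` are orthonormal because the `δ_t` are and `u(-t) x` has norm `1`.
  -- With `V δ_t = δ_t ⊗ u(-t) x`, the operator `V* (W(s) ⊗ 1) V` sends `δ_t` to `δ_{s+t}` with the
  -- additional coefficient `⟨u(-(s+t)) x, u(-t) x⟩ = ⟨x, u(s) x⟩`, which does not depend on `t`.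
  let e : S → HilbertTensor (lp (fun _ : S => ℂ) 2) F := fun t =>
    tmul (lp.single 2 t (1 : ℂ)) (u (-t) x)
  have hinner : ∀ (s : S) (ξ : lp (fun _ : S => ℂ) 2), ⟪lp.single 2 s (1 : ℂ), ξ⟫_ℂ = ξ s := by
    intro s ξ
    rw [lp.inner_single_left]
    simp
  have he : Orthonormal ℂ e := by
    rw [orthonormal_iff_ite]
    intro s t
    rw [inner_tmul_tmul, hinner, lp.single_apply]
    by_cases h : s = t
    · subst h
      rw [hu', inner_self_eq_norm_sq_to_K, hx]
      simp
    · simp [h]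
  let V := he.orthogonalFamily.linearIsometry
  have hV : ∀ t, V (lp.single 2 t (1 : ℂ)) = e t := fun t => by
    refine (he.orthogonalFamily.linearIsometry_apply_single (1 : ℂ)).trans ?_
    simp
  let Φ : (lp (fun _ : S => ℂ) 2 →L[ℂ] lp (fun _ : S => ℂ) 2) →ₗ[ℂ]
      (lp (fun _ : S => ℂ) 2 →L[ℂ] lp (fun _ : S => ℂ) 2) :=
    { toFun := fun X => ContinuousLinearMap.adjoint V.toContinuousLinearMap ∘L
        tensorOneL _ F X ∘L V.toContinuousLinearMap
      map_add' := fun X Y => by simp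
      map_smul' := fun c X => by simp }
  have hΦ : ∀ s, Φ (weylOp η s) = ⟪x, u s x⟫_ℂ • weylOp η s := by
    intro s
    refine lp.ext_continuousLinearMap (by norm_num) fun t => ?_
    ext r
    change Φ (weylOp η s) (lp.single 2 t (1 : ℂ)) r =
      (⟪x, u s x⟫_ℂ • weylOp η s) (lp.single 2 t (1 : ℂ)) r
    rw [← hinner, smul_apply, weylOp_single]
    change ⟪_, ContinuousLinearMap.adjoint V.toContinuousLinearMap
      (tensorOneL _ F (weylOp η s) (V (lp.single 2 t (1 : ℂ))))⟫_ℂ = _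
    rw [ContinuousLinearMap.adjoint_inner_right, LinearIsometry.coe_toContinuousLinearMap, hV, hV,
      tensorOneL_apply, tensorOp_tmul, one_apply_eq_self, weylOp_single, inner_tmul_tmul,
      inner_smul_right, hinner, lp.coeFn_smul, lp.coeFn_smul, Pi.smul_apply, Pi.smul_apply,
      lp.single_apply, smul_eq_mul, smul_eq_mul]
    by_cases h : r = s + t
    · subst h
      have h1 : u (-t) x = u (-(s + t)) (u s x) := by
        rw [← mul_apply_eq_comp, ← hu]
        congr 2
        abel
      rw [h1, hu', mul_comm]
    · simp [h]
  obtain ⟨C, hC⟩ := exists_norm_compression_le V.toContinuousLinearMap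
  refine ⟨C, fun a => ?_⟩
  have h : Finsupp.linearCombination ℂ (fun s => ⟪x, u s x⟫_ℂ • weylOp η s) a =
      Φ (Finsupp.linearCombination ℂ (weylOp η) a) := by
    rw [Finsupp.apply_linearCombination]
    simp only [Function.comp_def, hΦ]
  rw [h]
  exact hC _

end SchurMultiplier

end

end TwistedFieldModel

namespace TwistedFieldModel

noncomputable section

/-! ### Charged states and their cyclic representations -/

section ChargedState

variable {S F K : Type*} [AddCommGroup S] {η : S → S → ℝ}
  [NormedAddCommGroup F] [InnerProductSpace ℂ F] [CompleteSpace F]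
  [NormedAddCommGroup K] [InnerProductSpace ℂ K] [CompleteSpace K]

theorem norm_map_weylAlgebra_le (π : WeylAlgebra η →⋆ₐ[ℂ] (K →L[ℂ] K)) (a : WeylAlgebra η) :
    ‖π a‖ ≤ ‖a‖ :=
  have := isClosed_weylAlgebra η
  NonUnitalStarAlgHom.norm_apply_le π a

theorem coe_linearCombination_weyl (c : S → ℂ) (a : S →₀ ℂ) :
    ((Finsupp.linearCombination ℂ (fun s => c s • weyl η s) a : WeylAlgebra η) :
      lp (fun _ : S => ℂ) 2 →L[ℂ] lp (fun _ : S => ℂ) 2) =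
      Finsupp.linearCombination ℂ (fun s => c s • weylOp η s) a :=
  Finsupp.apply_linearCombination ℂ (WeylAlgebra η).subtype.toLinearMap _ a

/-- The functional `W(s) ↦ ⟨x, u(s) x⟩ ω(W(s))` is bounded. -/
theorem exists_continuous_schur {u : S → F →L[ℂ] F} (hη : IsAlternatingForm η)
    (hu : ∀ s t, u (s + t) = u s * u t)
    (hu' : ∀ s x y, ⟪u s x, u s y⟫_ℂ = ⟪x, y⟫_ℂ) {x : F} (hx : ‖x‖ = 1)
    {ω : WeylAlgebra η →ₗ[ℂ] ℂ} {π : WeylAlgebra η →⋆ₐ[ℂ] (K →L[ℂ] K)} {Ω : K}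
    (hω : ∀ a, ω a = ⟪Ω, π a Ω⟫_ℂ) :
    ∃ φ : WeylAlgebra η →L[ℂ] ℂ, ∀ s, φ (weyl η s) = ⟪x, u s x⟫_ℂ * ω (weyl η s) := by
  obtain ⟨C, hC⟩ := exists_norm_schur_le (η := η) hu hu' hx
  have hbound : ∀ a : S →₀ ℂ,
      ‖Finsupp.linearCombination ℂ (fun s => ⟪x, u s x⟫_ℂ * ω (weyl η s)) a‖ ≤
        (‖Ω‖ * ‖Ω‖ * C) * ‖Finsupp.linearCombination ℂ (weyl η) a‖ := by
    intro a
    have h1 : Finsupp.linearCombination ℂ (fun s => ⟪x, u s x⟫_ℂ * ω (weyl η s)) a =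
        ω (Finsupp.linearCombination ℂ (fun s => ⟪x, u s x⟫_ℂ • weyl η s) a) := by
      rw [Finsupp.apply_linearCombination]
      simp only [Function.comp_def, map_smul, smul_eq_mul]
    have h2 : ‖Finsupp.linearCombination ℂ (fun s => ⟪x, u s x⟫_ℂ • weyl η s) a‖ ≤
        C * ‖Finsupp.linearCombination ℂ (weyl η) a‖ := by
      have h3 := coe_linearCombination_weyl (η := η) (fun _ => 1) a
      simp only [one_smul] at h3
      change ‖((Finsupp.linearCombination ℂ (fun s => ⟪x, u s x⟫_ℂ • weyl η s) a :
        WeylAlgebra η) : lp (fun _ : S => ℂ) 2 →L[ℂ] lp (fun _ : S => ℂ) 2)‖ ≤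
        C * ‖((Finsupp.linearCombination ℂ (fun s => weyl η s) a :
        WeylAlgebra η) : lp (fun _ : S => ℂ) 2 →L[ℂ] lp (fun _ : S => ℂ) 2)‖
      rw [h3, coe_linearCombination_weyl]
      exact hC a
    rw [h1, hω]
    calc _ ≤ ‖Ω‖ * (‖Finsupp.linearCombination ℂ (fun s => ⟪x, u s x⟫_ℂ • weyl η s) a‖ * ‖Ω‖) :=
          (norm_inner_le_norm _ _).trans (mul_le_mul_of_nonneg_left
            ((ContinuousLinearMap.le_opNorm _ _).trans (mul_le_mul_of_nonneg_right
              (norm_map_weylAlgebra_le π _) (norm_nonneg _))) (norm_nonneg _))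
      _ ≤ ‖Ω‖ * ((C * ‖Finsupp.linearCombination ℂ (weyl η) a‖) * ‖Ω‖) := by gcongr
      _ = _ := by ring
  -- The bound also makes the functional well defined: a combination of Weyl operators that vanishes
  -- is sent to `0`.
  refine ⟨(Finsupp.linearCombination ℂ fun s => ⟪x, u s x⟫_ℂ * ω (weyl η s)).extendOfNorm
    (Finsupp.linearCombination ℂ (weyl η)), fun s => ?_⟩
  have := LinearMap.extendOfNorm_eq (denseRange_linearCombination (dense_span_weyl hη))
    ⟨_, hbound⟩ (Finsupp.single s 1)
  simpa using this

/-- A functional `φ(w(s)) = ⟨x, T(s) x⟩` on a C*-algebra with a total family `w`, where both `w` and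
`T` satisfy the Weyl relations, is positive, and it is represented on the cyclic space of `x`. -/
theorem exists_representation_cyclic {A E : Type*} [CStarAlgebra A] [NormedAddCommGroup E]
    [InnerProductSpace ℂ E] [CompleteSpace E] {w : S → A} {p : S → S → ℂ}
    (hw : Dense (Submodule.span ℂ (Set.range w) : Set A)) (hw0 : w 0 = 1)
    (hstar : ∀ s, star (w s) = w (-s)) (hmul : ∀ s t, w s * w t = p s t • w (s + t))
    (hp : ∀ s t, p s t ≠ 0) {T : S → E →L[ℂ] E} (hT0 : T 0 = 1)
    (hTstar : ∀ s, star (T s) = T (-s)) (hTmul : ∀ s t, T s * T t = p s t • T (s + t))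
    {x : E} {φ : A →L[ℂ] ℂ} (hφ : ∀ s, φ (w s) = ⟪x, T s x⟫_ℂ)
    (M : Submodule ℂ E) [CompleteSpace M]
    (hM : M = (Submodule.span ℂ (Set.range fun s => T s x)).topologicalClosure) :
    (∀ a, 0 ≤ φ (star a * a)) ∧
      ∃ (π' : A →⋆ₐ[ℂ] (M →L[ℂ] M)) (Ω' : M), (Ω' : E) = x ∧
        (∀ (s : S) (v : M), (π' (w s) v : E) = T s v) ∧
        (DenseRange fun a => π' a Ω') ∧ ∀ a, φ a = ⟪Ω', π' a Ω'⟫_ℂ := by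
  let v : S → M := fun s => ⟨T s x, by
    rw [hM]
    exact Submodule.le_topologicalClosure _ (Submodule.subset_span ⟨s, rfl⟩)⟩
  have hv : ∀ s, (v s : E) = T s x := fun s => rfl
  have hdense : Dense (Submodule.span ℂ (Set.range v) : Set M) := by
    have h := Submodule.map_span M.subtype (Set.range v)
    rw [← Set.range_comp] at h
    have h2 := congrArg SetLike.coe h
    refine Subtype.dense_iff.mpr ?_
    have h3 : (M : Set E) = _ := congrArg SetLike.coe hM
    intro y hy
    rw [h3] at hy
    exact (congrArg closure h2.symm).subset hy
  -- The same Weyl relations reduce both sides to one generator, `w(-s+t)` and `T(-s+t)`, with the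
  -- same phase.
  have hgram : ∀ s t, φ (star (w s) * w t) = ⟪v s, v t⟫_ℂ := by
    intro s t
    rw [Submodule.coe_inner, hv, hv, ← ContinuousLinearMap.adjoint_inner_right,
      ← ContinuousLinearMap.star_eq_adjoint, hTstar, ← mul_apply_eq_comp, hTmul, hstar, hmul,
      map_smul, hφ, smul_apply, inner_smul_right, smul_eq_mul]
  obtain ⟨ρ, hρ⟩ := exists_representation hw hdense hgram
  have hρv : ∀ s t, ρ (w s) (v t) = p s t • v (s + t) := fun s t =>
    representation_apply hdense hgram hρ (hmul s t)
  refine ⟨nonneg_of_gram hw hgram, ρ, v 0, by rw [hv, hT0, one_apply_eq_self], fun s => ?_, ?_, ?_⟩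
  -- The abstract representation is identified with the restriction of `T(s)` by comparing the two
  -- on the total family `T(t) x`.
  · have h : M.subtypeL ∘L ρ (w s) = T s ∘L M.subtypeL := by
      refine ContinuousLinearMap.ext_on hdense ?_
      rintro _ ⟨t, rfl⟩
      change ((ρ (w s) (v t) : M) : E) = T s (v t : E)
      rw [hρv, Submodule.coe_smul, hv, hv, ← mul_apply_eq_comp, hTmul, smul_apply]
    intro y
    exact congrArg (fun T : M →L[ℂ] E => T y) h
  · exact denseRange_representation (w := w) hdense ρ.toAlgHom.toLinearMap fun s =>
      ⟨p s 0, hp s 0, (hρv s 0).trans (by rw [add_zero])⟩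
  · intro a
    have h := hρ a 0 0
    rw [hw0, star_one, one_mul, mul_one] at h
    exact h.symm

theorem exists_state_cyclic {E : Type*} [NormedAddCommGroup E] [InnerProductSpace ℂ E]
    [CompleteSpace E] (hη : IsAlternatingForm η) {T : S → E →L[ℂ] E} (hT0 : T 0 = 1)
    (hTstar : ∀ s, star (T s) = T (-s)) (hTmul : ∀ s t, T s * T t = weylPhase η s t • T (s + t))
    {x : E} {φ : WeylAlgebra η →L[ℂ] ℂ} (hφ1 : φ 1 = 1) (hφ : ∀ s, φ (weyl η s) = ⟪x, T s x⟫_ℂ)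
    (M : Submodule ℂ E) [CompleteSpace M]
    (hM : M = (Submodule.span ℂ (Set.range fun s => T s x)).topologicalClosure) :
    IsState φ.toLinearMap ∧
      ∃ (π' : WeylAlgebra η →⋆ₐ[ℂ] BoundedOp M) (Ω' : M), (Ω' : E) = x ∧
        (∀ (s : S) (v : M), (π' (weyl η s) v : E) = T s v) ∧
        IsGNSTriple φ.toLinearMap π' Ω' := by
  have := isClosed_weylAlgebra η
  obtain ⟨hpos, π', Ω', h1, h2, h3, h4⟩ := exists_representation_cyclic (A := WeylAlgebra η)
    (w := weyl η) (dense_span_weyl hη) (weyl_zero hη) (star_weyl hη) (weyl_mul_weyl hη)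
    (fun _ _ => Complex.exp_ne_zero _) hT0 hTstar hTmul hφ M hM
  exact ⟨⟨hpos, hφ1⟩, π', Ω', h1, h2, h3, h4⟩

section TensorWeyl

variable {u : S → F →L[ℂ] F} (hη : IsAlternatingForm η) (hu : ∀ s t, u (s + t) = u s * u t)
  (hu0 : u 0 = 1) (π : WeylAlgebra η →⋆ₐ[ℂ] (K →L[ℂ] K))
include hη

omit [CompleteSpace F] in
include hu0 in
theorem tensorOp_weyl_zero : tensorOp (u 0) (π (weyl η 0)) = 1 := by
  rw [hu0, weyl_zero hη, map_one, tensorOp_one]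

omit [CompleteSpace F] in
include hu in
theorem tensorOp_weyl_mul (s t : S) :
    tensorOp (u s) (π (weyl η s)) * tensorOp (u t) (π (weyl η t)) =
      weylPhase η s t • tensorOp (u (s + t)) (π (weyl η (s + t))) := by
  rw [tensorOp_mul, ← hu, ← map_mul, weyl_mul_weyl hη, map_smul, tensorOp_smul_right]

theorem star_tensorOp_weyl (hstar : ∀ s, star (u s) = u (-s)) (s : S) :
    star (tensorOp (u s) (π (weyl η s))) = tensorOp (u (-s)) (π (weyl η (-s))) := by
  rw [star_tensorOp, hstar, ← map_star, star_weyl hη]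

end TensorWeyl

/-- The charged state and its GNS representation, for a unitary representation `u` of the additive
group underlying the symplectic space. -/
theorem exists_chargedState {u : S → F →L[ℂ] F} (hη : IsAlternatingForm η)
    (hu : ∀ s t, u (s + t) = u s * u t) (hu0 : u 0 = 1)
    (hu' : ∀ s x y, ⟪u s x, u s y⟫_ℂ = ⟪x, y⟫_ℂ) (hustar : ∀ s, star (u s) = u (-s))
    {x : F} (hx : ‖x‖ = 1) {ω : WeylAlgebra η →ₗ[ℂ] ℂ} (hone : ω 1 = 1) {π : WeylAlgebra η →⋆ₐ[ℂ] (K →L[ℂ] K)} {Ω : K}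
    (hω : ∀ a, ω a = ⟪Ω, π a Ω⟫_ℂ) (M : Submodule ℂ (HilbertTensor F K)) [CompleteSpace M]
    (hM : M = (Submodule.span ℂ (Set.range fun s =>
      tensorOp (u s) (π (weyl η s)) (tmul x Ω))).topologicalClosure) :
    ∃ ω' : WeylAlgebra η →ₗ[ℂ] ℂ, IsState ω' ∧
      (∀ s, ω' (weyl η s) = ⟪x, u s x⟫_ℂ * ω (weyl η s)) ∧
      ∃ (π' : WeylAlgebra η →⋆ₐ[ℂ] BoundedOp M) (Ω' : M),
        (Ω' : HilbertTensor F K) = tmul x Ω ∧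
        (∀ (s : S) (v : M), (π' (weyl η s) v : HilbertTensor F K) =
          tensorOp (u s) (π (weyl η s)) v) ∧
        IsGNSTriple ω' π' Ω' := by
  obtain ⟨φ, hφ⟩ := exists_continuous_schur hη hu hu' hx hω
  have hφ' : ∀ s, φ (weyl η s) =
      ⟪tmul x Ω, tensorOp (u s) (π (weyl η s)) (tmul x Ω)⟫_ℂ := fun s =>
    (hφ s).trans (by rw [tensorOp_tmul, inner_tmul_tmul, hω])
  have hone' : φ 1 = 1 := by
    have h := hφ 0
    rw [weyl_zero hη, hu0, one_apply_eq_self, hone, inner_self_eq_norm_sq_to_K, hx] at h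
    simpa using h
  have hT0 := tensorOp_weyl_zero hη hu0 π
  have hTs := star_tensorOp_weyl hη π hustar
  have hTm := tensorOp_weyl_mul hη hu π
  have h := @exists_state_cyclic S _ η (HilbertTensor F K) _ _ _ hη
  have h := @h (fun s => tensorOp (u s) (π (weyl η s))) hT0 hTs hTm
  have h := @h (tmul x Ω) φ hone' hφ' M _ hM
  exact ⟨φ.toLinearMap, h.1, hφ, h.2⟩

end ChargedState

end

end TwistedFieldModel

namespace TwistedFieldModel

noncomputable section

/-! ### Generators and covariant families of bounded operators -/

section Covariance

variable {H W : Type*} [NormedAddCommGroup H] [InnerProductSpace ℂ H] [CompleteSpace H]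
  [NormedAddCommGroup W] [InnerProductSpace ℂ W] [CompleteSpace W]

theorem IsUnitaryGroup.expI_mul_expI_neg {U : ℝ → H →L[ℂ] H} (hU : IsUnitaryGroup U)
    {B B' : H →L[ℂ] H} (h : U 1 * B = B' * U 1) :
    expI (stoneGenerator U) * B * expI (-stoneGenerator U) = B' := by
  rw [hU.neg_stoneGenerator, hU.expI_stoneGenerator, hU.comp_neg.expI_stoneGenerator, h, mul_assoc,
    ← hU.add, add_neg_cancel, hU.zero, mul_one]

omit [CompleteSpace H] in
theorem smul_mul_comm_of_weyl {A B C : H →L[ℂ] H} {a b p : ℂ} (h₁ : A * B = a • C)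
    (h₂ : B * A = b • C) (h : a = p * b) : A * B = p • (B * A) := by
  rw [h₁, h₂, smul_smul, h]

/-- A family of operators on which a unitary group acts by a unitary group on its index space
preserves the domain of the generator, with the commutator determined by the generator of the latter
group. -/
theorem IsUnitaryGroup.mem_graph_of_covariant {U : ℝ → H →L[ℂ] H} (hU : IsUnitaryGroup U)
    {u : ℝ → W →L[ℂ] W} (hu : IsUnitaryGroup u) {L : W →L[ℂ] H →L[ℂ] H}
    (hL : ∀ t w, U t * L w = L (u (-t) w) * U t) {w w' : W}
    (hw : (w, w') ∈ (stoneGenerator u).graph) {v v' : H}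
    (hv : (v, v') ∈ (stoneGenerator U).graph) :
    (L w v, L w v' - L w' v) ∈ (stoneGenerator U).graph := by
  have h0 : L (u (-0) w) = L w := by rw [neg_zero, hu.zero_apply]
  -- As `L` is bounded, differentiability of `u(-t) w` in `W` becomes the operator norm
  -- differentiability that `mem_graph_of_intertwine` requires.
  have hd : HasDerivAt (fun t => L (u (-t) w)) (-Complex.I • L w') 0 := by
    have h1 := mem_graph_stoneGenerator.mp hw
    have h2 : HasDerivAt (fun t : ℝ => u (-t) w) (-(Complex.I • w')) 0 := by
      have h3 : HasDerivAt (fun t => u t w) (Complex.I • w') (-0) := by rwa [neg_zero]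
      have h4 := h3.scomp (0 : ℝ) (_root_.hasDerivAt_neg (0 : ℝ))
      rwa [neg_one_smul] at h4
    have h5 := (L.restrictScalars ℝ).hasFDerivAt.comp_hasDerivAt (0 : ℝ) h2
    have h6 : L (-(Complex.I • w')) = -Complex.I • L w' := by rw [map_neg, map_smul, neg_smul]
    exact h6 ▸ h5
  have := mem_graph_of_intertwine hU (B := fun t => L (u (-t) w)) (fun t => by
    simp only [h0]; exact hL t w) hd hv
  simpa only [h0] using this

end Covariance

/-! ### The symplectic form on test functions -/

section Symplectic

variable (c : TestClass)

theorem integrable_mul_testSpace (f g : testSpace c) :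
    Integrable fun x => (f : 𝓢(Space, ℝ)) x * (g : 𝓢(Space, ℝ)) x :=
  ((f : 𝓢(Space, ℝ)).memLp 2 volume).integrable_mul ((g : 𝓢(Space, ℝ)).memLp 2 volume)

theorem integrable_sympl (s s' : TestPair c) :
    Integrable fun x => (s.2 : 𝓢(Space, ℝ)) x * (s'.1 : 𝓢(Space, ℝ)) x
      - (s.1 : 𝓢(Space, ℝ)) x * (s'.2 : 𝓢(Space, ℝ)) x :=
  (integrable_mul_testSpace c _ _).sub (integrable_mul_testSpace c _ _)

theorem isAlternatingForm_sympl : IsAlternatingForm (sympl c) where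
  add_left s s' t := by
    rw [sympl, sympl, sympl, ← integral_add (integrable_sympl c s t) (integrable_sympl c s' t)]
    refine integral_congr_ae (Filter.Eventually.of_forall fun x => ?_)
    simp only [Prod.snd_add, Prod.fst_add, Submodule.coe_add, add_apply]
    ring
  add_right s t t' := by
    rw [sympl, sympl, sympl, ← integral_add (integrable_sympl c s t) (integrable_sympl c s t')]
    refine integral_congr_ae (Filter.Eventually.of_forall fun x => ?_)
    simp only [Prod.snd_add, Prod.fst_add, Submodule.coe_add, add_apply]
    ring
  self s := by
    rw [sympl, ← integral_zero Space ℝ]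
    refine integral_congr_ae (Filter.Eventually.of_forall fun x => ?_)
    simp only
    ring

theorem sympl_smul_smul (t r : ℝ) (s s' : TestPair c) :
    sympl c (t • s) (r • s') = sympl c s s' * t * r := by
  rw [mul_assoc, mul_comm, sympl, sympl, ← integral_const_mul]
  refine integral_congr_ae (Filter.Eventually.of_forall fun x => ?_)
  simp only [Prod.smul_snd, Prod.smul_fst, Submodule.coe_smul, smul_apply, smul_eq_mul]
  ring

end Symplectic

/-! ### The second quantized twists as a representation of the test functions -/

section TwistedSecondQuant

variable (σ : Distr)

theorem secondQuant_twist_add (f g : 𝓢(Space, ℝ)) :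
    secondQuant (twist σ (f + g)) = secondQuant (twist σ f) * secondQuant (twist σ g) := by
  rw [secondQuant_mul (inner_twist σ f) (inner_twist σ g), twist_comp_twist]

theorem twist_zero : twist σ 0 = id := by
  rw [← zero_smul ℝ (0 : 𝓢(Space, ℝ)), twist_smul, (isUnitaryGroup_twistGroup σ 0).zero]
  rfl

theorem star_secondQuant_twist (f : 𝓢(Space, ℝ)) :
    star (secondQuant (twist σ f)) = secondQuant (twist σ (-f)) :=
  star_secondQuant (inner_twist σ f) (inner_twist σ (-f)) (by
    rw [twist_comp_twist, add_neg_cancel, twist_zero])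

end TwistedSecondQuant

/-! ### The twisted field: self-adjointness and commutation relations -/

section TwistedField

variable {c : TestClass} {K : Type*} [NormedAddCommGroup K] [InnerProductSpace ℂ K]
  [CompleteSpace K] (σ : Distr) {π : WeylAlgebra (sympl c) →⋆ₐ[ℂ] (K →L[ℂ] K)}

theorem isUnitaryGroup_weyl (hreg : IsRegular π) (s : TestPair c) :
    IsUnitaryGroup fun t : ℝ => π (weyl (sympl c) (t • s)) := by
  have hη := isAlternatingForm_sympl c
  have hadd : ∀ t r : ℝ, π (weyl (sympl c) ((t + r) • s)) =
      π (weyl (sympl c) (t • s)) * π (weyl (sympl c) (r • s)) := by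
    intro t r
    have h : weylPhase (sympl c) (t • s) (r • s) = 1 := by
      rw [weylPhase, sympl_smul_smul, hη.self]
      simp
    rw [← map_mul, weyl_mul_weyl hη, h, one_smul, add_smul]
  have hzero : π (weyl (sympl c) ((0 : ℝ) • s)) = 1 := by rw [zero_smul, weyl_zero hη, map_one]
  have hstar : ∀ t : ℝ, star (π (weyl (sympl c) (t • s))) = π (weyl (sympl c) (-t • s)) := by
    intro t
    rw [← map_star, star_weyl hη, neg_smul]
  refine ⟨fun t => ?_, hzero, hadd, hreg s⟩
  rw [Unitary.mem_iff, hstar, ← hadd, ← hadd, neg_add_cancel, add_neg_cancel, hzero]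
  exact ⟨rfl, rfl⟩

theorem secondQuant_twist_smul (s : TestPair c) (t : ℝ) :
    secondQuant (twist σ (t • s).1) = secondQuant (twistGroup σ s.1 t) := by
  rw [← twist_smul]
  rfl

theorem twistedWeyl_smul (s : TestPair c) (t : ℝ) : twistedWeyl σ π (t • s) =
    tensorOp (secondQuant (twistGroup σ s.1 t)) (π (weyl (sympl c) (t • s))) :=
  congrArg (fun T => tensorOp T (π (weyl (sympl c) (t • s)))) (secondQuant_twist_smul σ s t)

theorem twistedWeyl_smul_eq (s : TestPair c) : (fun t : ℝ => twistedWeyl σ π (t • s)) = fun t : ℝ =>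
    tensorOp (secondQuant (twistGroup σ s.1 t)) (π (weyl (sympl c) (t • s))) :=
  funext (twistedWeyl_smul σ s)

theorem isUnitaryGroup_twistedWeyl (hreg : IsRegular π) (s : TestPair c) :
    IsUnitaryGroup fun t : ℝ => twistedWeyl σ π (t • s) :=
  (congrArg IsUnitaryGroup (twistedWeyl_smul_eq σ s)).mpr
    ((isUnitaryGroup_twistGroup σ s.1).secondQuant.tensor (isUnitaryGroup_weyl hreg s))

/-- The bridge from closures to groups: the two core arguments combine, and later statements about
the field become statements about `twistedWeyl`. -/
theorem twistedField_eq (hreg : IsRegular π) (s : TestPair c) :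
    twistedField σ π s = stoneGenerator fun t : ℝ => twistedWeyl σ π (t • s) :=
  (congrArg (fun A => tensorSum A (bosonField π s)) (diffSecondQuant_twistGenerator σ s.1)).trans
    ((tensorSum_stoneGenerator (isUnitaryGroup_twistGroup σ s.1).secondQuant
      (isUnitaryGroup_weyl hreg s)).trans
        (congrArg stoneGenerator (twistedWeyl_smul_eq σ s)).symm)

theorem expI_twistedField (hreg : IsRegular π) (s : TestPair c) :
    expI (twistedField σ π s) = twistedWeyl σ π s :=
  (congrArg expI (twistedField_eq σ hreg s)).trans
    ((isUnitaryGroup_twistedWeyl σ hreg s).expI_stoneGenerator.trans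
      (congrArg (twistedWeyl σ π) (one_smul ℝ s)))

theorem isSelfAdjoint_twistedField (hreg : IsRegular π) (s : TestPair c) :
    IsSelfAdjoint (twistedField σ π s) :=
  (congrArg IsSelfAdjoint (twistedField_eq σ hreg s)).mpr
    (isUnitaryGroup_twistedWeyl σ hreg s).isSelfAdjoint_stoneGenerator

theorem mem_graph_twistedField (hreg : IsRegular π) (s : TestPair c) {p : TotalSpace K × TotalSpace K} :
    p ∈ (twistedField σ π s).graph ↔
      p ∈ (stoneGenerator fun t : ℝ => twistedWeyl σ π (t • s)).graph :=
  iff_of_eq (congrArg (fun A => p ∈ LinearPMap.graph A) (twistedField_eq σ hreg s))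

variable (π)

theorem twistedWeyl_mul_twistedWeyl (s s' : TestPair c) :
    twistedWeyl σ π s * twistedWeyl σ π s' =
      weylPhase (sympl c) s s' • twistedWeyl σ π (s + s') :=
  tensorOp_weyl_mul (u := fun s : TestPair c => secondQuant (twist σ s.1))
    (isAlternatingForm_sympl c) (fun s t => secondQuant_twist_add σ s.1 t.1) π s s'

/-- The phases `e^{±iη/2}` of the two orderings differ by `e^{iη}`, as `η` is antisymmetric. -/
theorem twistedWeyl_commutation (s s' : TestPair c) :
    twistedWeyl σ π s * twistedWeyl σ π s' =
      Complex.exp (Complex.I * (sympl c s s' : ℂ)) • (twistedWeyl σ π s' * twistedWeyl σ π s) := by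
  refine smul_mul_comm_of_weyl (twistedWeyl_mul_twistedWeyl σ π s s')
    ((twistedWeyl_mul_twistedWeyl σ π s' s).trans
      (congrArg (fun r => weylPhase (sympl c) s' s • twistedWeyl σ π r) (add_comm s' s))) ?_
  rw [weylPhase, weylPhase, (isAlternatingForm_sympl c).swap s s', ← Complex.exp_add]
  congr 1
  push_cast
  ring

variable {π}

theorem twistedField_commutator (hreg : IsRegular π) (s s' : TestPair c)
    {v v₁ v₂ v₁₂ v₂₁ : TotalSpace K}
    (h₁ : (v, v₁) ∈ (twistedField σ π s).graph) (h₂ : (v, v₂) ∈ (twistedField σ π s').graph)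
    (h₁₂ : (v₂, v₁₂) ∈ (twistedField σ π s).graph)
    (h₂₁ : (v₁, v₂₁) ∈ (twistedField σ π s').graph) :
    v₁₂ - v₂₁ = (-Complex.I * (sympl c s s' : ℂ)) • v := by
  have h : ∀ t r : ℝ, twistedWeyl σ π (t • s) * twistedWeyl σ π (r • s') =
      Complex.exp (Complex.I * (sympl c s s' * t * r : ℝ)) •
        (twistedWeyl σ π (r • s') * twistedWeyl σ π (t • s)) := fun t r =>
    (twistedWeyl_commutation σ π (t • s) (r • s')).trans
      (congrArg (fun x : ℝ => Complex.exp (Complex.I * (x : ℂ)) •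
        (twistedWeyl σ π (r • s') * twistedWeyl σ π (t • s))) (sympl_smul_smul c t r s s'))
  exact IsUnitaryGroup.commutator_of_weyl (isUnitaryGroup_twistedWeyl σ hreg s)
    (isUnitaryGroup_twistedWeyl σ hreg s') h ((mem_graph_twistedField σ hreg s).mp h₁)
    ((mem_graph_twistedField σ hreg s').mp h₂) ((mem_graph_twistedField σ hreg s).mp h₁₂)
    ((mem_graph_twistedField σ hreg s').mp h₂₁)

theorem twistedWeyl_mul_dirac (s : TestPair c) (t : ℝ) (w : HPlus) :
    twistedWeyl σ π (t • s) * dirac K w =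
      dirac K (phaseOp (conv σ s.1) (continuous_conv σ s.1) (-t) w) *
        twistedWeyl σ π (t • s) :=
  have h := tensorOp_commutation (secondQuant_mul_fockDirac σ s.1 t w) (π (weyl (sympl c) (t • s)))
  (congrArg (fun T => T * dirac K w) (twistedWeyl_smul σ s t)).trans (h.trans
    (congrArg (fun T => dirac K (phaseOp (conv σ s.1) (continuous_conv σ s.1) (-t) w) * T)
      (twistedWeyl_smul σ s t)).symm)

/-- The derivative at `t = 0` of the covariance relation `T(ts) ψ(w) = ψ(e^{-itσ⋆s_0} w) T(ts)`. The
hypothesis on `w'` places `w` in the domain of multiplication by `σ⋆s_0`, so one lemma serves both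
test spinors and the gauge field. -/
theorem dirac_mem_graph_twistedField (hreg : IsRegular π) (s : TestPair c) {w w' : HPlus}
    (hw : w' =ᵐ[volume] fun x => (conv σ s.1 x : ℂ) • w x) {v v₁ : TotalSpace K}
    (hv : (v, v₁) ∈ (twistedField σ π s).graph) :
    (dirac K w v, dirac K w v₁ - dirac K w' v) ∈ (twistedField σ π s).graph := by
  refine (mem_graph_twistedField σ hreg s).mpr ?_
  have h : ∀ (t : ℝ) (w : HPlus), twistedWeyl σ π (t • s) * diracL K w =
      diracL K (phaseOp (conv σ s.1) (continuous_conv σ s.1) (-t) w) * twistedWeyl σ π (t • s) := by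
    intro t w
    simp only [diracL_apply]
    exact twistedWeyl_mul_dirac σ s t w
  have h2 := (isUnitaryGroup_twistedWeyl σ hreg s).mem_graph_of_covariant
    (isUnitaryGroup_phaseOp (continuous_conv σ s.1)) h
    (mem_graph_phaseOp (continuous_conv σ s.1) hw) ((mem_graph_twistedField σ hreg s).mp hv)
  simpa only [diracL_apply] using h2

theorem expI_mul_dirac (hreg : IsRegular π) (s : TestPair c) (w : HPlus) :
    expI (twistedField σ π s) * dirac K w =
      dirac K (phaseOp (conv σ s.1) (continuous_conv σ s.1) (-1) w) * expI (twistedField σ π s) := by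
  have h := twistedWeyl_mul_dirac (π := π) σ s 1 w
  have e : twistedWeyl σ π ((1 : ℝ) • s) = expI (twistedField σ π s) :=
    (congrArg (twistedWeyl σ π) (one_smul ℝ s)).trans (expI_twistedField σ hreg s).symm
  exact (congrArg (fun T => T * dirac K w) e).symm.trans (h.trans
    (congrArg (fun T => dirac K (phaseOp (conv σ s.1) (continuous_conv σ s.1) (-1) w) * T) e))

theorem expI_mul_dirac_mul_expI (hreg : IsRegular π) (s : TestPair c) (w : HPlus) :
    expI (twistedField σ π s) * dirac K w * expI (-twistedField σ π s) =
      dirac K (phaseOp (conv σ s.1) (continuous_conv σ s.1) (-1) w) :=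
  (congrArg (fun A => expI A * dirac K w * expI (-A)) (twistedField_eq σ hreg s)).trans
    ((isUnitaryGroup_twistedWeyl σ hreg s).expI_mul_expI_neg (twistedWeyl_mul_dirac σ s 1 w))

end TwistedField

end

end TwistedFieldModel

namespace TwistedFieldModel

noncomputable section

/-! ### Essential supports and multiplication operators -/

section EssentialSupport

variable {w : HPlus} {m : Space → ℂ}

/-- Each point off the support has a null neighbourhood, and a locally null set in a second
countable space is null. -/
theorem ae_eq_zero_of_notMem_essSupport (w : HPlus) :
    ∀ᵐ x ∂(volume : Measure Space), x ∉ essSupport w → w x = 0 := by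
  have h : volume {x | x ∉ essSupport w ∧ w x ≠ 0} = 0 := by
    refine measure_null_of_locally_null _ ?_
    rintro x ⟨hx, -⟩
    simp only [essSupport, Set.mem_ofPred_eq, not_forall, not_not] at hx
    obtain ⟨U, hU, hw⟩ := hx
    obtain ⟨V, hVU, hV, hxV⟩ := mem_nhds_iff.mp hU
    have h1 := (ae_restrict_iff' hV.measurableSet).mp (ae_restrict_of_ae_restrict_of_subset hVU hw)
    refine ⟨{x | ¬(x ∈ V → w x = (0 : Space → Spinor) x)}, ?_, h1⟩
    filter_upwards [self_mem_nhdsWithin, mem_nhdsWithin_of_mem_nhds (hV.mem_nhds hxV)] with y hy hyV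
    exact fun hc => hy.2 (hc hyV)
  rw [ae_iff]
  refine measure_mono_null (fun x hx => ?_) h
  simpa only [Set.mem_ofPred_eq, Classical.not_imp] using hx

theorem mulL2_eq_self (h : ∀ x ∈ essSupport w, m x = 1) : mulL2 m w = w := by
  have hae : w =ᵐ[volume] fun x => m x • w x := by
    filter_upwards [ae_eq_zero_of_notMem_essSupport w] with x hx
    by_cases hs : x ∈ essSupport w
    · rw [h x hs, one_smul]
    · rw [hx hs, smul_zero]
  exact mulL2_eq_of_ae ((Lp.memLp w).ae_eq hae) hae

theorem mulL2_eq_zero (h : ∀ x ∈ essSupport w, m x = 0) : mulL2 m w = 0 := by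
  have hae : (0 : HPlus) =ᵐ[volume] fun x => m x • w x := by
    filter_upwards [ae_eq_zero_of_notMem_essSupport w, Lp.coeFn_zero Spinor 2 volume] with x hx h0
    rw [h0, Pi.zero_apply]
    by_cases hs : x ∈ essSupport w
    · rw [h x hs, zero_smul]
    · rw [hx hs, smul_zero]
  exact mulL2_eq_of_ae ((Lp.memLp (0 : HPlus)).ae_eq hae) hae

/-- The function `σ⋆s_0` is continuous but may be unbounded; compact support of the spinor keeps the
product in `L²`. -/
theorem IsTestSpinor.mem_mulDomain (hw : IsTestSpinor w) (hm : Continuous m) : w ∈ mulDomain m := by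
  obtain ⟨g, hg, hc, hwg⟩ := hw
  have h := (hm.smul hg.continuous).memLp_of_hasCompactSupport (p := 2) (μ := volume)
    (hc.smul_left (f := m))
  refine MemLp.ae_eq ?_ h
  filter_upwards [hwg] with x hx
  rw [hx]
  rfl

theorem exists_norm_schwartz_le (f : 𝓢(Space, ℝ)) : ∃ C : ℝ, ∀ x, ‖(f x : ℂ)‖ ≤ C := by
  obtain ⟨C, hC⟩ := f.decay 0 0
  exact ⟨C, fun x => by simpa using hC.2 x⟩

theorem twist_eq_self {σ : Distr} {f : 𝓢(Space, ℝ)} {z : OneParticle}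
    (h : ∀ x ∈ essSupport z.fst ∪ essSupport z.snd, conv σ f x = 0) : twist σ f z = z := by
  rw [twist, mulL2_eq_self fun x hx => by rw [h x (Or.inl hx)]; simp,
    mulL2_eq_self fun x hx => by rw [h x (Or.inr hx)]; simp]
  rfl

end EssentialSupport

/-! ### Localization of the twist -/

section Locality

variable {σ : Distr} {f : 𝓢(Space, ℝ)}

theorem inner_wedge_secondQuant_twist {n : ℕ} {z : Fin n → OneParticle}
    (hz : ‖(wedge z : Fock OneParticle)‖ = 1) (h : ∀ x ∈ suppProduct z, conv σ f x = 0) :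
    ⟪wedge z, secondQuant (twist σ f) (wedge z)⟫_ℂ = 1 := by
  have h1 : (fun i => twist σ f (z i)) = z := funext fun i =>
    twist_eq_self fun x hx => h x (Set.mem_iUnion.mpr ⟨i, hx⟩)
  have h2 : secondQuant (twist σ f) (wedge z) = wedge z :=
    (secondQuant_wedge (inner_twist σ f) z).trans (congrArg wedge h1)
  have h3 : ⟪wedge z, wedge z⟫_ℂ = 1 := by
    rw [inner_self_eq_norm_sq_to_K, hz]
    simp
  exact (congrArg (fun v => ⟪wedge z, v⟫_ℂ) h2).trans h3

theorem conv_eq_zero_of_disjoint {A B : Set Space} (hA : tsupport f ⊆ A)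
    (h : Disjoint A (B - Distribution.dsupport σ)) : ∀ x ∈ B, conv σ f x = 0 := fun _ hx =>
  conv_eq_zero fun _ hy hxy => Set.disjoint_left.mp h (hA hxy) (Set.sub_mem_sub hx hy)

theorem disjoint_sub_of_neg_mem {A B D : Set Space} (hD : ∀ y ∈ D, -y ∈ D)
    (h : Disjoint A (B + D)) : Disjoint A (B - D) := by
  refine h.mono_right ?_
  rintro _ ⟨x, hx, y, hy, rfl⟩
  exact ⟨x, hx, -y, hD y hy, (sub_eq_add_neg x y).symm⟩

end Locality

/-! ### Local gauge transformations and assembly of the charged state -/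

section GaugeField

variable {c : TestClass} {K : Type*} [NormedAddCommGroup K] [InnerProductSpace ℂ K]
  [CompleteSpace K] {σ : Distr} {π : WeylAlgebra (sympl c) →⋆ₐ[ℂ] (K →L[ℂ] K)}
  {P : MvPolynomial (Fin 3) ℝ}

theorem conv_diffOpPair (hP : IsFundamentalSolution P σ) (s : TestPair c) :
    conv σ (diffOpPair P s).1 = (s.1 : 𝓢(Space, ℝ)) :=
  funext fun x => conv_diffOp hP _ x

theorem phaseOp_diffOpPair (hP : IsFundamentalSolution P σ) (s : TestPair c) (w : HPlus) :
    phaseOp (conv σ (diffOpPair P s).1) (continuous_conv σ _) (-1) w =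
      mulL2 (fun x => Complex.exp (-Complex.I * ((s.1 : 𝓢(Space, ℝ)) x : ℂ))) w := by
  rw [phaseOp_apply, conv_diffOpPair hP]
  congr 1
  ext x
  congr 1
  push_cast
  ring

/-- Here `σ ⋆ P_∂ s_0 = s_0` is bounded, so every `w ∈ L²` is admissible and not only test spinors.
-/
theorem dirac_mem_graph_gaugeField (hreg : IsRegular π) (hP : IsFundamentalSolution P σ)
    (s : TestPair c) (w : HPlus) {v v₁ : TotalSpace K}
    (hv : (v, v₁) ∈ (gaugeField σ π P s).graph) :
    (dirac K w v,
      dirac K w v₁ - dirac K (mulL2 (fun x => ((s.1 : 𝓢(Space, ℝ)) x : ℂ)) w) v) ∈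
        (gaugeField σ π P s).graph := by
  refine dirac_mem_graph_twistedField σ hreg (diffOpPair P s) ?_ hv
  rw [conv_diffOpPair hP]
  obtain ⟨C, hC⟩ := exists_norm_schwartz_le s.1
  exact coeFn_mulL2 (mem_mulDomain_of_bounded
    (Complex.continuous_ofReal.comp (s.1 : 𝓢(Space, ℝ)).continuous) hC w)

theorem expI_gaugeField_mul_dirac (hreg : IsRegular π) (hP : IsFundamentalSolution P σ)
    (s : TestPair c) (w : HPlus) :
    expI (gaugeField σ π P s) * dirac K w * expI (-gaugeField σ π P s) =
      dirac K (mulL2 (fun x => Complex.exp (-Complex.I * ((s.1 : 𝓢(Space, ℝ)) x : ℂ))) w) :=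
  (expI_mul_dirac_mul_expI σ hreg (diffOpPair P s) w).trans
    (congrArg (dirac K) (phaseOp_diffOpPair hP s w))

theorem eq_zero_of_mem_essSupport {s : TestPair c} {A : Set Space} (h : Disjoint (suppPair s) A)
    {x : Space} (hx : x ∈ A) : (s.1 : 𝓢(Space, ℝ)) x = 0 :=
  image_eq_zero_of_notMem_tsupport fun hs => Set.disjoint_left.mp h (Or.inl hs) hx

theorem dirac_mem_graph_gaugeField_of_disjoint (hreg : IsRegular π)
    (hP : IsFundamentalSolution P σ) {s : TestPair c} {w : HPlus}
    (h : Disjoint (suppPair s) (essSupport w)) {v v₁ : TotalSpace K}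
    (hv : (v, v₁) ∈ (gaugeField σ π P s).graph) :
    (dirac K w v, dirac K w v₁) ∈ (gaugeField σ π P s).graph := by
  have h1 := dirac_mem_graph_gaugeField hreg hP s w hv
  have h2 : mulL2 (fun x => ((s.1 : 𝓢(Space, ℝ)) x : ℂ)) w = 0 :=
    mulL2_eq_zero fun x hx => by rw [eq_zero_of_mem_essSupport h hx]; simp
  have h3 : dirac K (mulL2 (fun x => ((s.1 : 𝓢(Space, ℝ)) x : ℂ)) w) = 0 :=
    (congrArg (dirac K) h2).trans ((diracL_apply K 0).symm.trans (map_zero (diracL K)))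
  have h4 : dirac K w v₁ - dirac K (mulL2 (fun x => ((s.1 : 𝓢(Space, ℝ)) x : ℂ)) w) v =
      dirac K w v₁ :=
    (congrArg (fun T : TotalSpace K →L[ℂ] TotalSpace K => dirac K w v₁ - T v) h3).trans
      (sub_zero _)
  exact (congrArg (fun y => (dirac K w v, y) ∈ (gaugeField σ π P s).graph) h4).mp h1

theorem commute_expI_gaugeField (hreg : IsRegular π) (hP : IsFundamentalSolution P σ)
    {s : TestPair c} {w : HPlus} (h : Disjoint (suppPair s) (essSupport w)) :
    Commute (expI (gaugeField σ π P s)) (dirac K w) := by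
  have h1 := expI_mul_dirac (π := π) σ hreg (diffOpPair P s) w
  have h2 : phaseOp (conv σ (diffOpPair P s).1) (continuous_conv σ _) (-1) w = w :=
    (phaseOp_diffOpPair hP s w).trans
      (mulL2_eq_self fun x hx => by rw [eq_zero_of_mem_essSupport h hx]; simp)
  exact h1.trans (congrArg (fun w => dirac K w * expI (gaugeField σ π P s)) h2)

theorem exists_chargedState_twisted {ω : WeylAlgebra (sympl c) →ₗ[ℂ] ℂ} (hone : ω 1 = 1) {Ωb : K}
    (hω : ∀ a, ω a = ⟪Ωb, π a Ωb⟫_ℂ) {x : Fock OneParticle} (hx : ‖x‖ = 1) :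
    ∃ ω' : WeylAlgebra (sympl c) →ₗ[ℂ] ℂ, IsState ω' ∧
      (∀ s : TestPair c, ω' (weyl (sympl c) s) =
        ⟪x, secondQuant (twist σ s.1) x⟫_ℂ * ω (weyl (sympl c) s)) ∧
      ∃ (π' : WeylAlgebra (sympl c) →⋆ₐ[ℂ] BoundedOp (cyclicSpace σ π (tmul x Ωb)))
        (Ω' : cyclicSpace σ π (tmul x Ωb)),
        (Ω' : TotalSpace K) = tmul x Ωb ∧
        (∀ (s : TestPair c) (v : cyclicSpace σ π (tmul x Ωb)),
          (π' (weyl (sympl c) s) v : TotalSpace K) = twistedWeyl σ π s v) ∧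
        IsGNSTriple ω' π' Ω' :=
  exists_chargedState (u := fun s : TestPair c => secondQuant (twist σ s.1))
    (isAlternatingForm_sympl c) (fun s t => secondQuant_twist_add σ s.1 t.1)
    ((congrArg secondQuant (twist_zero σ)).trans secondQuant_id)
    (fun s => inner_secondQuant (inner_twist σ s.1))
    (fun s => star_secondQuant_twist σ s.1) hx hone hω (cyclicSpace σ π (tmul x Ωb)) rfl

end GaugeField

end

end TwistedFieldModel

open TwistedFieldModel in
theorem mainTheorem1 (c : TestClass) (σ : Distr)
    (ω : WeylAlgebra (sympl c) →ₗ[ℂ] ℂ) (hω : IsState ω)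
    {K : Type*} [NormedAddCommGroup K] [InnerProductSpace ℂ K] [CompleteSpace K]
    (π : WeylAlgebra (sympl c) →⋆ₐ[ℂ] (K →L[ℂ] K)) (Ωb : K)
    (hGNS : IsGNSTriple ω π Ωb) (hreg : IsRegular π) :
    -- the canonical anticommutation relations of the Dirac field
    (∀ w w' : HPlus,
      dirac K w * dirac K w' + dirac K w' * dirac K w = 0 ∧
      dirac K w * star (dirac K w') + star (dirac K w') * dirac K w = ⟪w', w⟫_ℂ • 1) ∧
    -- the twisted field is self-adjoint and generates the twisted Weyl operators
    (∀ s : TestPair c,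
      IsSelfAdjoint (twistedField σ π s) ∧
      expI (twistedField σ π s) = twistedWeyl σ π s) ∧
    -- the canonical commutation relations of the twisted field, in exponentiated and in
    -- infinitesimal form
    (∀ s s' : TestPair c,
      expI (twistedField σ π s) * expI (twistedField σ π s') =
        Complex.exp (Complex.I * (sympl c s s' : ℂ) / 2) • expI (twistedField σ π (s + s')) ∧
      ∀ v v₁ v₂ v₁₂ v₂₁ : TotalSpace K,
        (v, v₁) ∈ (twistedField σ π s).graph → (v, v₂) ∈ (twistedField σ π s').graph →
        (v₂, v₁₂) ∈ (twistedField σ π s).graph → (v₁, v₂₁) ∈ (twistedField σ π s').graph →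
        v₁₂ - v₂₁ = (-Complex.I * (sympl c s s' : ℂ)) • v) ∧
    -- `[φ^λ(s), ψ(w)] = -ψ(σ⋆s_0 · w)` on the domain of `φ^λ(s)`
    (∀ (s : TestPair c) (w : HPlus), IsTestSpinor w →
      ∀ v v₁ : TotalSpace K, (v, v₁) ∈ (twistedField σ π s).graph →
        (dirac K w v,
          dirac K w v₁ - dirac K (mulL2 (fun x => (conv σ s.1 x : ℂ)) w) v) ∈
            (twistedField σ π s).graph) ∧
    -- the generator of local gauge transformations
    (∀ P : MvPolynomial (Fin 3) ℝ, IsFundamentalSolution P σ →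
      ∀ (s : TestPair c) (w : HPlus),
        (∀ v v₁ : TotalSpace K, (v, v₁) ∈ (gaugeField σ π P s).graph →
          (dirac K w v,
            dirac K w v₁ - dirac K (mulL2 (fun x => ((s.1 : 𝓢(Space, ℝ)) x : ℂ)) w) v) ∈
              (gaugeField σ π P s).graph) ∧
        expI (gaugeField σ π P s) * dirac K w * expI (-gaugeField σ π P s) =
          dirac K (mulL2 (fun x => Complex.exp (-Complex.I * ((s.1 : 𝓢(Space, ℝ)) x : ℂ))) w) ∧
        (Disjoint (suppPair s) (essSupport w) →
          (∀ v v₁ : TotalSpace K, (v, v₁) ∈ (gaugeField σ π P s).graph →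
            (dirac K w v, dirac K w v₁) ∈ (gaugeField σ π P s).graph) ∧
          Commute (expI (gaugeField σ π P s)) (dirac K w))) ∧
    -- the charged states, their GNS representations and their localization
    (∀ (q : ℤ) (n : ℕ) (f : Fin n → OneParticle), IsProductOfCharge q f →
      ‖(wedge f : Fock OneParticle)‖ = 1 →
      ∃ ω' : WeylAlgebra (sympl c) →ₗ[ℂ] ℂ, IsState ω' ∧
        (∀ s : TestPair c, ω' (weyl (sympl c) s) =
          ⟪wedge f, secondQuant (twist σ s.1) (wedge f)⟫_ℂ * ω (weyl (sympl c) s)) ∧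
        (∃ (π' : WeylAlgebra (sympl c) →⋆ₐ[ℂ]
              BoundedOp (cyclicSpace σ π (tmul (wedge f) Ωb)))
            (Ω' : cyclicSpace σ π (tmul (wedge f) Ωb)),
          (Ω' : TotalSpace K) = tmul (wedge f) Ωb ∧
          (∀ (s : TestPair c) (v : cyclicSpace σ π (tmul (wedge f) Ωb)),
            (π' (weyl (sympl c) s) v : TotalSpace K) = twistedWeyl σ π s v) ∧
          IsGNSTriple ω' π' Ω') ∧
        (∀ s : TestPair c,
          Disjoint (suppPair s) (suppProduct f - Distribution.dsupport σ) →
          ω' (weyl (sympl c) s) = ω (weyl (sympl c) s)) ∧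
        ((∀ y ∈ Distribution.dsupport σ, -y ∈ Distribution.dsupport σ) →
          ∀ s : TestPair c, Disjoint (suppPair s) (suppProduct f + Distribution.dsupport σ) →
            ω' (weyl (sympl c) s) = ω (weyl (sympl c) s)) ∧
        (∀ P : MvPolynomial (Fin 3) ℝ, IsFundamentalSolution P σ →
          ∀ s : TestPair c, Disjoint (suppPair s) (suppProduct f) →
            ω' (weyl (sympl c) (diffOpPair P s)) = ω (weyl (sympl c) (diffOpPair P s)))) := by
  refine ⟨fun w w' => ⟨dirac_anticommute K w w', dirac_anticommute_star K w w'⟩,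
    fun s => ⟨isSelfAdjoint_twistedField σ hreg s, expI_twistedField σ hreg s⟩,
    fun s s' => ⟨?_, fun v v₁ v₂ v₁₂ v₂₁ => twistedField_commutator σ hreg s s'⟩,
    fun s w hw v v₁ hv => dirac_mem_graph_twistedField σ hreg s
      (coeFn_mulL2 (hw.mem_mulDomain
        (Complex.continuous_ofReal.comp (continuous_conv σ s.1)))) hv,
    fun P hP s w => ⟨fun v v₁ hv => dirac_mem_graph_gaugeField hreg hP s w hv,
      expI_gaugeField_mul_dirac hreg hP s w,
      fun h => ⟨fun v v₁ hv => dirac_mem_graph_gaugeField_of_disjoint hreg hP h hv,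
        commute_expI_gaugeField hreg hP h⟩⟩, fun q n f _ hf => ?_⟩
  · exact (congrArg₂ (· * ·) (expI_twistedField σ hreg s) (expI_twistedField σ hreg s')).trans
      ((twistedWeyl_mul_twistedWeyl σ π s s').trans
        (congrArg (weylPhase (sympl c) s s' • ·) (expI_twistedField σ hreg (s + s')).symm))
  · have h := exists_chargedState_twisted (σ := σ) hω.normalized hGNS.apply hf
    refine Exists.elim h fun ω' h => ?_
    -- All three localization statements reduce to the vanishing of `σ⋆s_0` on the support of the
    -- product vector. In the last one it is immediate, as the convolution is `s_0` itself.
    have hloc : ∀ s : TestPair c, (∀ x ∈ suppProduct f, conv σ s.1 x = 0) →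
        ω' (weyl (sympl c) s) = ω (weyl (sympl c) s) := fun s hs =>
      (h.2.1 s).trans ((congrArg (· * ω (weyl (sympl c) s))
        (inner_wedge_secondQuant_twist hf hs)).trans (one_mul _))
    exact Exists.intro ω' ⟨h.1, h.2.1, h.2.2,
      fun s hs => hloc s (conv_eq_zero_of_disjoint Set.subset_union_left hs),
      fun hσ s hs => hloc s (conv_eq_zero_of_disjoint Set.subset_union_left
        (disjoint_sub_of_neg_mem hσ hs)),
      fun P hP s hs => hloc _ fun x hx => (congrFun (conv_diffOpPair hP s) x).trans
        (eq_zero_of_mem_essSupport hs hx)⟩
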